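/- **Setting.** For every $n\ge 1$ let $p=p_n$ and suppose that $$y_i=\beta_0+\mathbf x_i^\top\boldsymbol\beta_{\mathcal M}+\mathbf u_i^\top\boldsymbol\beta_{\mathcal I}+\varepsilon_i,\qquad 1\le i\le n,$$ where $\mathbf x_i\in\mathbb R^p$, $\mathbf u_i=\big(x_{ij}x_{ik}-\mathrm E(x_{ij}x_{ik})\big)_{j\le k}$ is the vector of centered order-2 terms, $\boldsymbol\beta_{\mathcal M}=(\beta_j)_{j\le p}$ and $\boldsymbol\beta_{\mathcal I}=(\beta_{j,k})_{j\le k}$, with the convention $\beta_{k,j}=\beta_{j,k}$ (the centered model is the case $\beta_0=0$). Let $\mathcal S=\{j:\beta_j^2+\sum_k\beta_{j,k}^2>0\}$ and $s=|\mathcal S|\ge1$. Let $\Sigma$ be the covariance matrix of $\mathbf x_i$, let $\tau^2=\mathrm{Var}(\mathbf u_i^\top\boldsymbol\beta_{\mathcal I})$ and $\sigma^2=\mathrm{Var}(\varepsilon_i)$, and let $\mathbf B$ be the symmetric $p\times p$ matrix with $B_{jj}=\beta_{j,j}$ and $B_{jk}=\beta_{j,k}/2$ for $j\ne k$ (so $\mathbf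 B$ is supported in $\mathcal S\times\mathcal S$). All these objects, including the distributions of $\mathbf x_i$ and $\varepsilon_i$, may depend on $n$. The constants $b>0$, $\gamma\in(0,1]$, $C_{\min}>0$ and $C_{\mathbf B}>0$ do not. **Assumptions.** * (SG) $\mathbf x_1,\dots,\mathbf x_n$ are i.i.d. from an elliptical distribution whose coordinates are $b$-subgaussian; $\varepsilon_1,\dots,\varepsilon_n$ are i.i.d. $b$-subgaussian and independent of $(\mathbf x_i)_{i\le n}$. Here $Z$ is $b$-subgaussian if $\mathrm E\,e^{tZ}\le e^{b^2t^2/2}$ for all $t\in\mathbb R$. * (C1) $\|\Sigma_{\mathcal S^c\mathcal S}(\Sigma_{\mathcal S\mathcal S})^{-1}\|_\infty\le1-\gamma$, where $\|A\|_\infty=\max_i\sum_j|A_{ij}|$. * (C2) $\Lambda_{\min}(\Sigma_{\mathcal S\mathcal S})\ge C_{\min}$. * (C3) $s\log p=o(n)$ and $s(\log s)^{1/2}=o(n^{1/3})$. * (C4) $\Lambda_{\max}(\mathbf B^2)\le C_{\mathbf B}^2$. Let $\lambda_n>0$ satisfy $\lambda_n\gg\tau(\log p/n)^{1/2}$ and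 also $\lambda_n\gg\sigma(\log p/n)^{1/2}$ (the latter follows from the former when $\sigma=O(\tau)$, for instance when $\tau$ is bounded away from $0$). **Theorem.** With probability tending to $1$ as $n\to\infty$, the Stage-1 LASSO problem $$\min_{(\theta_0,\boldsymbol\theta)\in\mathbb R\times\mathbb R^p}\ \frac1{2n}\sum_{i=1}^n\big(y_i-\theta_0-\mathbf x_i^\top\boldsymbol\theta\big)^2+\lambda_n\|\boldsymbol\theta\|_1$$ has a unique solution $(\hat\beta_{0L},\hat{\boldsymbol\beta}_L)$, the support of $\hat{\boldsymbol\beta}_L$ is contained in $\mathcal S$, and, if $$\beta_{\min}=\min_{j\in\mathcal S}|\beta_j|>\frac{2\big(s^{-1/2}+\|\boldsymbol\beta_{\mathcal I}\|_2/s+\lambda_ns^{1/2}\big)}{C_{\min}},$$ then $\mathrm{sign}(\hat{\boldsymbol\beta}_L)=\mathrm{sign}(\boldsymbol\beta_{\mathcal M})$. -/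

import Mathlib

open MeasureTheory ProbabilityTheory Filter Asymptotics
open scoped NNReal Topology Matrix

noncomputable section

namespace QuadLasso

/-! ### Elliptical distributions and the sampling condition -/

/-- The uniform distribution on the unit sphere of `ℝᵏ`: the law of `g / ‖g‖`, where `g` is a
standard Gaussian vector. -/
def uniformSphere (k : ℕ) : Measure (EuclideanSpace ℝ (Fin k)) :=
  (stdGaussian (EuclideanSpace ℝ (Fin k))).map (fun g => ‖g‖⁻¹ • g)

/-- `ν` is elliptical: it is the law of `m + R • A u`, where `u` is uniform on the unit sphere of
some `ℝᵏ`, `R ≥ 0` is a real random variable independent of `u`, `m` is a fixed vector and `A` is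
a fixed `d × k` matrix. No density and no invertibility of the scatter matrix are required. -/
def IsElliptical {d : ℕ} (ν : Measure (Fin d → ℝ)) : Prop :=
  ∃ (k : ℕ) (m : Fin d → ℝ) (A : Matrix (Fin d) (Fin k) ℝ) (ρ : Measure ℝ),
    IsProbabilityMeasure ρ ∧ (∀ᵐ r ∂ρ, 0 ≤ r) ∧
      ν = (ρ.prod (uniformSphere k)).map (fun z => m + z.1 • (A *ᵥ (z.2 : Fin k → ℝ)))

/-- The random mechanism for one sample of size `n`: the rows `x i` are i.i.d. from an elliptical
distribution `ν` with `b`-subgaussian marginals, the errors `ε i` are i.i.d. from a `b`-subgaussian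
distribution `η`, and the errors are independent of the rows. Here `Z` is `b`-subgaussian when
`E exp (t Z) ≤ exp (b² t² / 2)` for all real `t`. -/
structure ConditionSG {n d : ℕ} {Ω : Type*} [MeasurableSpace Ω] (b : ℝ≥0) (P : Measure Ω)
    (ν : Measure (Fin d → ℝ)) (η : Measure ℝ)
    (x : Fin n → Ω → Fin d → ℝ) (ε : Fin n → Ω → ℝ) : Prop where
  elliptical : IsElliptical ν
  subgaussian_marginal : ∀ j, HasSubgaussianMGF (fun v : Fin d → ℝ => v j) (b ^ 2) ν
  subgaussian_error : HasSubgaussianMGF (fun e : ℝ => e) (b ^ 2) η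
  law_x : ∀ i, HasLaw (x i) ν P
  law_error : ∀ i, HasLaw (ε i) η P
  indep_x : iIndepFun x P
  indep_error : iIndepFun ε P
  indep_x_error : IndepFun (fun ω i => x i ω) (fun ω i => ε i ω) P

/-! ### The quadratic model

The second order coefficients are indexed by unordered pairs `s(j, k)`, with `j = k` allowed, so
that the subscripts `(j, k)` and `(k, j)` are identical. -/

/-- The centered interaction effect `uᵀ β_I` at the covariate vector `v`, where the entry of `u`
at the pair `s(j, k)` is `v j * v k - E (X j * X k)`, with `X` distributed as `ν`. -/
def interactionEffect {d : ℕ} (ν : Measure (Fin d → ℝ)) (βI : Sym2 (Fin d) → ℝ)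
    (v : Fin d → ℝ) : ℝ :=
  ∑ z : Sym2 (Fin d), ((z.map v).mul - ∫ w, (z.map w).mul ∂ν) * βI z

/-- The response `β₀ + xᵀ β + uᵀ β_I + e`. -/
def response {d : ℕ} (ν : Measure (Fin d → ℝ)) (β₀ : ℝ) (β : Fin d → ℝ)
    (βI : Sym2 (Fin d) → ℝ) (v : Fin d → ℝ) (e : ℝ) : ℝ :=
  β₀ + ∑ j, v j * β j + interactionEffect ν βI v + e

/-- `τ`, the standard deviation of the interaction effect. -/
def interactionSD {d : ℕ} (ν : Measure (Fin d → ℝ)) (βI : Sym2 (Fin d) → ℝ) : ℝ :=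
  √(Var[interactionEffect ν βI; ν])

/-- `σ`, the standard deviation of the errors. -/
def errorSD (η : Measure ℝ) : ℝ := √(Var[fun e : ℝ => e; η])

/-- The important main effects, `S = {j : β_j² + ∑ₖ β_{j,k}² > 0}`. -/
def support {d : ℕ} (β : Fin d → ℝ) (βI : Sym2 (Fin d) → ℝ) : Finset (Fin d) :=
  Finset.univ.filter (fun j => 0 < β j ^ 2 + ∑ k, βI s(j, k) ^ 2)

/-- The Euclidean norm of `β_I`. -/
def interactionNorm {d : ℕ} (βI : Sym2 (Fin d) → ℝ) : ℝ := √(∑ z, βI z ^ 2)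

/-- The symmetric coefficient matrix `B`, with `B_{jj} = β_{j,j}` and `B_{jk} = β_{j,k} / 2` for
`j ≠ k`. Its nonzero entries automatically have both indices in `support β βI`. -/
def coefMatrix {d : ℕ} (βI : Sym2 (Fin d) → ℝ) : Matrix (Fin d) (Fin d) ℝ :=
  Matrix.of fun j k => if j = k then βI s(j, j) else βI s(j, k) / 2

/-! ### Covariance blocks -/

/-- The covariance matrix of `ν`. -/
def covMatrix {d : ℕ} (ν : Measure (Fin d → ℝ)) : Matrix (Fin d) (Fin d) ℝ :=
  Matrix.of fun j k => cov[fun v => v j, fun v => v k; ν]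

/-- The block `M_{SS}`. -/
def blockSS {d : ℕ} (M : Matrix (Fin d) (Fin d) ℝ) (S : Finset (Fin d)) :
    Matrix {j // j ∈ S} {j // j ∈ S} ℝ :=
  M.submatrix Subtype.val Subtype.val

/-- The block `M_{SᶜS}`. -/
def blockScS {d : ℕ} (M : Matrix (Fin d) (Fin d) ℝ) (S : Finset (Fin d)) :
    Matrix {j // j ∉ S} {j // j ∈ S} ℝ :=
  M.submatrix Subtype.val Subtype.val

/-- The largest absolute row sum, `‖A‖_∞ = maxᵢ ∑ⱼ |A i j|` (zero if there are no rows). -/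
def maxRowSum {ι κ : Type*} [Fintype ι] [Fintype κ] (A : Matrix ι κ ℝ) : ℝ :=
  ⨆ i, ∑ j, |A i j|

/-! ### The LASSO at stage 1 -/

/-- The LASSO criterion `(2n)⁻¹ ‖Y - 1 θ₀ - X θ‖² + lam ‖θ‖₁` with an unpenalized intercept. -/
def lassoObjective {n d : ℕ} (Y : Fin n → ℝ) (X : Fin n → Fin d → ℝ) (lam : ℝ)
    (θ : ℝ × (Fin d → ℝ)) : ℝ :=
  1 / (2 * (n : ℝ)) * ∑ i, (Y i - θ.1 - ∑ j, X i j * θ.2 j) ^ 2 + ∑ j, lam * |θ.2 j|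

/-- `θ = (θ₀, θ_M)` is a global minimizer of the LASSO criterion. -/
def IsLassoSolution {n d : ℕ} (Y : Fin n → ℝ) (X : Fin n → Fin d → ℝ) (lam : ℝ)
    (θ : ℝ × (Fin d → ℝ)) : Prop :=
  ∀ θ', lassoObjective Y X lam θ ≤ lassoObjective Y X lam θ'

/-- The signal strength bound `2 (s^{-1/2} + ‖β_I‖₂ / s + lam s^{1/2}) / C_min`, `s = |S|`. -/
def signalBound {d : ℕ} (β : Fin d → ℝ) (βI : Sym2 (Fin d) → ℝ) (lam Cmin : ℝ) : ℝ :=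
  2 * ((√((support β βI).card : ℝ))⁻¹ + interactionNorm βI / ((support β βI).card : ℝ)
    + lam * √((support β βI).card : ℝ)) / Cmin

/-- The LASSO has a unique solution, it is supported in `S`, and, if `min_{j ∈ S} |β_j|` exceeds
the signal strength bound, it has the same sign vector as `β`. -/
def LassoSucceeds {n d : ℕ} (β : Fin d → ℝ) (βI : Sym2 (Fin d) → ℝ) (lam Cmin : ℝ)
    (Y : Fin n → ℝ) (X : Fin n → Fin d → ℝ) : Prop :=
  ∃ θ : ℝ × (Fin d → ℝ),
    (IsLassoSolution Y X lam θ ∧ ∀ θ', IsLassoSolution Y X lam θ' → θ' = θ) ∧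
    (∀ j, j ∉ support β βI → θ.2 j = 0) ∧
    ((∀ j ∈ support β βI, signalBound β βI lam Cmin < |β j|) →
      ∀ j, SignType.sign (θ.2 j) = SignType.sign (β j))

end QuadLasso

end

open MeasureTheory ProbabilityTheory Filter Asymptotics
open scoped NNReal Topology Matrix ENNReal

noncomputable section

namespace QuadLasso

/-! ### Sign flips, Chernoff bounds and Gaussian decoupling -/

/-! The argument is a primal-dual witness construction in which concentration comes from the
symmetries of an elliptical law, since the coordinates of such a law are uncorrelated after
whitening but not independent.

Reduction. A subgaussian variable that is symmetric about `m` has `m = 0`, so the covariates are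
centered. Condition (C2) supplies a nondegenerate coordinate, which fixes the scale of the radial
part: the covariates become `⟪a j, w⟫` for a rotation invariant `w` with identity covariance and
functionals of variance proxy `b² / Cmin` (`exists_isIsotropic_of_isElliptical`), and the Gram
matrix of `a` is `Σ`. After a further rotation (`exists_adapted_coordinates`) the active covariates
involve only the coordinates of `w` in a set `T` with `|T| ≤ s`. The effective noise `W`, the
centered quadratic effect plus the error, then depends only on `w` restricted to `T` and on the
error, and it is even in `w`. The population regression residual of an inactive covariate on the
active ones is `⟪f, w⟫` with `f` vanishing on `T`.

Deterministic part (`lassoSucceeds_of_conditions`). Minimize the criterion over parameters supported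
in `S`. If the empirical Gram matrix of the intercept and the coordinates in `T` is close to the
identity, if `W` is nearly uncorrelated with these features, and if the residuals are nearly
uncorrelated with the features and with `W`, then the dual variable is strictly feasible off `S`,
which gives optimality, uniqueness and the support inclusion. The coefficient errors are read off by
pairing the stationarity equation with vectors dual to the active `a k`.

Inactive variables. Reflections that fix the coordinates in `T` preserve the law. Hence, given those
coordinates, the error and the mean square of the remaining coordinates, `⟪f, w⟫` is sub-Gaussian
(`IsIsotropic.lintegral_exp_sum_mul_inner_le`), and its tails survive a union over all `p`
variables. The conditional variance is an average of `W²` weighted by squared coordinates off `T`.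
It has to be of order `τ² + σ²`, because the tuning parameter dominates only that scale. This is
`IsIsotropic.integral_inner_sq_mul_centeredForm_sq_le`, whose proof uses that the quadratic form has
a zero eigenvalue. Such an eigenvalue exists unless `T` is everything, and in that case every `f` is
zero.

Active variables. The product of `W` with an active functional is odd in `w`, so flipping whole
observations gives conditional sub-Gaussian tails. Condition (C4) bounds the eighth moment of `W` by
a multiple of `s⁸`. A deviation of size `s^{-1/2}` then has exponent of order `n / s³`, and the
union over `s` variables is affordable because `s³ log s = o(n)`.

For every fixed `N` the failure probability is eventually at most `8 / N`, which gives the limit. -/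

/-- If the coordinates `Y l` change sign under measure preserving maps, while `F` is unchanged,
then `∑ Y l` is conditionally sub-Gaussian with variance proxy `∑ (Y l)²`. -/
theorem lintegral_mul_exp_sum_le_of_flips {Ω ι : Type*} [MeasurableSpace Ω] {μ : Measure Ω}
    [Fintype ι] [DecidableEq ι] (D : (ι → Bool) → Ω → Ω)
    (hD : ∀ ξ, MeasurePreserving (D ξ) μ μ) {F : Ω → ℝ≥0∞} (hF : Measurable F)
    (hFD : ∀ ξ ω, F (D ξ ω) = F ω) {Y : ι → Ω → ℝ} (hY : ∀ l, Measurable (Y l))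
    (hYD : ∀ ξ l ω, Y l (D ξ ω) = (if ξ l then 1 else -1) * Y l ω) :
    ∫⁻ ω, F ω * ENNReal.ofReal (Real.exp (∑ l, Y l ω)) ∂μ ≤
      ∫⁻ ω, F ω * ENNReal.ofReal (Real.exp ((∑ l, Y l ω ^ 2) / 2)) ∂μ := by
  have hmeas : Measurable fun ω => F ω * ENNReal.ofReal (Real.exp (∑ l, Y l ω)) := by fun_prop
  -- Every sign pattern gives the same integral. Summing over all patterns factorizes the
  -- exponential into `∏ 2 cosh (Y l)`, and `cosh y ≤ exp (y² / 2)` finishes; the factor `2 ^ card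
  -- ι` is cancelled only at the end.
  have key : ∀ ξ : ι → Bool, ∫⁻ ω, F ω * ENNReal.ofReal (Real.exp (∑ l, Y l ω)) ∂μ =
      ∫⁻ ω, F ω * ENNReal.ofReal (∏ l, Real.exp ((if ξ l then 1 else -1) * Y l ω)) ∂μ := by
    intro ξ
    rw [← (hD ξ).lintegral_comp hmeas]
    refine lintegral_congr fun ω => ?_
    rw [hFD, ← Real.exp_sum]
    simp only [hYD]
  have hsum : ∀ ω, ∑ ξ : ι → Bool, ∏ l, Real.exp ((if ξ l then 1 else -1) * Y l ω) =
      ∏ l, (2 * Real.cosh (Y l ω)) := by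
    intro ω
    have := Finset.prod_univ_sum (fun _ : ι => (Finset.univ : Finset Bool))
      (fun l (ε : Bool) => Real.exp ((if ε then 1 else -1) * Y l ω))
    rw [Fintype.piFinset_univ] at this
    rw [← this]
    refine Finset.prod_congr rfl fun l _ => ?_
    simp [Real.cosh_eq]
    ring
  have hle : ∀ ω, ∏ l, (2 * Real.cosh (Y l ω)) ≤
      2 ^ Fintype.card ι * Real.exp ((∑ l, Y l ω ^ 2) / 2) := by
    intro ω
    rw [Finset.prod_mul_distrib, Finset.prod_const, Finset.card_univ, Finset.sum_div, Real.exp_sum]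
    refine mul_le_mul_of_nonneg_left (Finset.prod_le_prod (fun l _ => (Real.cosh_pos _).le)
      fun l _ => Real.cosh_le_exp_half_sq _) (by positivity)
  have hN : (Fintype.card (ι → Bool) : ℝ≥0∞) = 2 ^ Fintype.card ι := by
    simp
  have h1 : (2 : ℝ≥0∞) ^ Fintype.card ι *
      ∫⁻ ω, F ω * ENNReal.ofReal (Real.exp (∑ l, Y l ω)) ∂μ ≤ (2 : ℝ≥0∞) ^ Fintype.card ι *
      ∫⁻ ω, F ω * ENNReal.ofReal (Real.exp ((∑ l, Y l ω ^ 2) / 2)) ∂μ := by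
    calc _ = ∑ ξ : ι → Bool, ∫⁻ ω, F ω *
          ENNReal.ofReal (∏ l, Real.exp ((if ξ l then 1 else -1) * Y l ω)) ∂μ := by
          rw [← Finset.sum_congr rfl fun ξ _ => key ξ, Finset.sum_const, Finset.card_univ,
            nsmul_eq_mul, hN]
      _ = ∫⁻ ω, ∑ ξ : ι → Bool, F ω *
          ENNReal.ofReal (∏ l, Real.exp ((if ξ l then 1 else -1) * Y l ω)) ∂μ := by
          rw [lintegral_finsetSum]
          intro ξ _
          refine hF.mul (ENNReal.measurable_ofReal.comp ?_)
          exact Finset.measurable_prod _ fun l _ =>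
            Real.measurable_exp.comp ((hY l).const_mul _)
      _ ≤ ∫⁻ ω, 2 ^ Fintype.card ι *
          (F ω * ENNReal.ofReal (Real.exp ((∑ l, Y l ω ^ 2) / 2))) ∂μ := by
          refine lintegral_mono fun ω => ?_
          simp only
          rw [← Finset.mul_sum, ← ENNReal.ofReal_sum_of_nonneg
            (fun ξ _ => Finset.prod_nonneg fun l _ => (Real.exp_pos _).le), hsum,
            mul_left_comm]
          gcongr
          refine (ENNReal.ofReal_le_ofReal (hle ω)).trans ?_
          rw [ENNReal.ofReal_mul (by positivity), ENNReal.ofReal_pow (by norm_num)]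
          simp
      _ = _ := by
          rw [lintegral_const_mul]
          fun_prop
  exact (ENNReal.mul_le_mul_iff_right (by simp) (by simp)).1 h1

/-- The Chernoff bound for a variable which is sub-Gaussian under a finite measure of mass at
most one. -/
theorem measure_abs_gt_le_of_lintegral_exp_le {Ω : Type*} [MeasurableSpace Ω] {μ : Measure Ω}
    {G : Ω → ℝ} (hG : Measurable G) {L : ℝ} (hL : 0 < L)
    (h : ∀ s : ℝ, ∫⁻ ω, ENNReal.ofReal (Real.exp (s * G ω)) ∂μ ≤
      ENNReal.ofReal (Real.exp (s ^ 2 * L / 2))) {t : ℝ} (ht : 0 ≤ t) :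
    μ {ω | t < |G ω|} ≤ ENNReal.ofReal (2 * Real.exp (-(t ^ 2 / (2 * L)))) := by
  -- Both tails at once through `σ = ±1`. The exponential parameter `t / L` is the optimal Chernoff
  -- choice.
  have one : ∀ σ : ℝ, σ ^ 2 = 1 → μ {ω | t ≤ σ * G ω} ≤
      ENNReal.ofReal (Real.exp (-(t ^ 2 / (2 * L)))) := by
    intro σ hσ
    have h1 := meas_ge_le_lintegral_div (μ := μ)
      (f := fun ω => ENNReal.ofReal (Real.exp ((t / L * σ) * G ω)))
      (by fun_prop) (ε := ENNReal.ofReal (Real.exp (t / L * t)))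
      (by simp [Real.exp_pos]) (by simp)
    refine le_trans (measure_mono ?_) (h1.trans ?_)
    · intro ω hω
      simp only [Set.mem_ofPred_eq] at hω ⊢
      apply ENNReal.ofReal_le_ofReal
      apply Real.exp_le_exp.2
      rw [mul_assoc]
      gcongr
    · refine (ENNReal.div_le_div_right (h _) _).trans ?_
      rw [← ENNReal.ofReal_div_of_pos (Real.exp_pos _), ← Real.exp_sub]
      apply ENNReal.ofReal_le_ofReal
      apply Real.exp_le_exp.2
      rw [mul_pow, hσ]
      apply le_of_eq
      field_simp
      ring
  have hsub : {ω | t < |G ω|} ⊆ {ω | t ≤ 1 * G ω} ∪ {ω | t ≤ (-1) * G ω} := by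
    intro ω hω
    have hω' : t < |G ω| := hω
    rcases lt_abs.1 hω' with h | h
    · left; simp; exact h.le
    · right; simp; linarith
  refine (measure_mono hsub).trans ((measure_union_le _ _).trans ?_)
  rw [two_mul, ENNReal.ofReal_add (Real.exp_pos _).le (Real.exp_pos _).le]
  exact add_le_add (one 1 (by norm_num)) (one (-1) (by norm_num))

theorem lintegral_exp_mul_gaussianReal (t : ℝ) (v : ℝ≥0) :
    ∫⁻ y, ENNReal.ofReal (Real.exp (t * y)) ∂(gaussianReal 0 v) =
      ENNReal.ofReal (Real.exp (v * t ^ 2 / 2)) := by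
  rw [← ofReal_integral_eq_lintegral_ofReal]
  · have := mgf_gaussianReal (p := gaussianReal 0 v) (X := id) (μ := 0) (v := v) (by simp) t
    simp only [mgf, id] at this
    rw [this]; simp
  · exact integrable_exp_mul_gaussianReal t
  · filter_upwards with y using (Real.exp_pos _).le

/-- The condition `L v = 1 / 2` makes the exponent cancel exactly half of the Gaussian decay. The
integral equals `√2`, rounded up to `2` so that a product over coordinates is a power of two. -/
theorem lintegral_exp_sq_gaussianReal_le {v : ℝ≥0} {L : ℝ} (hv : 0 < v)
    (h : L * v = 1 / 2) :
    ∫⁻ y, ENNReal.ofReal (Real.exp (L * y ^ 2 / 2)) ∂(gaussianReal 0 v) ≤ 2 := by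
  have hv' : (0 : ℝ) < v := by exact_mod_cast hv
  have hLv : L = 1 / (2 * v) := by field_simp; linarith
  rw [gaussianReal_of_var_ne_zero _ hv.ne', lintegral_withDensity_eq_lintegral_mul₀
    (by fun_prop) (by fun_prop)]
  have e : ∀ y, (gaussianPDF 0 v * fun y => ENNReal.ofReal (Real.exp (L * y ^ 2 / 2))) y =
      ENNReal.ofReal ((√(2 * Real.pi * v))⁻¹ * Real.exp (-(1 / (4 * v)) * y ^ 2)) := by
    intro y
    simp only [Pi.mul_apply, gaussianPDF, gaussianPDFReal]
    rw [← ENNReal.ofReal_mul (by positivity), mul_assoc, ← Real.exp_add]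
    congr 3
    rw [hLv]; field_simp; ring
  simp_rw [e]
  rw [← ofReal_integral_eq_lintegral_ofReal]
  · rw [integral_const_mul, integral_gaussian]
    have : (√(2 * Real.pi * v))⁻¹ * √(Real.pi / (1 / (4 * v))) = √2 := by
      rw [← Real.sqrt_inv, ← Real.sqrt_mul (by positivity)]
      congr 1
      field_simp; norm_num
    rw [this]
    have : √2 ≤ 2 := by rw [Real.sqrt_le_left (by norm_num)]; norm_num
    rw [ENNReal.ofReal_le_ofNat]
    exact this
  · exact (integrable_exp_neg_mul_sq (by positivity)).const_mul _
  · filter_upwards with y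
    positivity

/-- Gaussian decoupling: a vector all of whose linear functionals are sub-Gaussian with variance
proxy `L` has an exponentially integrable squared norm. -/
theorem lintegral_exp_sum_sq_le {Ω ι : Type*} [MeasurableSpace Ω] {μ : Measure Ω} [SFinite μ]
    [Fintype ι] {G : ι → Ω → ℝ} (hG : ∀ l, Measurable (G l)) {L : ℝ} (hL : 0 < L)
    (h : ∀ φ : ι → ℝ, ∫⁻ ω, ENNReal.ofReal (Real.exp (∑ l, φ l * G l ω)) ∂μ ≤
      ENNReal.ofReal (Real.exp (L * (∑ l, φ l ^ 2) / 2))) :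
    ∫⁻ ω, ENNReal.ofReal (Real.exp ((∑ l, G l ω ^ 2) / (4 * L))) ∂μ ≤
      2 ^ Fintype.card ι := by
  -- Integrating out an auxiliary Gaussian of variance `1 / (2 L)` turns `exp (φ G)` into `exp (G² /
  -- (4 L))`. After exchanging the integrals, this same variance keeps `exp (L φ² / 2)` integrable.
  set v : ℝ≥0 := ⟨1 / (2 * L), by positivity⟩ with hv
  have hvc : (v : ℝ) = 1 / (2 * L) := rfl
  have hv0 : 0 < v := by rw [← NNReal.coe_pos, hvc]; positivity
  have prodG : ∀ f : ι → ℝ → ℝ, (∀ l, Measurable (f l)) →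
      ∫⁻ φ, ENNReal.ofReal (Real.exp (∑ l, f l (φ l))) ∂(Measure.pi fun _ : ι => gaussianReal 0 v)
        = ∏ l, ∫⁻ y, ENNReal.ofReal (Real.exp (f l y)) ∂(gaussianReal 0 v) := by
    intro f hf
    simp_rw [Real.exp_sum]
    simp_rw [ENNReal.ofReal_prod_of_nonneg (fun _ _ => (Real.exp_pos _).le)]
    have hm : ∀ l, Measurable fun y => ENNReal.ofReal (Real.exp (f l y)) := fun l => by
      have := hf l; fun_prop
    have h1 := lintegral_prod_eq_prod_lintegral_of_indepFun Finset.univ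
      (fun l (φ : ι → ℝ) => ENNReal.ofReal (Real.exp (f l (φ l))))
      (iIndepFun_pi (μ := fun _ : ι => gaussianReal 0 v) fun l => (hm l).aemeasurable)
      (fun l => (hm l).comp (measurable_pi_apply l))
    rw [h1]
    refine Finset.prod_congr rfl fun l _ => ?_
    exact (measurePreserving_eval (fun _ : ι => gaussianReal 0 v) l).lintegral_comp (hm l)
  calc _ = ∫⁻ ω, ∫⁻ φ, ENNReal.ofReal (Real.exp (∑ l, φ l * G l ω))
        ∂(Measure.pi fun _ : ι => gaussianReal 0 v) ∂μ := by
        refine lintegral_congr fun ω => ?_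
        rw [prodG (fun l y => y * G l ω) (fun l => by fun_prop)]
        simp_rw [mul_comm _ (G _ ω), lintegral_exp_mul_gaussianReal]
        rw [← ENNReal.ofReal_prod_of_nonneg (fun _ _ => (Real.exp_pos _).le), ← Real.exp_sum]
        congr 2
        rw [Finset.sum_div]
        refine Finset.sum_congr rfl fun l _ => ?_
        rw [hvc]; field_simp; ring
    _ = ∫⁻ φ, ∫⁻ ω, ENNReal.ofReal (Real.exp (∑ l, φ l * G l ω)) ∂μ
        ∂(Measure.pi fun _ : ι => gaussianReal 0 v) := by
        rw [lintegral_lintegral_swap]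
        refine Measurable.aemeasurable ?_
        refine ENNReal.measurable_ofReal.comp (Real.measurable_exp.comp ?_)
        refine Finset.measurable_sum _ fun l _ => ?_
        exact ((measurable_pi_apply l).comp measurable_snd).mul ((hG l).comp measurable_fst)
    _ ≤ ∫⁻ φ, ENNReal.ofReal (Real.exp (∑ l, L * φ l ^ 2 / 2))
        ∂(Measure.pi fun _ : ι => gaussianReal 0 v) := by
        refine lintegral_mono fun φ => (h φ).trans (le_of_eq ?_)
        rw [Finset.mul_sum, Finset.sum_div]
    _ = ∏ _l : ι, ∫⁻ y, ENNReal.ofReal (Real.exp (L * y ^ 2 / 2)) ∂(gaussianReal 0 v) :=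
        prodG (fun _ y => L * y ^ 2 / 2) (fun _ => by fun_prop)
    _ ≤ ∏ _l : ι, 2 := by
        refine Finset.prod_le_prod' fun l _ => ?_
        refine lintegral_exp_sq_gaussianReal_le hv0 ?_
        rw [hvc]; field_simp
    _ = _ := by simp

/-! ### Variables with moments of all orders -/

/-- `f` has finite moments of all orders. -/
def AllMoments {Ω : Type*} [MeasurableSpace Ω] (f : Ω → ℝ) (μ : Measure Ω) : Prop :=
  ∀ p : ℝ≥0, MemLp f p μ

namespace AllMoments

variable {Ω : Type*} [MeasurableSpace Ω] {μ : Measure Ω} {f g : Ω → ℝ}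

theorem integrable (hf : AllMoments f μ) : Integrable f μ := by
  have := hf 1
  rwa [ENNReal.coe_one, memLp_one_iff_integrable] at this

theorem memLp_two (hf : AllMoments f μ) : MemLp f 2 μ := by
  exact hf 2

theorem add (hf : AllMoments f μ) (hg : AllMoments g μ) : AllMoments (fun ω => f ω + g ω) μ :=
  fun p => (hf p).add (hg p)

theorem sub (hf : AllMoments f μ) (hg : AllMoments g μ) : AllMoments (fun ω => f ω - g ω) μ :=
  fun p => (hf p).sub (hg p)

theorem const_mul (hf : AllMoments f μ) (c : ℝ) : AllMoments (fun ω => c * f ω) μ :=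
  fun p => (hf p).const_mul c

theorem const [IsFiniteMeasure μ] (c : ℝ) : AllMoments (fun _ : Ω => c) μ :=
  fun _ => memLp_const c

theorem sum {ι : Type*} (s : Finset ι) {f : ι → Ω → ℝ} (hf : ∀ i ∈ s, AllMoments (f i) μ) :
    AllMoments (fun ω => ∑ i ∈ s, f i ω) μ :=
  fun p => memLp_finsetSum s fun i hi => hf i hi p

/-- Hölder with exponent `2p` on both factors. Closure under products is the reason for asking for
all moments at once: every polynomial in the coordinates and the errors becomes integrable without
bookkeeping. -/
theorem mul (hf : AllMoments f μ) (hg : AllMoments g μ) : AllMoments (fun ω => f ω * g ω) μ := by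
  intro p
  have : ENNReal.HolderTriple ((2 * p : ℝ≥0) : ℝ≥0∞) ((2 * p : ℝ≥0) : ℝ≥0∞) p := by
    constructor
    push_cast
    rw [ENNReal.mul_inv (by simp) (by simp), ← add_mul, ENNReal.inv_two_add_inv_two, one_mul]
  exact (hg (2 * p)).mul (hf (2 * p))

theorem pow [IsFiniteMeasure μ] (hf : AllMoments f μ) (n : ℕ) :
    AllMoments (fun ω => f ω ^ n) μ := by
  induction n with
  | zero => simpa using AllMoments.const 1
  | succ n ih => simpa [pow_succ] using ih.mul hf

theorem comp_measurePreserving {Ω' : Type*} [MeasurableSpace Ω'] {μ' : Measure Ω'}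
    (hf : AllMoments f μ) {T : Ω' → Ω} (hT : MeasurePreserving T μ' μ) :
    AllMoments (fun ω => f (T ω)) μ' :=
  fun p => (hf p).comp_measurePreserving hT

end AllMoments

theorem _root_.ProbabilityTheory.HasSubgaussianMGF.allMoments {Ω : Type*} [MeasurableSpace Ω]
    {μ : Measure Ω} {f : Ω → ℝ} {c : ℝ≥0} (h : HasSubgaussianMGF f c μ) : AllMoments f μ :=
  fun p => h.memLp p

/-- With `s = c^{-1/2}` one has `(s x)^{2m} / (2m)! ≤ exp (s x) + exp (-s x)`, and each exponential
has mean at most `exp (1 / 2) ≤ 2`. Positivity of `c` is needed to define `s`. -/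
theorem integral_pow_le_of_subgaussian {Ω : Type*} [MeasurableSpace Ω] {μ : Measure Ω}
    [IsProbabilityMeasure μ] {f : Ω → ℝ} {c : ℝ≥0} (hc : 0 < c) (h : HasSubgaussianMGF f c μ)
    (m : ℕ) : ∫ ω, f ω ^ (2 * m) ∂μ ≤ 4 * (2 * m).factorial * (c : ℝ) ^ m := by
  have hc' : (0 : ℝ) < c := by exact_mod_cast hc
  set s : ℝ := (√c)⁻¹ with hs
  have hs0 : 0 < s := by positivity
  have hs2 : s ^ 2 * c = 1 := by
    rw [hs, inv_pow, Real.sq_sqrt hc'.le]; field_simp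
  have hpt : ∀ x : ℝ, x ^ (2 * m) ≤
      (2 * m).factorial * (c : ℝ) ^ m * (Real.exp (s * x) + Real.exp (-s * x)) := by
    intro x
    have h1 := Real.pow_div_factorial_le_exp (|s * x|) (abs_nonneg _) (2 * m)
    have h2 : Real.exp |s * x| ≤ Real.exp (s * x) + Real.exp (-s * x) := by
      rcases abs_cases (s * x) with ⟨h, _⟩ | ⟨h, _⟩ <;> rw [h]
      · linarith [Real.exp_pos (-s * x)]
      · rw [neg_mul]; linarith [Real.exp_pos (s * x)]
    have h3 : x ^ (2 * m) = (c : ℝ) ^ m * |s * x| ^ (2 * m) := by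
      rw [pow_mul |s * x|, sq_abs, mul_pow, mul_pow, ← mul_assoc, ← mul_pow, mul_comm (c : ℝ), hs2,
        pow_mul]
      simp
    rw [h3]
    have hfac : (0 : ℝ) < (2 * m).factorial := by positivity
    rw [div_le_iff₀ hfac] at h1
    calc (c : ℝ) ^ m * |s * x| ^ (2 * m)
        ≤ (c : ℝ) ^ m * (Real.exp |s * x| * (2 * m).factorial) := by gcongr
      _ ≤ (c : ℝ) ^ m * ((Real.exp (s * x) + Real.exp (-s * x)) * (2 * m).factorial) := by gcongr
      _ = _ := by ring
  have hb : ∀ t : ℝ, t ^ 2 * c = 1 → ∫ ω, Real.exp (t * f ω) ∂μ ≤ 2 := by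
    intro t ht
    refine (h.mgf_le t).trans ?_
    rw [mul_comm (c : ℝ), ht, ← Real.le_log_iff_exp_le (by norm_num)]
    have := Real.log_two_gt_d9
    norm_num; linarith
  calc ∫ ω, f ω ^ (2 * m) ∂μ ≤ ∫ ω, (2 * m).factorial * (c : ℝ) ^ m *
        (Real.exp (s * f ω) + Real.exp (-s * f ω)) ∂μ := by
        refine integral_mono (h.allMoments.pow _).integrable ?_ fun ω => hpt _
        exact ((h.integrable_exp_mul s).add (h.integrable_exp_mul (-s))).const_mul _
    _ = (2 * m).factorial * (c : ℝ) ^ m *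
        (∫ ω, Real.exp (s * f ω) ∂μ + ∫ ω, Real.exp (-s * f ω) ∂μ) := by
        rw [integral_const_mul, integral_add (h.integrable_exp_mul s) (h.integrable_exp_mul (-s))]
    _ ≤ (2 * m).factorial * (c : ℝ) ^ m * (2 + 2) := by
        gcongr
        · exact hb s hs2
        · exact hb (-s) (by rw [neg_sq, hs2])
    _ = _ := by ring

/-! ### Averages over an i.i.d. sample -/

theorem measure_gt_le_of_integral_le {Ω : Type*} [MeasurableSpace Ω] {μ : Measure Ω}
    {f : Ω → ℝ} (hf : Integrable f μ) (h0 : ∀ ω, 0 ≤ f ω) {C t : ℝ} (hC : ∫ ω, f ω ∂μ ≤ C)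
    (ht : 0 < t) : μ {ω | t < f ω} ≤ ENNReal.ofReal (C / t) := by
  have h1 := meas_ge_le_lintegral_div (μ := μ) (f := fun ω => ENNReal.ofReal (f ω))
    hf.aemeasurable.ennreal_ofReal (ε := ENNReal.ofReal t) (by simpa using ht) (by simp)
  refine (measure_mono ?_).trans (h1.trans ?_)
  · intro ω hω
    exact ENNReal.ofReal_le_ofReal (le_of_lt hω)
  · rw [ENNReal.ofReal_div_of_pos ht, ← ofReal_integral_eq_lintegral_ofReal hf
      (Eventually.of_forall h0)]
    gcongr

section Sample

variable {Z : Type*} [MeasurableSpace Z] {μ : Measure Z} [IsProbabilityMeasure μ] {n : ℕ}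

theorem integral_sample_eval {f : Z → ℝ} (hf : AEStronglyMeasurable f μ) (i : Fin n) :
    ∫ ω, f (ω i) ∂(Measure.pi fun _ : Fin n => μ) = ∫ z, f z ∂μ := by
  exact integral_comp_eval (μ := fun _ : Fin n => μ) (i := i) hf

theorem integrable_sample_eval {f : Z → ℝ} (hf : Integrable f μ) (i : Fin n) :
    Integrable (fun ω => f (ω i)) (Measure.pi fun _ : Fin n => μ) :=
  (measurePreserving_eval (fun _ : Fin n => μ) i).integrable_comp_of_integrable hf

theorem integral_sample_mean (hn : n ≠ 0) {f : Z → ℝ} (hf : Integrable f μ) :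
    ∫ ω, (n : ℝ)⁻¹ * ∑ i, f (ω i) ∂(Measure.pi fun _ : Fin n => μ) = ∫ z, f z ∂μ := by
  rw [integral_const_mul, integral_finsetSum _ fun i _ => integrable_sample_eval hf i]
  simp_rw [integral_sample_eval hf.aestronglyMeasurable]
  have : (n : ℝ) ≠ 0 := by exact_mod_cast hn
  simp [this]

theorem measure_sample_mean_gt_le (hn : n ≠ 0) {f : Z → ℝ} (hf : Integrable f μ)
    (h0 : ∀ z, 0 ≤ f z) {C t : ℝ} (hC : ∫ z, f z ∂μ ≤ C) (ht : 0 < t) :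
    (Measure.pi fun _ : Fin n => μ) {ω | t < (n : ℝ)⁻¹ * ∑ i, f (ω i)} ≤
      ENNReal.ofReal (C / t) := by
  refine measure_gt_le_of_integral_le ?_ (fun ω => ?_) ?_ ht
  · exact (integrable_finsetSum _ fun i _ => integrable_sample_eval hf i).const_mul _
  · exact mul_nonneg (by positivity) (Finset.sum_nonneg fun i _ => h0 _)
  · rwa [integral_sample_mean hn hf]

theorem integral_sample_mean_sub_sq_le (hn : n ≠ 0) {f : Z → ℝ} (hf : MemLp f 2 μ) :
    ∫ ω, ((n : ℝ)⁻¹ * ∑ i, f (ω i) - ∫ z, f z ∂μ) ^ 2 ∂(Measure.pi fun _ : Fin n => μ) ≤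
      (n : ℝ)⁻¹ * ∫ z, f z ^ 2 ∂μ := by
  have hn' : (n : ℝ) ≠ 0 := by exact_mod_cast hn
  have hfi : Integrable f μ := hf.integrable (by norm_num)
  have h1 := variance_sum_pi (μ := fun _ : Fin n => μ) (X := fun _ => f) (fun _ => hf)
  have hvar : ∫ ω, ((n : ℝ)⁻¹ * ∑ i, f (ω i) - ∫ z, f z ∂μ) ^ 2
      ∂(Measure.pi fun _ : Fin n => μ) =
      Var[fun ω => (n : ℝ)⁻¹ * ∑ i, f (ω i); Measure.pi fun _ : Fin n => μ] := by
    rw [variance_eq_integral]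
    · rw [integral_sample_mean hn hfi]
    · exact ((integrable_finsetSum _ fun i _ => integrable_sample_eval hfi i).const_mul
        _).aemeasurable
  rw [hvar, variance_const_mul]
  have h2 : Var[fun ω => ∑ i, f (ω i); Measure.pi fun _ : Fin n => μ] = n * Var[f; μ] := by
    have e : (fun ω : Fin n → Z => ∑ i, f (ω i)) = ∑ i, fun ω => f (ω i) := by
      ext ω; simp
    rw [e, h1]; simp
  rw [h2]
  have h3 : Var[f; μ] ≤ ∫ z, f z ^ 2 ∂μ := by
    have := variance_le_expectation_sq (μ := μ) (X := f) hf.aestronglyMeasurable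
    simpa using this
  calc _ = (n : ℝ)⁻¹ * Var[f; μ] := by field_simp
    _ ≤ _ := by gcongr

/-- Chebyshev for a whole vector of empirical means: the expected squared distance is at most `n⁻¹`
times the sum of the second moments, so no union bound over the entries is paid. -/
theorem measure_sum_sq_sample_mean_gt_le (hn : n ≠ 0) {ι : Type*} (A : Finset ι) {f : ι → Z → ℝ}
    (hf : ∀ a ∈ A, MemLp (f a) 2 μ) {C t : ℝ} (hC : ∑ a ∈ A, ∫ z, f a z ^ 2 ∂μ ≤ C) (ht : 0 < t) :
    (Measure.pi fun _ : Fin n => μ)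
      {ω | t < ∑ a ∈ A, ((n : ℝ)⁻¹ * ∑ i, f a (ω i) - ∫ z, f a z ∂μ) ^ 2} ≤
      ENNReal.ofReal ((n : ℝ)⁻¹ * C / t) := by
  have hInt : ∀ a ∈ A, Integrable (fun ω : Fin n → Z =>
      ((n : ℝ)⁻¹ * ∑ i, f a (ω i) - ∫ z, f a z ∂μ) ^ 2) (Measure.pi fun _ : Fin n => μ) := by
    intro a ha
    have h1 : ∀ i ∈ Finset.univ, MemLp (fun ω : Fin n → Z => f a (ω i)) 2
        (Measure.pi fun _ : Fin n => μ) := fun i _ =>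
      (hf a ha).comp_measurePreserving (measurePreserving_eval (fun _ : Fin n => μ) i)
    exact (((memLp_finsetSum _ h1).const_mul _).sub (memLp_const _)).integrable_sq
  refine measure_gt_le_of_integral_le (integrable_finsetSum _ hInt)
    (fun ω => Finset.sum_nonneg fun a _ => sq_nonneg _) ?_ ht
  rw [integral_finsetSum _ hInt]
  calc _ ≤ ∑ a ∈ A, (n : ℝ)⁻¹ * ∫ z, f a z ^ 2 ∂μ :=
        Finset.sum_le_sum fun a ha => integral_sample_mean_sub_sq_le hn (hf a ha)
    _ ≤ _ := by rw [← Finset.mul_sum]; gcongr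

end Sample

/-! ### Rotation invariant laws -/

/-- Euclidean `k`-space. -/
abbrev Euc (k : ℕ) : Type := EuclideanSpace ℝ (Fin k)

/-- A rotation invariant probability law on `ℝᵏ` with identity covariance and sub-Gaussian
linear functionals. -/
structure IsIsotropic {k : ℕ} (μ : Measure (Euc k)) (c : ℝ≥0) : Prop where
  isProbabilityMeasure : IsProbabilityMeasure μ
  map_eq : ∀ L : Euc k ≃ₗᵢ[ℝ] Euc k, μ.map L = μ
  integral_sq : ∀ a, ∫ w, inner ℝ a w ^ 2 ∂μ = ‖a‖ ^ 2
  subgaussian : ∀ a, HasSubgaussianMGF (fun w => inner ℝ a w) (c * ‖a‖₊ ^ 2) μ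

/-- The reflection in the hyperplane orthogonal to `u - v`. The last clause is what makes it useful:
every basis vector on which `u` and `v` have equal entries stays fixed. -/
theorem exists_isometry_swap {E : Type*} [NormedAddCommGroup E] [InnerProductSpace ℝ E]
    [CompleteSpace E] {u v : E} (h : ‖u‖ = ‖v‖) :
    ∃ L : E ≃ₗᵢ[ℝ] E, L u = v ∧ L v = u ∧ ∀ x, inner ℝ x (u - v) = 0 → L x = x := by
  refine ⟨(ℝ ∙ (u - v))ᗮ.reflection, Submodule.reflection_sub h, ?_, fun x hx => ?_⟩
  · have := (ℝ ∙ (u - v))ᗮ.reflection_reflection u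
    rwa [Submodule.reflection_sub h] at this
  · rw [Submodule.reflection_eq_self_iff, Submodule.mem_orthogonal_singleton_iff_inner_left]
    exact hx

namespace IsIsotropic

variable {k : ℕ} {μ : Measure (Euc k)} {c : ℝ≥0}

theorem measurePreserving (h : IsIsotropic μ c) (L : Euc k ≃ₗᵢ[ℝ] Euc k) : MeasurePreserving L μ μ :=
  ⟨L.continuous.measurable, h.map_eq L⟩

theorem integral_comp_isometry (h : IsIsotropic μ c) (L : Euc k ≃ₗᵢ[ℝ] Euc k) (F : Euc k → ℝ) :
    ∫ w, F (L w) ∂μ = ∫ w, F w ∂μ :=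
  (h.measurePreserving L).integral_comp L.toHomeomorph.measurableEmbedding F

theorem allMoments_inner (h : IsIsotropic μ c) (a : Euc k) :
    AllMoments (fun w => inner ℝ a w) μ := (h.subgaussian a).allMoments

theorem allMoments_apply (h : IsIsotropic μ c) (l : Fin k) : AllMoments (fun w => w l) μ := by
  have := h.allMoments_inner (EuclideanSpace.single l 1)
  simpa [EuclideanSpace.inner_single_left] using this

theorem integral_inner_pow_le (h : IsIsotropic μ c) (hc : 0 < c) {a : Euc k} (m : ℕ) :
    ∫ w, inner ℝ a w ^ (2 * m) ∂μ ≤ 4 * (2 * m).factorial * ((c : ℝ) * ‖a‖ ^ 2) ^ m := by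
  have := h.isProbabilityMeasure
  -- The zero functional is separated because the moment bound requires a positive variance proxy.
  by_cases ha : a = 0
  · subst ha
    rcases Nat.eq_zero_or_pos m with rfl | hm
    · simp
    · have : (2 * m) ≠ 0 := by omega
      simp [this, hm.ne']
  · have := integral_pow_le_of_subgaussian (c := c * ‖a‖₊ ^ 2)
      (mul_pos hc (by simpa [pow_pos] using pow_pos (nnnorm_pos.2 ha) 2)) (h.subgaussian a) m
    simpa using this

theorem integral_apply_pow_le (h : IsIsotropic μ c) (hc : 0 < c) (l : Fin k) (m : ℕ) :
    ∫ w, w l ^ (2 * m) ∂μ ≤ 4 * (2 * m).factorial * (c : ℝ) ^ m := by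
  have := h.integral_inner_pow_le hc (a := EuclideanSpace.single l 1) m
  simpa [EuclideanSpace.inner_single_left] using this

theorem integral_apply_sq (h : IsIsotropic μ c) (l : Fin k) : ∫ w, w l ^ 2 ∂μ = 1 := by
  have := h.integral_sq (EuclideanSpace.single l 1)
  simpa [EuclideanSpace.inner_single_left] using this

/-- `|w|²` is exponentially integrable on the scale of the dimension. -/
theorem lintegral_exp_normSq_le (h : IsIsotropic μ c) (hc : 0 < c) :
    ∫⁻ w, ENNReal.ofReal (Real.exp (‖w‖ ^ 2 / (4 * c))) ∂μ ≤ 2 ^ k := by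
  have := h.isProbabilityMeasure
  have key := lintegral_exp_sum_sq_le (μ := μ) (G := fun (l : Fin k) w => w l)
    (fun l => by fun_prop) (L := c) (by exact_mod_cast hc) ?_
  · simpa [EuclideanSpace.norm_sq_eq] using key
  · intro φ
    have hs := h.subgaussian (WithLp.toLp 2 φ)
    rw [← ofReal_integral_eq_lintegral_ofReal]
    · apply ENNReal.ofReal_le_ofReal
      have := hs.mgf_le 1
      simp only [mgf, one_mul, PiLp.inner_apply, RCLike.inner_apply, conj_trivial] at this
      simpa [EuclideanSpace.norm_sq_eq, mul_comm] using this
    · have := hs.integrable_exp_mul 1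
      simpa only [one_mul, PiLp.inner_apply, RCLike.inner_apply, conj_trivial, mul_comm] using this
    · exact Eventually.of_forall fun w => (Real.exp_pos _).le

/-- Moments of linear functionals, weighted by an invariant function, depend on the norm only. -/
theorem integral_mul_inner_pow_eq (h : IsIsotropic μ c) {A : Set (Fin k)} {g : Euc k → ℝ}
    (hg : ∀ L : Euc k ≃ₗᵢ[ℝ] Euc k, (∀ i ∉ A, L (EuclideanSpace.single i 1) = EuclideanSpace.single i 1) →
      ∀ w, g (L w) = g w) {u v : Euc k} (huv : ‖u‖ = ‖v‖) (hu : ∀ i ∉ A, u i = 0)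
    (hv : ∀ i ∉ A, v i = 0) (p : ℕ) :
    ∫ w, g w * inner ℝ u w ^ p ∂μ = ∫ w, g w * inner ℝ v w ^ p ∂μ := by
  obtain ⟨L, hL, hL', hLx⟩ := exists_isometry_swap huv
  have hLg := hg L fun i hi => hLx _ (by
    simp [EuclideanSpace.inner_single_left, hu i hi, hv i hi])
  rw [← h.integral_comp_isometry L]
  refine integral_congr_ae (Eventually.of_forall fun w => ?_)
  simp only
  rw [hLg, ← hL', L.inner_map_map]

/-! ### Fourth moments weighted by a partially invariant function. -/

section Quadratic

variable {A : Finset (Fin k)} {g : Euc k → ℝ}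

/-- Polarization: `w l ± w m` has the weighted fourth moment of `√2 w a`, and adding the two
expansions gives `8 M = 4 M + 12 X`, hence `X = M / 3`. Fourth moments thus follow the Gaussian
pattern up to one scalar, even though the coordinates are dependent. -/
theorem integral_mul_sq_mul_sq (h : IsIsotropic μ c) (hgm : AllMoments g μ)
    (hg : ∀ L : Euc k ≃ₗᵢ[ℝ] Euc k, (∀ i ∉ A, L (EuclideanSpace.single i 1) = EuclideanSpace.single i 1) →
      ∀ w, g (L w) = g w) {a l m : Fin k} (ha : a ∈ A) (hl : l ∈ A) (hm : m ∈ A) :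
    ∫ w, g w * (w l ^ 2 * w m ^ 2) ∂μ =
      (∫ w, g w * w a ^ 4 ∂μ) / 3 * (1 + if l = m then 2 else 0) := by
  have hp := h.isProbabilityMeasure
  have hw := h.allMoments_apply
  have hg' : ∀ L : Euc k ≃ₗᵢ[ℝ] Euc k, (∀ i ∉ (A : Set (Fin k)),
    L (EuclideanSpace.single i 1) = EuclideanSpace.single i 1) → ∀ w, g (L w) = g w :=
    fun L hL => hg L fun i hi => hL i (by simpa using hi)
  have e4 : ∀ l ∈ A, ∫ w, g w * w l ^ 4 ∂μ = ∫ w, g w * w a ^ 4 ∂μ := by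
    intro l hl
    have := h.integral_mul_inner_pow_eq hg' (u := EuclideanSpace.single l 1)
      (v := EuclideanSpace.single a 1) (by simp) (fun i hi => by
        have : i ≠ l := fun e => hi (by rw [e]; exact hl)
        simp [this])
      (fun i hi => by
        have : i ≠ a := fun e => hi (by rw [e]; exact ha)
        simp [this]) 4
    simpa [EuclideanSpace.inner_single_left] using this
  split_ifs with hlm
  · subst hlm
    rw [← e4 l hl]
    have : ∀ w : Euc k, w l ^ 2 * w l ^ 2 = w l ^ 4 := fun w => by ring
    simp_rw [this]
    ring
  · have hlm' : m ≠ l := fun e => hlm e.symm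
    have er : ∀ σ : ℝ, σ ^ 2 = 1 → ∫ w, g w * (w l + σ * w m) ^ 4 ∂μ =
        4 * ∫ w, g w * w a ^ 4 ∂μ := by
      intro σ hσ
      have hnorm : ‖(EuclideanSpace.single l 1 + σ • EuclideanSpace.single m 1 : Euc k)‖ =
          ‖(√2 • EuclideanSpace.single a 1 : Euc k)‖ := by
        rw [← sq_eq_sq₀ (norm_nonneg _) (norm_nonneg _), norm_smul, mul_pow]
        rw [@norm_add_sq_real]
        simp [norm_smul, EuclideanSpace.inner_single_left, hlm, hσ]
        norm_num
      have := h.integral_mul_inner_pow_eq hg' hnorm (fun i hi => by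
        have h1 : i ≠ l := fun e => hi (by rw [e]; exact hl)
        have h2 : i ≠ m := fun e => hi (by rw [e]; exact hm)
        simp [h1, h2])
        (fun i hi => by
          have : i ≠ a := fun e => hi (by rw [e]; exact ha)
          simp [this]) 4
      simp only [inner_add_left, inner_smul_left, EuclideanSpace.inner_single_left, map_one,
        one_mul, conj_trivial, mul_pow] at this
      rw [this]
      have h4 : √2 ^ 4 = (4 : ℝ) := by
        rw [show 4 = 2 * 2 by norm_num, pow_mul, Real.sq_sqrt (by norm_num)]; norm_num
      simp_rw [h4, mul_left_comm _ (4 : ℝ), integral_const_mul]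
    have h1 := er 1 (by norm_num)
    have h2 := er (-1) (by norm_num)
    have hi : ∀ σ : ℝ, Integrable (fun w => g w * (w l + σ * w m) ^ 4) μ := fun σ =>
      (hgm.mul (((hw l).add ((hw m).const_mul σ)).pow 4)).integrable
    have hsum : ∫ w, g w * (w l + 1 * w m) ^ 4 ∂μ + ∫ w, g w * (w l + -1 * w m) ^ 4 ∂μ =
        2 * ∫ w, g w * w l ^ 4 ∂μ + 2 * ∫ w, g w * w m ^ 4 ∂μ +
          12 * ∫ w, g w * (w l ^ 2 * w m ^ 2) ∂μ := by
      have i1 := (hgm.mul ((hw l).pow 4)).integrable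
      have i2 := (hgm.mul ((hw m).pow 4)).integrable
      have i3 := (hgm.mul (((hw l).pow 2).mul ((hw m).pow 2))).integrable
      have i12 : Integrable (fun w : Euc k => 2 * (g w * w l ^ 4) + 2 * (g w * w m ^ 4)) μ :=
        (i1.const_mul 2).add (i2.const_mul 2)
      rw [← integral_add (hi 1) (hi (-1)), ← integral_const_mul, ← integral_const_mul,
        ← integral_const_mul, ← integral_add (i1.const_mul 2) (i2.const_mul 2),
        ← integral_add i12 (i3.const_mul 12)]
      refine integral_congr_ae (Eventually.of_forall fun w => ?_)
      simp only
      ring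
    rw [h1, h2, e4 l hl, e4 m hm] at hsum
    linarith

/-- Expansion into pairs, each given by the Gaussian pattern. The set `A` may be proper, so that the
weight is allowed to depend on the coordinates outside it. -/
theorem integral_mul_quadratic_sq (h : IsIsotropic μ c) (hgm : AllMoments g μ)
    (hg : ∀ L : Euc k ≃ₗᵢ[ℝ] Euc k, (∀ i ∉ A, L (EuclideanSpace.single i 1) = EuclideanSpace.single i 1) →
      ∀ w, g (L w) = g w) {a : Fin k} (ha : a ∈ A) (d : Fin k → ℝ) :
    ∫ w, g w * (∑ l ∈ A, d l * w l ^ 2) ^ 2 ∂μ =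
      (∫ w, g w * w a ^ 4 ∂μ) / 3 * ((∑ l ∈ A, d l) ^ 2 + 2 * ∑ l ∈ A, d l ^ 2) := by
  have hp := h.isProbabilityMeasure
  have hw := h.allMoments_apply
  have e : ∀ w : Euc k, g w * (∑ l ∈ A, d l * w l ^ 2) ^ 2 =
      ∑ l ∈ A, ∑ m ∈ A, (d l * d m) * (g w * (w l ^ 2 * w m ^ 2)) := by
    intro w
    rw [sq, Finset.sum_mul_sum, Finset.mul_sum]
    refine Finset.sum_congr rfl fun l _ => ?_
    rw [Finset.mul_sum]
    refine Finset.sum_congr rfl fun m _ => ?_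
    ring
  simp_rw [e]
  have hInt : ∀ l m, Integrable (fun w => (d l * d m) * (g w * (w l ^ 2 * w m ^ 2))) μ :=
    fun l m => ((hgm.mul (((hw l).pow 2).mul ((hw m).pow 2))).const_mul _).integrable
  rw [integral_finsetSum _ fun l _ => integrable_finsetSum _ fun m _ => hInt l m]
  simp_rw [integral_finsetSum A fun m _ => hInt _ m, integral_const_mul]
  have e2 : ∀ l ∈ A, ∀ m ∈ A, d l * d m * ∫ w, g w * (w l ^ 2 * w m ^ 2) ∂μ =
      (∫ w, g w * w a ^ 4 ∂μ) / 3 * (d l * d m + if l = m then 2 * (d l * d m) else 0) := by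
    intro l hl m hm
    rw [h.integral_mul_sq_mul_sq hgm hg ha hl hm]
    split_ifs <;> ring
  rw [Finset.sum_congr rfl fun l hl => Finset.sum_congr rfl (e2 l hl)]
  simp_rw [← Finset.mul_sum, Finset.sum_add_distrib]
  congr 1
  rw [sq, Finset.sum_mul_sum, Finset.mul_sum]
  congr 1
  refine Finset.sum_congr rfl fun l hl => ?_
  rw [Finset.sum_ite_eq A l, if_pos hl]
  ring

end Quadratic

/-! ### Radial fluctuations of an isotropic vector. -/

/-- The normalized squared norm. -/
def normSqMean {k : ℕ} (w : Euc k) : ℝ := ‖w‖ ^ 2 / k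

theorem normSqMean_eq (w : Euc k) : normSqMean w = (∑ l, w l ^ 2) / k := by
  simp [normSqMean, EuclideanSpace.norm_sq_eq]

theorem normSqMean_isometry (L : Euc k ≃ₗᵢ[ℝ] Euc k) (w : Euc k) :
    normSqMean (L w) = normSqMean w := by
  simp [normSqMean]

theorem allMoments_normSqMean (h : IsIsotropic μ c) : AllMoments (normSqMean (k := k)) μ := by
  have hp := h.isProbabilityMeasure
  have : AllMoments (fun w : Euc k => (k : ℝ)⁻¹ * ∑ l, w l ^ 2) μ :=
    (AllMoments.sum _ fun l _ => (h.allMoments_apply l).pow 2).const_mul _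
  convert this using 2 with w
  rw [normSqMean_eq, div_eq_inv_mul]

/-- A coordinate has variance one, while the moment bound with `m = 1` allows at most `4 · 2! · c`.
-/
theorem one_le_eight_mul (h : IsIsotropic μ c) (hc : 0 < c) (hk : 0 < k) : 1 ≤ 8 * (c : ℝ) := by
  have := h.integral_apply_pow_le hc ⟨0, hk⟩ 1
  rw [mul_one, h.integral_apply_sq] at this
  norm_num at this
  linarith

/-- All squared coordinates have the same integral against an invariant weight, so each may be
replaced by their average. -/
theorem integral_sq_mul_invariant (h : IsIsotropic μ c) {g : Euc k → ℝ} (hgm : AllMoments g μ)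
    (hg : ∀ L : Euc k ≃ₗᵢ[ℝ] Euc k, ∀ w, g (L w) = g w) (l : Fin k) :
    ∫ w, g w * w l ^ 2 ∂μ = ∫ w, g w * normSqMean w ∂μ := by
  have hp := h.isProbabilityMeasure
  have hk : (k : ℝ) ≠ 0 := by
    have := l.pos
    exact_mod_cast this.ne'
  have e : ∀ m, ∫ w, g w * w m ^ 2 ∂μ = ∫ w, g w * w l ^ 2 ∂μ := by
    intro m
    have := h.integral_mul_inner_pow_eq (A := Set.univ) (fun L _ => hg L)
      (u := EuclideanSpace.single m 1) (v := EuclideanSpace.single l 1) (by simp)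
      (by simp) (by simp) 2
    simpa [EuclideanSpace.inner_single_left] using this
  have hs : ∫ w, g w * normSqMean w ∂μ = (k : ℝ)⁻¹ * ∑ m, ∫ w, g w * w m ^ 2 ∂μ := by
    rw [← integral_finsetSum _ fun m _ => (hgm.mul ((h.allMoments_apply m).pow 2)).integrable,
      ← integral_const_mul]
    refine integral_congr_ae (Eventually.of_forall fun w => ?_)
    simp only
    rw [normSqMean_eq, ← Finset.mul_sum]
    ring
  rw [hs]
  simp_rw [e]
  simp [hk]

/-- Below the level `8 κ` the first factor is bounded. Above it, with `y = X / (4 κ) > 2`, the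
exponent `k y - k log 2` exceeds `0.65 k y`, and its cubic Taylor term dominates `X³` with `k` to
spare, whence the factor `k⁻²`. The weight `2⁻ᵏ` matches the bound `2ᵏ` on the exponential moment.
-/
theorem normSqMean_mul_sub_one_sq_le {κ : ℝ} (hκ : 1 ≤ 8 * κ) (hk : 0 < k) (w : Euc k) :
    normSqMean w * (normSqMean w - 1) ^ 2 ≤ 8 * κ * (normSqMean w - 1) ^ 2 +
      1500 * κ ^ 3 / k ^ 2 * (Real.exp (‖w‖ ^ 2 / (4 * κ)) * (2 ^ k)⁻¹) := by
  set X := normSqMean w with hX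
  have hX0 : 0 ≤ X := by rw [hX, normSqMean]; positivity
  have hk' : (1 : ℝ) ≤ k := by exact_mod_cast hk
  have hκ0 : 0 < κ := by linarith
  have hw : ‖w‖ ^ 2 = k * X := by
    rw [hX, normSqMean]; field_simp
  rcases le_or_gt X (8 * κ) with hle | hgt
  · have : 0 ≤ 1500 * κ ^ 3 / k ^ 2 * (Real.exp (‖w‖ ^ 2 / (4 * κ)) * (2 ^ k)⁻¹) := by positivity
    nlinarith [mul_le_mul_of_nonneg_right hle (sq_nonneg (X - 1))]
  · set y := X / (4 * κ) with hy
    have hy2 : 2 < y := by rw [hy, lt_div_iff₀ (by positivity)]; linarith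
    have hXy : X = 4 * κ * y := by rw [hy]; field_simp
    have h1 : X * (X - 1) ^ 2 ≤ X ^ 3 := by
      have : (X - 1) ^ 2 ≤ X ^ 2 := by
        apply sq_le_sq' <;> linarith
      nlinarith [mul_le_mul_of_nonneg_left this hX0]
    have h2 : (0.65 * (k * y)) ^ 3 / 6 ≤ Real.exp (‖w‖ ^ 2 / (4 * κ)) * (2 ^ k)⁻¹ := by
      have e : Real.exp (‖w‖ ^ 2 / (4 * κ)) * (2 ^ k)⁻¹ =
          Real.exp (k * y - k * Real.log 2) := by
        rw [Real.exp_sub, hw, hy, mul_div_assoc, div_eq_mul_inv (Real.exp _)]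
        congr 2
        rw [← Real.log_pow, Real.exp_log (by positivity)]
      rw [e]
      have h3 := Real.pow_div_factorial_le_exp (0.65 * (k * y)) (by positivity) 3
      norm_num [Nat.factorial] at h3 ⊢
      refine h3.trans (Real.exp_le_exp.2 ?_)
      have := Real.log_two_lt_d9
      nlinarith [mul_pos (lt_of_lt_of_le one_pos hk') (sub_pos.2 hy2)]
    calc X * (X - 1) ^ 2 ≤ X ^ 3 := h1
      _ ≤ 1500 * κ ^ 3 / k ^ 2 * ((0.65 * (k * y)) ^ 3 / 6) := by
          rw [hXy, div_mul_eq_mul_div, le_div_iff₀ (by positivity)]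
          have e2 : (4 * κ * y) ^ 3 * (k : ℝ) ^ 2 = 64 * (κ ^ 3 * y ^ 3 * k ^ 2) := by ring
          have e3 : 1500 * κ ^ 3 * ((0.65 * (k * y)) ^ 3 / 6) =
              (1500 * 0.65 ^ 3 / 6) * k * (κ ^ 3 * y ^ 3 * k ^ 2) := by ring
          rw [e2, e3]
          refine mul_le_mul_of_nonneg_right ?_ (by positivity)
          nlinarith
      _ ≤ 1500 * κ ^ 3 / k ^ 2 * (Real.exp (‖w‖ ^ 2 / (4 * κ)) * (2 ^ k)⁻¹) := by gcongr
      _ ≤ _ := by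
          have : 0 ≤ 8 * κ * (X - 1) ^ 2 := by positivity
          linarith

/-- Large radii are charged to the exponential moment, which leaves an additive remainder of order
`k⁻²`; the rank deficiency of the quadratic form absorbs it later. -/
theorem integral_normSqMean_mul_sub_one_sq_le (h : IsIsotropic μ c) (hc : 0 < c) (hk : 0 < k) :
    ∫ w, normSqMean w * (normSqMean w - 1) ^ 2 ∂μ ≤
      8 * (c : ℝ) * ∫ w, (normSqMean w - 1) ^ 2 ∂μ + 1500 * (c : ℝ) ^ 3 / k ^ 2 := by
  have hp := h.isProbabilityMeasure
  have hX := h.allMoments_normSqMean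
  have hl := h.lintegral_exp_normSq_le hc
  have hexp : Integrable (fun w : Euc k => Real.exp (‖w‖ ^ 2 / (4 * c))) μ := by
    refine ⟨by fun_prop, ?_⟩
    rw [hasFiniteIntegral_iff_ofReal (Eventually.of_forall fun w => (Real.exp_pos _).le)]
    exact hl.trans_lt (by simp)
  have hexp' : ∫ w : Euc k, Real.exp (‖w‖ ^ 2 / (4 * c)) ∂μ ≤ 2 ^ k := by
    rw [← ofReal_integral_eq_lintegral_ofReal hexp
      (Eventually.of_forall fun w => (Real.exp_pos _).le)] at hl
    have : (2 : ℝ≥0∞) ^ k = ENNReal.ofReal (2 ^ k) := by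
      rw [ENNReal.ofReal_pow (by norm_num)]; simp
    rw [this] at hl
    exact (ENNReal.ofReal_le_ofReal_iff (by positivity)).1 hl
  have i1 : Integrable (fun w => (normSqMean w - 1) ^ 2) μ :=
    ((hX.sub (AllMoments.const 1)).pow 2).integrable
  calc _ ≤ ∫ w, (8 * (c : ℝ) * (normSqMean w - 1) ^ 2 +
        1500 * (c : ℝ) ^ 3 / k ^ 2 * (Real.exp (‖w‖ ^ 2 / (4 * c)) * (2 ^ k)⁻¹)) ∂μ := by
        refine integral_mono (hX.mul ((hX.sub (AllMoments.const 1)).pow 2)).integrable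
          ((i1.const_mul (8 * (c : ℝ))).add ((hexp.mul_const ((2 ^ k)⁻¹)).const_mul
            (1500 * (c : ℝ) ^ 3 / k ^ 2))) fun w => ?_
        exact normSqMean_mul_sub_one_sq_le (h.one_le_eight_mul hc hk) hk w
    _ = 8 * (c : ℝ) * ∫ w, (normSqMean w - 1) ^ 2 ∂μ +
        1500 * (c : ℝ) ^ 3 / k ^ 2 * ((∫ w, Real.exp (‖w‖ ^ 2 / (4 * c)) ∂μ) * (2 ^ k)⁻¹) := by
        rw [integral_add (i1.const_mul _) ((hexp.mul_const _).const_mul _), integral_const_mul,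
          integral_const_mul, integral_mul_const]
    _ ≤ _ := by
        have h1 : (∫ w : Euc k, Real.exp (‖w‖ ^ 2 / (4 * c)) ∂μ) * ((2 : ℝ) ^ k)⁻¹ ≤ 1 := by
          rw [← div_eq_mul_inv, div_le_one (by positivity)]; exact hexp'
        have h2 : (0 : ℝ) ≤ 1500 * (c : ℝ) ^ 3 / k ^ 2 := by positivity
        nlinarith [mul_le_mul_of_nonneg_left h1 h2]

/-- The coordinate `a` is split off, and the weight `w a²` is invariant under isometries fixing it,
so the fourth moment formula applies to the other coordinates, whose coefficients sum to `-m a`. The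
remaining moments reduce to sixth moments, bounded by `4 · 6! · c³ = 2880 c³`. -/
theorem integral_apply_sq_mul_quadratic_sq_le (h : IsIsotropic μ c) (hc : 0 < c) {m : Fin k → ℝ}
    (hm : ∑ l, m l = 0) (a : Fin k) :
    ∫ w, w a ^ 2 * (∑ l, m l * w l ^ 2) ^ 2 ∂μ ≤ 6 * (2880 * (c : ℝ) ^ 3) * ∑ l, m l ^ 2 := by
  have hp := h.isProbabilityMeasure
  have hw := h.allMoments_apply
  set D := ∑ l, m l ^ 2 with hD
  set A := Finset.univ.erase a with hA
  have hM6 : ∀ l, ∫ w, w l ^ 6 ∂μ ≤ 2880 * (c : ℝ) ^ 3 := by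
    intro l
    have := h.integral_apply_pow_le hc l 3
    norm_num [Nat.factorial] at this
    exact this
  have hsplit : ∀ f : Fin k → ℝ, ∑ l, f l = f a + ∑ l ∈ A, f l := fun f =>
    (Finset.add_sum_erase _ _ (Finset.mem_univ a)).symm
  have hmA : ∑ l ∈ A, m l = -m a := by
    have := hsplit m
    rw [hm] at this; linarith
  have hDA : D = m a ^ 2 + ∑ l ∈ A, m l ^ 2 := hsplit _
  have hDA0 : 0 ≤ ∑ l ∈ A, m l ^ 2 := Finset.sum_nonneg fun l _ => sq_nonneg _
  have hma : m a ^ 2 ≤ D := by linarith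
  have hYA : AllMoments (fun w : Euc k => w a ^ 2 * (∑ l ∈ A, m l * w l ^ 2) ^ 2) μ :=
    ((hw a).pow 2).mul ((AllMoments.sum A fun l _ => ((hw l).pow 2).const_mul _).pow 2)
  have hY : AllMoments (fun w : Euc k => w a ^ 2 * (∑ l, m l * w l ^ 2) ^ 2) μ :=
    ((hw a).pow 2).mul ((AllMoments.sum _ fun l _ => ((hw l).pow 2).const_mul _).pow 2)
  have hA2 : ∫ w, w a ^ 2 * (∑ l ∈ A, m l * w l ^ 2) ^ 2 ∂μ ≤ 2 * (2880 * (c : ℝ) ^ 3) * D := by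
    rcases A.eq_empty_or_nonempty with hE | ⟨b, hb⟩
    · simp [hE]
      positivity
    · have hinv : ∀ L : Euc k ≃ₗᵢ[ℝ] Euc k,
          (∀ i ∉ A, L (EuclideanSpace.single i 1) = EuclideanSpace.single i 1) →
          ∀ w, (L w) a ^ 2 = w a ^ 2 := by
        intro L hL w
        have h1 := L.inner_map_map (EuclideanSpace.single a 1) w
        rw [hL a (by simp [hA])] at h1
        simp only [EuclideanSpace.inner_single_left, map_one, one_mul] at h1
        rw [h1]
      rw [h.integral_mul_quadratic_sq ((hw a).pow 2) hinv hb, hmA]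
      have hR : ∫ w, w a ^ 2 * w b ^ 4 ∂μ ≤ 2 * (2880 * (c : ℝ) ^ 3) := by
        calc _ ≤ ∫ w, (w a ^ 6 + w b ^ 6) ∂μ := by
              refine integral_mono (((hw a).pow 2).mul ((hw b).pow 4)).integrable
                (((hw a).pow 6).add ((hw b).pow 6)).integrable fun w => ?_
              have h1 := sq_nonneg (w a)
              have h2 := sq_nonneg (w b)
              have e1 : w a ^ 6 = (w a ^ 2) ^ 3 := by ring
              have e2 : w b ^ 6 = (w b ^ 2) ^ 3 := by ring
              have e3 : w b ^ 4 = (w b ^ 2) ^ 2 := by ring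
              simp only
              rw [e1, e2, e3]
              generalize w a ^ 2 = x at *
              generalize w b ^ 2 = y at *
              rcases le_total x y with hxy | hxy
              · nlinarith [pow_nonneg h1 3, mul_le_mul_of_nonneg_right hxy (sq_nonneg y)]
              · nlinarith [pow_nonneg h2 3, mul_le_mul_of_nonneg_left
                  (pow_le_pow_left₀ h2 hxy 2) h1]
          _ = ∫ w, w a ^ 6 ∂μ + ∫ w, w b ^ 6 ∂μ :=
              integral_add ((hw a).pow 6).integrable ((hw b).pow 6).integrable
          _ ≤ _ := by linarith [hM6 a, hM6 b]
      have hR0 : 0 ≤ ∫ w, w a ^ 2 * w b ^ 4 ∂μ := integral_nonneg fun w => by positivity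
      have : (-m a) ^ 2 + 2 * ∑ l ∈ A, m l ^ 2 ≤ 3 * D := by rw [hDA]; nlinarith [sq_nonneg (m a)]
      have hD0 : 0 ≤ D := by linarith [sq_nonneg (m a)]
      calc _ ≤ (∫ w, w a ^ 2 * w b ^ 4 ∂μ) / 3 * (3 * D) := by gcongr
        _ = (∫ w, w a ^ 2 * w b ^ 4 ∂μ) * D := by ring
        _ ≤ _ := by gcongr
  calc _ ≤ ∫ w, (2 * m a ^ 2 * w a ^ 6 + 2 * (w a ^ 2 * (∑ l ∈ A, m l * w l ^ 2) ^ 2)) ∂μ := by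
        refine integral_mono hY.integrable
          ((((hw a).pow 6).const_mul _).add (hYA.const_mul _)).integrable fun w => ?_
        simp only
        rw [hsplit fun l => m l * w l ^ 2]
        nlinarith [mul_nonneg (sq_nonneg (w a))
          (sq_nonneg (m a * w a ^ 2 - ∑ l ∈ A, m l * w l ^ 2))]
    _ = 2 * m a ^ 2 * ∫ w, w a ^ 6 ∂μ +
        2 * ∫ w, w a ^ 2 * (∑ l ∈ A, m l * w l ^ 2) ^ 2 ∂μ := by
        rw [integral_add (((hw a).pow 6).const_mul _).integrable (hYA.const_mul _).integrable,
          integral_const_mul, integral_const_mul]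
    _ ≤ 2 * D * (2880 * (c : ℝ) ^ 3) + 2 * (2 * (2880 * (c : ℝ) ^ 3) * D) := by
        gcongr
        exact hM6 a
    _ = _ := by ring

/-- A centered diagonal quadratic form without full rank dominates, in mean square, its product
with any coordinate. -/
theorem integral_apply_sq_mul_diag_sq_le (h : IsIsotropic μ c) (hc : 0 < c) {d : Fin k → ℝ}
    {l₀ : Fin k} (hl₀ : d l₀ = 0) (a : Fin k) :
    ∫ w, w a ^ 2 * (∑ l, d l * w l ^ 2 - ∑ l, d l) ^ 2 ∂μ ≤
      (60000 * (c : ℝ) ^ 3 + 16 * c) * ∫ w, (∑ l, d l * w l ^ 2 - ∑ l, d l) ^ 2 ∂μ := by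
  have hp := h.isProbabilityMeasure
  have hw := h.allMoments_apply
  have hX := h.allMoments_normSqMean
  have hk : 0 < k := l₀.pos
  have hk' : (k : ℝ) ≠ 0 := by exact_mod_cast hk.ne'
  set T := ∑ l, d l with hT
  -- The form splits into a traceless part `Y` and the radial part `T (normSqMean - 1)`.
  set m : Fin k → ℝ := fun l => d l - T / k with hm
  set D := ∑ l, m l ^ 2 with hD
  have hD0 : 0 ≤ D := Finset.sum_nonneg fun l _ => sq_nonneg _
  set Y : Euc k → ℝ := fun w => ∑ l, m l * w l ^ 2 with hY
  have hYm : AllMoments Y μ := AllMoments.sum _ fun l _ => ((hw l).pow 2).const_mul _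
  have hX1 : AllMoments (fun w : Euc k => normSqMean w - 1) μ := hX.sub (AllMoments.const 1)
  have hm0 : ∑ l, m l = 0 := by
    simp only [hm, Finset.sum_sub_distrib, Finset.sum_const, Finset.card_univ, Fintype.card_fin,
      nsmul_eq_mul, ← hT]
    field_simp
    ring
  have hq : ∀ w : Euc k, ∑ l, d l * w l ^ 2 - T = Y w + T * (normSqMean w - 1) := by
    intro w
    have : Y w = ∑ l, d l * w l ^ 2 - T / k * ∑ l, w l ^ 2 := by
      simp only [hY, hm, sub_mul, Finset.sum_sub_distrib, Finset.mul_sum]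
    rw [this, normSqMean_eq]
    ring
  simp_rw [hq]
  have hM4 : 1 ≤ ∫ w, w a ^ 4 ∂μ := by
    have h1 : ∫ w, (2 * w a ^ 2 - 1) ∂μ ≤ ∫ w, w a ^ 4 ∂μ := by
      refine integral_mono ((((hw a).pow 2).const_mul 2).sub (AllMoments.const 1)).integrable
        ((hw a).pow 4).integrable fun w => ?_
      simp only
      nlinarith [sq_nonneg (w a ^ 2 - 1)]
    rw [integral_sub (((hw a).pow 2).const_mul 2).integrable (integrable_const _),
      integral_const_mul, h.integral_apply_sq] at h1
    simp at h1
    linarith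
  have hEY : 2 / 3 * D ≤ ∫ w, Y w ^ 2 ∂μ := by
    have := h.integral_mul_quadratic_sq (A := Finset.univ) (g := fun _ => 1) (AllMoments.const 1)
      (fun _ _ _ => rfl) (Finset.mem_univ a) m
    simp only [one_mul] at this
    rw [this, hm0, ← hD]
    nlinarith
  -- The two parts are orthogonal: against the invariant weight `normSqMean - 1` all squared
  -- coordinates integrate alike, and the coefficients `m` sum to zero.
  have hcross : ∫ w, Y w * (normSqMean w - 1) ∂μ = 0 := by
    have e : ∀ w, Y w * (normSqMean w - 1) = ∑ l, m l * ((normSqMean w - 1) * w l ^ 2) := by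
      intro w
      simp only [hY, Finset.sum_mul]
      exact Finset.sum_congr rfl fun l _ => by ring
    simp_rw [e]
    rw [integral_finsetSum _ fun l _ => ((hX1.mul ((hw l).pow 2)).const_mul _).integrable]
    simp_rw [integral_const_mul]
    simp_rw [h.integral_sq_mul_invariant hX1 fun L w => by simp only [normSqMean_isometry]]
    rw [← Finset.sum_mul, hm0, zero_mul]
  set V := ∫ w, (normSqMean w - 1) ^ 2 ∂μ with hV
  have hEq : ∫ w, (Y w + T * (normSqMean w - 1)) ^ 2 ∂μ = ∫ w, Y w ^ 2 ∂μ + T ^ 2 * V := by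
    have e : ∀ w, (Y w + T * (normSqMean w - 1)) ^ 2 =
        (Y w ^ 2 + 2 * T * (Y w * (normSqMean w - 1))) + T ^ 2 * (normSqMean w - 1) ^ 2 := by
      intro w; ring
    simp_rw [e]
    have i1 := (hYm.pow 2)
    have i2 := ((hYm.mul hX1).const_mul (2 * T))
    have i3 := ((hX1.pow 2).const_mul (T ^ 2))
    rw [integral_add (i1.add i2).integrable i3.integrable, integral_add i1.integrable i2.integrable,
      integral_const_mul, integral_const_mul, hcross]
    ring
  -- The only use of the vanishing eigenvalue: `m l₀ = -T / k`, so the traceless part controls the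
  -- additive `k⁻²` remainder of the radial estimate.
  have hTD : T ^ 2 / k ^ 2 ≤ D := by
    have h1 : m l₀ ^ 2 ≤ D :=
      Finset.single_le_sum (f := fun l => m l ^ 2) (fun l _ => sq_nonneg _) (Finset.mem_univ l₀)
    rw [hm] at h1
    simp only [hl₀] at h1
    calc T ^ 2 / k ^ 2 = (0 - T / k) ^ 2 := by ring
      _ ≤ D := h1
  have hEX : ∫ w, (normSqMean w - 1) ^ 2 * w a ^ 2 ∂μ ≤ 8 * c * V + 1500 * c ^ 3 / k ^ 2 := by
    rw [h.integral_sq_mul_invariant (hX1.pow 2) fun L w => by simp only [normSqMean_isometry]]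
    have := h.integral_normSqMean_mul_sub_one_sq_le hc hk
    simpa only [mul_comm (normSqMean _)] using this
  have hEaY := h.integral_apply_sq_mul_quadratic_sq_le hc hm0 a
  have hc0 : (0 : ℝ) < c := by exact_mod_cast hc
  calc _ ≤ ∫ w, (2 * (w a ^ 2 * Y w ^ 2) +
        2 * T ^ 2 * ((normSqMean w - 1) ^ 2 * w a ^ 2)) ∂μ := by
        refine integral_mono (((hw a).pow 2).mul ((hYm.add (hX1.const_mul T)).pow 2)).integrable
          (((((hw a).pow 2).mul (hYm.pow 2)).const_mul _).add
            (((hX1.pow 2).mul ((hw a).pow 2)).const_mul _)).integrable fun w => ?_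
        simp only
        nlinarith [mul_nonneg (sq_nonneg (w a)) (sq_nonneg (Y w - T * (normSqMean w - 1)))]
    _ = 2 * ∫ w, w a ^ 2 * Y w ^ 2 ∂μ +
        2 * T ^ 2 * ∫ w, (normSqMean w - 1) ^ 2 * w a ^ 2 ∂μ := by
        rw [integral_add ((((hw a).pow 2).mul (hYm.pow 2)).const_mul _).integrable
          (((hX1.pow 2).mul ((hw a).pow 2)).const_mul _).integrable, integral_const_mul,
          integral_const_mul]
    _ ≤ 2 * (6 * (2880 * (c : ℝ) ^ 3) * D) +
        2 * T ^ 2 * (8 * c * V + 1500 * c ^ 3 / k ^ 2) := by gcongr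
    _ = 34560 * (c : ℝ) ^ 3 * D + 3000 * c ^ 3 * (T ^ 2 / k ^ 2) + 16 * c * (T ^ 2 * V) := by ring
    _ ≤ 34560 * (c : ℝ) ^ 3 * D + 3000 * c ^ 3 * D + 16 * c * (T ^ 2 * V) := by gcongr
    _ ≤ (60000 * (c : ℝ) ^ 3 + 16 * c) * (2 / 3 * D + T ^ 2 * V) := by
        have hV0 : 0 ≤ V := integral_nonneg fun w => sq_nonneg _
        have h1 : 0 ≤ (c : ℝ) ^ 3 * D := by positivity
        have h2 : 0 ≤ (c : ℝ) ^ 3 * (T ^ 2 * V) := by positivity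
        have h3 : 0 ≤ (c : ℝ) * D := by positivity
        nlinarith
    _ ≤ _ := by
        rw [hEq]
        gcongr

/-- Changing the sign of one coordinate leaves a diagonal form unchanged, so the mixed terms `w a *
w b` drop out and the coordinate bound can be summed against `o a²`. -/
theorem integral_inner_sq_mul_diag_sq_le (h : IsIsotropic μ c) (hc : 0 < c) {d : Fin k → ℝ}
    {l₀ : Fin k} (hl₀ : d l₀ = 0) (o : Euc k) :
    ∫ w, inner ℝ o w ^ 2 * (∑ l, d l * w l ^ 2 - ∑ l, d l) ^ 2 ∂μ ≤
      (60000 * (c : ℝ) ^ 3 + 16 * c) * ‖o‖ ^ 2 *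
        ∫ w, (∑ l, d l * w l ^ 2 - ∑ l, d l) ^ 2 ∂μ := by
  have hp := h.isProbabilityMeasure
  have hw := h.allMoments_apply
  set q : Euc k → ℝ := fun w => ∑ l, d l * w l ^ 2 - ∑ l, d l with hq
  have hqm : AllMoments q μ :=
    (AllMoments.sum _ fun l _ => ((hw l).pow 2).const_mul _).sub (AllMoments.const _)
  have hoff : ∀ a b, a ≠ b → ∫ w, w a * w b * q w ^ 2 ∂μ = 0 := by
    intro a b hab
    obtain ⟨L, hL, hL', hLx⟩ := exists_isometry_swap (E := Euc k)
      (u := EuclideanSpace.single a 1) (v := -EuclideanSpace.single a 1) (by simp)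
    have ha : ∀ w, (L w) a = -w a := by
      intro w
      have h1 := L.inner_map_map (-EuclideanSpace.single a 1) w
      rw [hL'] at h1
      simpa [EuclideanSpace.inner_single_left] using h1
    have hb : ∀ w l, l ≠ a → (L w) l = w l := by
      intro w l hl
      have h1 := L.inner_map_map (EuclideanSpace.single l 1) w
      rw [hLx _ (by simp [EuclideanSpace.inner_single_left, hl])] at h1
      simpa [EuclideanSpace.inner_single_left] using h1
    have hqL : ∀ w, q (L w) = q w := by
      intro w
      simp only [hq]
      congr 1
      refine Finset.sum_congr rfl fun l _ => ?_
      by_cases hl : l = a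
      · rw [hl, ha, neg_sq]
      · rw [hb w l hl]
    have h1 := h.integral_comp_isometry L fun w => w a * w b * q w ^ 2
    simp only [ha, hb _ b hab.symm, hqL, neg_mul, integral_neg] at h1
    linarith
  have e : ∀ w, inner ℝ o w ^ 2 * q w ^ 2 = ∑ a, ∑ b, o a * o b * (w a * w b * q w ^ 2) := by
    intro w
    simp only [PiLp.inner_apply, RCLike.inner_apply, conj_trivial]
    rw [sq, Finset.sum_mul_sum, Finset.sum_mul]
    refine Finset.sum_congr rfl fun l _ => ?_
    rw [Finset.sum_mul]
    refine Finset.sum_congr rfl fun m _ => ?_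
    ring
  have hInt : ∀ a b, Integrable (fun w => o a * o b * (w a * w b * q w ^ 2)) μ := fun a b =>
    ((((hw a).mul (hw b)).mul (hqm.pow 2)).const_mul _).integrable
  calc ∫ w, inner ℝ o w ^ 2 * q w ^ 2 ∂μ
      = ∑ a, ∑ b, o a * o b * ∫ w, w a * w b * q w ^ 2 ∂μ := by
        simp_rw [e]
        rw [integral_finsetSum _ fun l _ => integrable_finsetSum _ fun m _ => hInt l m]
        simp_rw [integral_finsetSum Finset.univ fun m _ => hInt _ m, integral_const_mul]
    _ = ∑ a, o a ^ 2 * ∫ w, w a ^ 2 * q w ^ 2 ∂μ := by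
        refine Finset.sum_congr rfl fun a _ => ?_
        rw [Finset.sum_eq_single a]
        · simp_rw [sq (_ : ℝ)]
        · intro b _ hb
          rw [hoff a b hb.symm, mul_zero]
        · simp
    _ ≤ ∑ a, o a ^ 2 * ((60000 * (c : ℝ) ^ 3 + 16 * c) * ∫ w, q w ^ 2 ∂μ) := by
        gcongr with a
        exact h.integral_apply_sq_mul_diag_sq_le hc hl₀ a
    _ = _ := by
        rw [← Finset.sum_mul, EuclideanSpace.norm_sq_eq]
        simp only [Real.norm_eq_abs, sq_abs]
        ring

/-- The quadratic form `wᵀ Q w` centered at its mean under an isotropic law. -/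
def centeredForm (Q : Matrix (Fin k) (Fin k) ℝ) (w : Euc k) : ℝ :=
  (w : Fin k → ℝ) ⬝ᵥ (Q *ᵥ (w : Fin k → ℝ)) - Q.trace

/-- A centered quadratic form without full rank dominates, in mean square, its product with any
linear functional. -/
theorem integral_inner_sq_mul_centeredForm_sq_le (h : IsIsotropic μ c) (hc : 0 < c)
    {Q : Matrix (Fin k) (Fin k) ℝ} (hQ : Q.IsHermitian) (hQ0 : Q.det = 0) (o : Euc k) :
    ∫ w, inner ℝ o w ^ 2 * centeredForm Q w ^ 2 ∂μ ≤
      (60000 * (c : ℝ) ^ 3 + 16 * c) * ‖o‖ ^ 2 * ∫ w, centeredForm Q w ^ 2 ∂μ := by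
  -- A vanishing determinant provides a zero eigenvalue. Rotation to the eigenbasis, which preserves
  -- the law, reduces to the diagonal case.
  obtain ⟨l₀, hl₀⟩ : ∃ l, hQ.eigenvalues l = 0 := by
    rw [hQ.det_eq_prod_eigenvalues] at hQ0
    obtain ⟨l, -, hl⟩ := Finset.prod_eq_zero_iff.1 hQ0
    exact ⟨l, by simpa using hl⟩
  set L : Euc k ≃ₗᵢ[ℝ] Euc k := hQ.eigenvectorBasis.repr with hL
  have hform : ∀ w, centeredForm Q w =
      ∑ l, hQ.eigenvalues l * (L w) l ^ 2 - ∑ l, hQ.eigenvalues l := by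
    intro w
    have htr : Q.trace = ∑ l, hQ.eigenvalues l := by
      rw [hQ.trace_eq_sum_eigenvalues]; simp
    have hmul : ∀ l, inner ℝ (hQ.eigenvectorBasis l) (WithLp.toLp 2 (Q *ᵥ w.ofLp)) =
        hQ.eigenvalues l * inner ℝ (hQ.eigenvectorBasis l) w := by
      intro l
      have h1 := hQ.mulVec_eigenvectorBasis l
      have h2 : inner ℝ (hQ.eigenvectorBasis l) (WithLp.toLp 2 (Q *ᵥ w.ofLp)) =
          (Q *ᵥ (hQ.eigenvectorBasis l).ofLp) ⬝ᵥ w.ofLp := by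
        have hQt : Qᵀ = Q := by rwa [Matrix.IsHermitian, Matrix.conjTranspose_eq_transpose_of_trivial] at hQ
        rw [EuclideanSpace.inner_eq_star_dotProduct]
        simp only [star_trivial]
        generalize (hQ.eigenvectorBasis l).ofLp = v
        nth_rw 2 [← hQt]
        rw [Matrix.mulVec_transpose, ← Matrix.dotProduct_mulVec, dotProduct_comm]
      rw [h2, h1, smul_dotProduct, EuclideanSpace.inner_eq_star_dotProduct]
      simp [dotProduct_comm]
    have hdot : w.ofLp ⬝ᵥ (Q *ᵥ w.ofLp) = inner ℝ w (WithLp.toLp 2 (Q *ᵥ w.ofLp)) := by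
      rw [EuclideanSpace.inner_eq_star_dotProduct]
      simp [dotProduct_comm]
    rw [centeredForm, htr, hdot, ← hQ.eigenvectorBasis.sum_inner_mul_inner]
    congr 1
    refine Finset.sum_congr rfl fun l _ => ?_
    rw [hmul, hL, OrthonormalBasis.repr_apply_apply, real_inner_comm]
    ring
  have h1 := h.integral_inner_sq_mul_diag_sq_le hc hl₀ (L o)
  rw [← h.integral_comp_isometry L, ← h.integral_comp_isometry L (fun w => (_ : ℝ) ^ 2)] at h1
  simpa only [LinearIsometryEquiv.inner_map_map, ← hform, LinearIsometryEquiv.norm_map] using h1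

end IsIsotropic

/-! ### Deterministic analysis of the LASSO -/

section Lasso

variable {n d : ℕ}

/-- The residuals of the fit `θ`. -/
def residual (Y : Fin n → ℝ) (X : Fin n → Fin d → ℝ) (θ : ℝ × (Fin d → ℝ)) (i : Fin n) : ℝ :=
  Y i - θ.1 - ∑ j, X i j * θ.2 j

theorem lassoObjective_add (Y : Fin n → ℝ) (X : Fin n → Fin d → ℝ) (lam : ℝ)
    (θ h : ℝ × (Fin d → ℝ)) :
    lassoObjective Y X lam (θ + h) - lassoObjective Y X lam θ =
      1 / (2 * (n : ℝ)) * ∑ i, (h.1 + ∑ j, X i j * h.2 j) ^ 2 -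
        (n : ℝ)⁻¹ * ∑ i, residual Y X θ i * (h.1 + ∑ j, X i j * h.2 j) +
        ∑ j, lam * (|θ.2 j + h.2 j| - |θ.2 j|) := by
  have e1 : ∀ i, Y i - (θ + h).1 - ∑ j, X i j * (θ + h).2 j =
      residual Y X θ i - (h.1 + ∑ j, X i j * h.2 j) := by
    intro i
    simp only [residual, Prod.fst_add, Prod.snd_add, Pi.add_apply, mul_add, Finset.sum_add_distrib]
    ring
  have e2 : ∀ i, Y i - θ.1 - ∑ j, X i j * θ.2 j = residual Y X θ i := fun i => rfl
  simp only [lassoObjective, e1, e2]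
  generalize residual Y X θ = r at *
  simp only [sub_sq, Finset.sum_add_distrib, Finset.sum_sub_distrib, mul_sub, Prod.snd_add,
    Pi.add_apply]
  have e3 : ∑ i, 2 * r i * (h.1 + ∑ j, X i j * h.2 j) =
      2 * ∑ i, r i * (h.1 + ∑ j, X i j * h.2 j) := by
    rw [Finset.mul_sum]; exact Finset.sum_congr rfl fun i _ => by ring
  rw [e3]
  ring

theorem continuous_lassoObjective (Y : Fin n → ℝ) (X : Fin n → Fin d → ℝ) (lam : ℝ) :
    Continuous (lassoObjective Y X lam) := by
  unfold lassoObjective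
  fun_prop

/-- Coercivity: the penalty bounds the slopes on a sublevel set, and the unpenalized intercept is
then bounded through the residual of one observation, using `|a| ≤ a² + 1`. -/
theorem exists_restricted_minimizer (hn : n ≠ 0) (Y : Fin n → ℝ) (X : Fin n → Fin d → ℝ)
    {lam : ℝ} (hlam : 0 < lam) (S : Finset (Fin d)) :
    ∃ θ : ℝ × (Fin d → ℝ), (∀ j ∉ S, θ.2 j = 0) ∧ ∀ θ' : ℝ × (Fin d → ℝ),
      (∀ j ∉ S, θ'.2 j = 0) → lassoObjective Y X lam θ ≤ lassoObjective Y X lam θ' := by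
  set F := lassoObjective Y X lam 0 with hF
  set K : Set (ℝ × (Fin d → ℝ)) :=
    {θ | (∀ j ∉ S, θ.2 j = 0) ∧ lassoObjective Y X lam θ ≤ F} with hK
  have hcont := continuous_lassoObjective Y X lam
  have hclosed : IsClosed K := by
    refine IsClosed.inter ?_ (isClosed_le hcont continuous_const)
    have : {θ : ℝ × (Fin d → ℝ) | ∀ j ∉ S, θ.2 j = 0} =
        ⋂ j, ⋂ (_ : j ∉ S), {θ : ℝ × (Fin d → ℝ) | θ.2 j = 0} := by ext; simp
    change IsClosed {θ : ℝ × (Fin d → ℝ) | ∀ j ∉ S, θ.2 j = 0}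
    rw [this]
    exact isClosed_iInter fun j => isClosed_iInter fun _ =>
      isClosed_eq (by fun_prop) continuous_const
  have hn0 : 0 < n := Nat.pos_of_ne_zero hn
  have hn' : (0 : ℝ) < n := by exact_mod_cast hn0
  let i₀ : Fin n := ⟨0, hn0⟩
  set R := F / lam with hR
  set R₀ := |Y i₀| + ∑ j, |X i₀ j| * R + (2 * n * F + 1) with hR₀
  have hbdd : Bornology.IsBounded K := by
    refine (Metric.isBounded_closedBall (x := (0 : ℝ × (Fin d → ℝ))) (r := max R₀ R)).subset ?_
    rintro θ ⟨-, hθ⟩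
    have hsq : 0 ≤ 1 / (2 * (n : ℝ)) * ∑ i, (Y i - θ.1 - ∑ j, X i j * θ.2 j) ^ 2 := by positivity
    have hab : 0 ≤ ∑ j, lam * |θ.2 j| :=
      Finset.sum_nonneg fun j _ => mul_nonneg hlam.le (abs_nonneg _)
    rw [lassoObjective] at hθ
    have hF0 : 0 ≤ F := by linarith
    have h1 : ∀ j, |θ.2 j| ≤ R := by
      intro j
      rw [hR, le_div_iff₀ hlam]
      have := Finset.single_le_sum (f := fun j => lam * |θ.2 j|)
        (fun j _ => mul_nonneg hlam.le (abs_nonneg _)) (Finset.mem_univ j)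
      linarith
    have hR0 : 0 ≤ R := div_nonneg hF0 hlam.le
    have h2 : |θ.1| ≤ R₀ := by
      set a := Y i₀ - θ.1 - ∑ j, X i₀ j * θ.2 j with ha
      have h3 : a ^ 2 ≤ 2 * n * F := by
        have := Finset.single_le_sum (f := fun i => (Y i - θ.1 - ∑ j, X i j * θ.2 j) ^ 2)
          (fun i _ => sq_nonneg _) (Finset.mem_univ i₀)
        have h4 : 1 / (2 * (n : ℝ)) * a ^ 2 ≤ F := by
          refine le_trans ?_ (le_trans (le_add_of_nonneg_right hab) hθ)
          exact mul_le_mul_of_nonneg_left this (by positivity)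
        rw [div_mul_eq_mul_div, one_mul, div_le_iff₀ (by positivity)] at h4
        linarith
      have h5 : |a| ≤ 2 * n * F + 1 := by
        rw [← sq_abs] at h3
        nlinarith [sq_nonneg (|a| - 1), abs_nonneg a, sq_nonneg (|a|)]
      have h6 : |∑ j, X i₀ j * θ.2 j| ≤ ∑ j, |X i₀ j| * R := by
        refine (Finset.abs_sum_le_sum_abs _ _).trans (Finset.sum_le_sum fun j _ => ?_)
        rw [abs_mul]
        exact mul_le_mul_of_nonneg_left (h1 j) (abs_nonneg _)
      have h7 : θ.1 = Y i₀ - ∑ j, X i₀ j * θ.2 j - a := by rw [ha]; ring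
      rw [h7, hR₀]
      exact (abs_sub _ _).trans (add_le_add ((abs_sub _ _).trans (add_le_add le_rfl h6)) h5)
    rw [mem_closedBall_zero_iff, Prod.norm_def]
    refine max_le_max h2 ?_
    rw [pi_norm_le_iff_of_nonneg hR0]
    exact h1
  have hcomp : IsCompact K := Metric.isCompact_of_isClosed_isBounded hclosed hbdd
  obtain ⟨θ, hθ, hmin⟩ := hcomp.exists_isMinOn ⟨0, by simp [hK, hF]⟩ hcont.continuousOn
  refine ⟨θ, hθ.1, fun θ' hθ' => ?_⟩
  by_cases h : lassoObjective Y X lam θ' ≤ F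
  · exact hmin ⟨hθ', h⟩
  · exact hθ.2.trans (not_le.1 h).le

/-- One-sided derivatives at zero. Moving up and down bounds `G`; shrinking `θ` towards zero by the
factor `1 - t` gives the complementarity identity. -/
theorem subgradient_of_quadratic_bound {C G lam θ : ℝ} (hlam : 0 < lam)
    (h : ∀ t : ℝ, 0 ≤ C * t ^ 2 - G * t + lam * (|θ + t| - |θ|)) :
    |G| ≤ lam ∧ G * θ = lam * |θ| := by
  -- Otherwise a step of length at most `-a / (2 (|D| + 1))` would make the expression negative; the
  -- `+ 1` covers `D = 0`.
  have lin : ∀ a D : ℝ, (∀ t : ℝ, 0 < t → t ≤ 1 → 0 ≤ D * t ^ 2 + a * t) → 0 ≤ a := by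
    intro a D hD
    by_contra ha
    push Not at ha
    have hD1 : 0 < |D| + 1 := by positivity
    set t := min 1 (-a / (2 * (|D| + 1))) with ht
    have ht0 : 0 < t := lt_min one_pos (div_pos (by linarith) (by positivity))
    have h1 := hD t ht0 (min_le_left _ _)
    have h2 : t * (2 * (|D| + 1)) ≤ -a := by
      rw [← le_div_iff₀ (by positivity)]; exact min_le_right _ _
    have h3 : D ≤ |D| := le_abs_self D
    nlinarith [mul_pos ht0 ht0, mul_le_mul_of_nonneg_right h3 (mul_pos ht0 ht0).le,
      mul_le_mul_of_nonneg_left h2 ht0.le]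
  have hG1 : 0 ≤ lam - G := by
    refine lin _ C fun t ht _ => ?_
    have h1 := h t
    have h2 : |θ + t| - |θ| ≤ t := by
      have := abs_add_le θ t; rw [abs_of_pos ht] at this; linarith
    nlinarith [mul_le_mul_of_nonneg_left h2 hlam.le]
  have hG2 : 0 ≤ lam + G := by
    refine lin _ C fun t ht _ => ?_
    have h1 := h (-t)
    have h2 : |θ + -t| - |θ| ≤ t := by
      have := abs_add_le θ (-t); rw [abs_neg, abs_of_pos ht] at this; linarith
    nlinarith [mul_le_mul_of_nonneg_left h2 hlam.le]
  have hG : |G| ≤ lam := abs_le.2 ⟨by linarith, by linarith⟩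
  refine ⟨hG, le_antisymm ?_ ?_⟩
  · calc G * θ ≤ |G * θ| := le_abs_self _
      _ = |G| * |θ| := abs_mul _ _
      _ ≤ _ := by gcongr
  · have : 0 ≤ G * θ - lam * |θ| := by
      refine lin _ (C * θ ^ 2) fun t ht ht1 => ?_
      have h1 := h (-(t * θ))
      have h2 : |θ + -(t * θ)| = (1 - t) * |θ| := by
        rw [show θ + -(t * θ) = (1 - t) * θ by ring, abs_mul, abs_of_nonneg (by linarith)]
      rw [h2] at h1
      nlinarith
    linarith

/-- The stationarity conditions of the LASSO restricted to the variables in `S`. -/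
theorem restricted_stationarity {Y : Fin n → ℝ} {X : Fin n → Fin d → ℝ}
    {lam : ℝ} (hlam : 0 < lam) {S : Finset (Fin d)} {θ : ℝ × (Fin d → ℝ)}
    (hθ : ∀ j ∉ S, θ.2 j = 0)
    (hmin : ∀ θ' : ℝ × (Fin d → ℝ), (∀ j ∉ S, θ'.2 j = 0) →
      lassoObjective Y X lam θ ≤ lassoObjective Y X lam θ') :
    (n : ℝ)⁻¹ * ∑ i, residual Y X θ i = 0 ∧ ∀ k ∈ S,
      |(n : ℝ)⁻¹ * ∑ i, residual Y X θ i * X i k| ≤ lam ∧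
      ((n : ℝ)⁻¹ * ∑ i, residual Y X θ i * X i k) * θ.2 k = lam * |θ.2 k| := by
  constructor
  · have key : ∀ t : ℝ, 0 ≤ (1 / (2 * (n : ℝ)) * ∑ _i : Fin n, (1 : ℝ)) * t ^ 2 -
        ((n : ℝ)⁻¹ * ∑ i, residual Y X θ i) * t + 0 := by
      intro t
      have h1 := hmin (θ + (t, 0)) (fun j hj => by simp [hθ j hj])
      have h2 := lassoObjective_add Y X lam θ (t, 0)
      simp only [Pi.zero_apply, mul_zero, Finset.sum_const_zero, add_zero, sub_self] at h2
      rw [← Finset.sum_mul] at h2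
      have h3 : ∑ _i : Fin n, t ^ 2 = (∑ _i : Fin n, (1 : ℝ)) * t ^ 2 := by simp
      rw [h3] at h2
      linarith
    set C := 1 / (2 * (n : ℝ)) * ∑ _i : Fin n, (1 : ℝ)
    set G := (n : ℝ)⁻¹ * ∑ i, residual Y X θ i
    by_contra hG
    have hC : 0 ≤ C := by
      have := key 1; have := key (-1); linarith
    have hC1 : 0 < C + 1 := by linarith
    -- Dividing by `C + 1` avoids proving `C ≠ 0`; the value is exactly `-(G / (C + 1))²`, which is
    -- negative unless `G` vanishes.
    have h1 := key (G / (C + 1))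
    have hpos : 0 < G ^ 2 := by positivity
    have e : C * (G / (C + 1)) ^ 2 - G * (G / (C + 1)) + 0 = -(G ^ 2 / (C + 1) ^ 2) := by
      field_simp; ring
    rw [e] at h1
    have : 0 < G ^ 2 / (C + 1) ^ 2 := by positivity
    linarith
  · intro k hk
    refine subgradient_of_quadratic_bound (C := 1 / (2 * (n : ℝ)) * ∑ i, X i k ^ 2) hlam ?_
    intro t
    have h1 := hmin (θ + (0, Pi.single k t)) (fun j hj => by
      have : j ≠ k := fun e => hj (e ▸ hk)
      simp [hθ j hj, this])
    have h2 := lassoObjective_add Y X lam θ (0, Pi.single k t)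
    have e1 : ∀ i, ∑ j, X i j * (Pi.single k t : Fin d → ℝ) j = X i k * t := by
      intro i
      rw [Finset.sum_eq_single k] <;> simp +contextual
    have e2 : ∑ j, lam * (|θ.2 j + (Pi.single k t : Fin d → ℝ) j| - |θ.2 j|) =
        lam * (|θ.2 k + t| - |θ.2 k|) := by
      rw [Finset.sum_eq_single k] <;> simp +contextual
    simp only [zero_add, e1, e2, mul_pow, ← mul_assoc] at h2
    rw [← Finset.sum_mul, ← Finset.sum_mul] at h2
    linarith

/-- A stationary point with strict dual feasibility off `S` is a minimizer, and any other
minimizer has the same fitted values and vanishes off `S`. -/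
theorem isLassoSolution_of_stationarity {Y : Fin n → ℝ} {X : Fin n → Fin d → ℝ}
    {lam : ℝ} {S : Finset (Fin d)} {θ : ℝ × (Fin d → ℝ)}
    (hθ : ∀ j ∉ S, θ.2 j = 0) (h0 : (n : ℝ)⁻¹ * ∑ i, residual Y X θ i = 0)
    (hS : ∀ k ∈ S, |(n : ℝ)⁻¹ * ∑ i, residual Y X θ i * X i k| ≤ lam ∧
      ((n : ℝ)⁻¹ * ∑ i, residual Y X θ i * X i k) * θ.2 k = lam * |θ.2 k|)
    (hSc : ∀ j ∉ S, |(n : ℝ)⁻¹ * ∑ i, residual Y X θ i * X i j| < lam) :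
    IsLassoSolution Y X lam θ ∧ ∀ h : ℝ × (Fin d → ℝ), IsLassoSolution Y X lam (θ + h) →
      (∀ i, h.1 + ∑ j, X i j * h.2 j = 0) ∧ ∀ j ∉ S, h.2 j = 0 := by
  set G : Fin d → ℝ := fun j => (n : ℝ)⁻¹ * ∑ i, residual Y X θ i * X i j with hG
  -- By stationarity, the excess of the criterion is a square plus the gaps `lam |a| - G a`, each
  -- nonnegative because `|G| ≤ lam`. Equality therefore forces equal fitted values, and the strict
  -- inequality off `S` forces zeros there.
  have hident : ∀ h : ℝ × (Fin d → ℝ),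
      lassoObjective Y X lam (θ + h) - lassoObjective Y X lam θ =
      1 / (2 * (n : ℝ)) * ∑ i, (h.1 + ∑ j, X i j * h.2 j) ^ 2 +
        ∑ j, (lam * |θ.2 j + h.2 j| - G j * (θ.2 j + h.2 j)) := by
    intro h
    rw [lassoObjective_add]
    have e1 : (n : ℝ)⁻¹ * ∑ i, residual Y X θ i * (h.1 + ∑ j, X i j * h.2 j) =
        ∑ j, G j * h.2 j := by
      have : ∀ i, residual Y X θ i * (h.1 + ∑ j, X i j * h.2 j) =
          residual Y X θ i * h.1 + ∑ j, residual Y X θ i * X i j * h.2 j := by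
        intro i; rw [mul_add, Finset.mul_sum]
        congr 1
        exact Finset.sum_congr rfl fun j _ => by ring
      simp_rw [this, Finset.sum_add_distrib, mul_add]
      rw [← Finset.sum_mul, ← mul_assoc, h0, zero_mul, zero_add, Finset.sum_comm, Finset.mul_sum]
      refine Finset.sum_congr rfl fun j _ => ?_
      rw [← Finset.sum_mul, hG]
      ring
    have e2 : ∀ j, G j * θ.2 j = lam * |θ.2 j| := by
      intro j
      by_cases hj : j ∈ S
      · exact (hS j hj).2
      · simp [hθ j hj]
    rw [e1]
    have e3 : ∑ j, (lam * |θ.2 j + h.2 j| - G j * (θ.2 j + h.2 j)) =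
        ∑ j, lam * (|θ.2 j + h.2 j| - |θ.2 j|) - ∑ j, G j * h.2 j := by
      rw [← Finset.sum_sub_distrib]
      refine Finset.sum_congr rfl fun j _ => ?_
      have := e2 j
      linarith
    rw [e3]; ring
  have hGle : ∀ j, |G j| ≤ lam := by
    intro j
    by_cases hj : j ∈ S
    · exact (hS j hj).1
    · exact (hSc j hj).le
  have hterm : ∀ j (a : ℝ), 0 ≤ lam * |a| - G j * a := by
    intro j a
    have h1 : G j * a ≤ |G j| * |a| := by rw [← abs_mul]; exact le_abs_self _
    have := mul_le_mul_of_nonneg_right (hGle j) (abs_nonneg a)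
    linarith
  have hmin : ∀ h, lassoObjective Y X lam θ ≤ lassoObjective Y X lam (θ + h) := by
    intro h
    have h1 := hident h
    have h2 : 0 ≤ 1 / (2 * (n : ℝ)) * ∑ i, (h.1 + ∑ j, X i j * h.2 j) ^ 2 := by positivity
    have h3 := Finset.sum_nonneg fun j (_ : j ∈ Finset.univ) => hterm j (θ.2 j + h.2 j)
    linarith
  refine ⟨fun θ' => by simpa using hmin (θ' - θ), fun h hh => ?_⟩
  have h1 := hident h
  have hle := hh θ
  have h2 : 0 ≤ 1 / (2 * (n : ℝ)) * ∑ i, (h.1 + ∑ j, X i j * h.2 j) ^ 2 := by positivity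
  have h3 := Finset.sum_nonneg fun j (_ : j ∈ Finset.univ) => hterm j (θ.2 j + h.2 j)
  have h4 : ∑ j, (lam * |θ.2 j + h.2 j| - G j * (θ.2 j + h.2 j)) = 0 := by linarith
  have h5 : 1 / (2 * (n : ℝ)) * ∑ i, (h.1 + ∑ j, X i j * h.2 j) ^ 2 = 0 := by linarith
  constructor
  · intro i
    have hn : (n : ℝ) ≠ 0 := by
      have := i.pos
      exact_mod_cast this.ne'
    have h6 : ∑ i, (h.1 + ∑ j, X i j * h.2 j) ^ 2 = 0 := by
      rcases mul_eq_zero.1 h5 with h | h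
      · exfalso; apply one_div_ne_zero (a := 2 * (n : ℝ)) _ h; positivity
      · exact h
    have := (Finset.sum_eq_zero_iff_of_nonneg fun i _ => sq_nonneg _).1 h6 i (Finset.mem_univ i)
    exact pow_eq_zero_iff (two_ne_zero) |>.1 this
  · intro j hj
    have h6 := (Finset.sum_eq_zero_iff_of_nonneg fun j _ => hterm j _).1 h4 j (Finset.mem_univ j)
    rw [hθ j hj, zero_add] at h6
    by_contra hne
    have h7 : G j * h.2 j ≤ |G j| * |h.2 j| := by rw [← abs_mul]; exact le_abs_self _
    have h8 := mul_lt_mul_of_pos_right (hSc j hj) (abs_pos.2 hne)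
    simp only [hG] at h6 h7
    linarith

end Lasso

theorem abs_sum_mul_le_sqrt {ι : Type*} (s : Finset ι) (f g : ι → ℝ) :
    |∑ i ∈ s, f i * g i| ≤ √(∑ i ∈ s, f i ^ 2) * √(∑ i ∈ s, g i ^ 2) := by
  rw [← Real.sqrt_sq_eq_abs, ← Real.sqrt_mul (Finset.sum_nonneg fun i _ => sq_nonneg _)]
  exact Real.sqrt_le_sqrt (Finset.sum_mul_sq_le_sq_mul_sq s f g)

/-! ### Empirical Gram matrices near the identity. -/

section Gram

variable {n : ℕ} {ι : Type*} [Fintype ι]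

/-- The squared Frobenius distance of the Gram matrix `n⁻¹ φᵀ φ` to the identity. -/
def gramDev [DecidableEq ι] (φ : Fin n → ι → ℝ) : ℝ :=
  ∑ l, ∑ m, ((n : ℝ)⁻¹ * ∑ i, φ i l * φ i m - if l = m then 1 else 0) ^ 2

/-- The Frobenius norm dominates the operator norm, by Cauchy–Schwarz over pairs of indices.
Frobenius distance is used because its expectation is a plain sum of variances. -/
theorem abs_gram_sub_le [DecidableEq ι] (φ : Fin n → ι → ℝ) (t u : ι → ℝ) :
    |(n : ℝ)⁻¹ * ∑ i, (∑ l, t l * φ i l) * (∑ m, u m * φ i m) - ∑ l, t l * u l| ≤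
      √(gramDev φ) * √(∑ l, t l ^ 2) * √(∑ l, u l ^ 2) := by
  have e : (n : ℝ)⁻¹ * ∑ i, (∑ l, t l * φ i l) * (∑ m, u m * φ i m) - ∑ l, t l * u l =
      ∑ x : ι × ι, ((n : ℝ)⁻¹ * ∑ i, φ i x.1 * φ i x.2 - if x.1 = x.2 then 1 else 0) *
        (t x.1 * u x.2) := by
    rw [Fintype.sum_prod_type]
    simp only [sub_mul, Finset.sum_sub_distrib, ite_mul, one_mul, zero_mul]
    congr 1
    · simp_rw [Finset.sum_mul_sum]
      rw [Finset.sum_comm, Finset.mul_sum]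
      refine Finset.sum_congr rfl fun l _ => ?_
      rw [Finset.sum_comm, Finset.mul_sum]
      refine Finset.sum_congr rfl fun m _ => ?_
      rw [mul_assoc, Finset.sum_mul]
      congr 1
      exact Finset.sum_congr rfl fun i _ => by ring
    · refine Finset.sum_congr rfl fun l _ => ?_
      simp
  rw [e]
  refine (abs_sum_mul_le_sqrt _ _ _).trans (le_of_eq ?_)
  have e1 : ∑ x : ι × ι, (t x.1 * u x.2) ^ 2 = (∑ l, t l ^ 2) * ∑ l, u l ^ 2 := by
    rw [Fintype.sum_prod_type, Finset.sum_mul_sum]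
    simp only [mul_pow]
  rw [mul_assoc, e1, Real.sqrt_mul (Finset.sum_nonneg fun i _ => sq_nonneg _),
    Fintype.sum_prod_type, gramDev]

end Gram

/-- The regressors `(1, z)` of an observation. -/
def withIntercept {ι : Type*} (z : ι → ℝ) (o : Option ι) : ℝ := o.elim 1 z

theorem sqrt_inv_mul_sqrt_div {C s : ℝ} (hC : 0 < C) : √(1 / C) * √(s / C) = √s / C := by
  rw [← Real.sqrt_mul (by positivity), show 1 / C * (s / C) = s / C ^ 2 by field_simp,
    Real.sqrt_div' _ (sq_nonneg _), Real.sqrt_sq hC.le]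

/-- The bound `η ≤ 1 / 2` is spent only on the penalty term. In the noise term the factor `η` is
kept, since it has to be small in product with `Z`. -/
theorem gram_error_le {η T Z lam Q G R P : ℝ} (hη : 0 ≤ η) (hη1 : η ≤ 1 / 2) (hlam : 0 < lam)
    (hQ : 0 ≤ Q) (hT : T ≤ 2 * (Z + lam * Q)) (hT0 : 0 ≤ T) (hG : G ≤ R) (hG0 : 0 ≤ G)
    (hP : R * Q = P) : η * T * G ≤ 2 * (η * Z * R) + lam * P := by
  have hR : 0 ≤ R := hG0.trans hG
  have h0 : 0 ≤ η * (2 * (Z + lam * Q)) := mul_nonneg hη (hT0.trans hT)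
  calc η * T * G ≤ η * (2 * (Z + lam * Q)) * R := by gcongr
    _ = 2 * (η * Z * R) + 2 * η * (lam * (R * Q)) := by ring
    _ ≤ 2 * (η * Z * R) + 1 * (lam * (R * Q)) := by
        have : 0 ≤ lam * (R * Q) := by positivity
        nlinarith
    _ = _ := by rw [hP]; ring

/-- The four contributions to a coefficient error, namely noise, shrinkage and the two Gram terms,
add up to the signal bound without its interaction term. -/
theorem error_budget_eq {q C lam : ℝ} (hC : 0 < C) :
    (q⁻¹ / C + lam * (q / C) + (2 * (q⁻¹ / (2 * C)) + lam * (q / C))) * C =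
      2 * (q⁻¹ + lam * q) := by
  generalize q⁻¹ = a
  field_simp
  ring

/-! ### The primal-dual witness. -/

section Success

variable {n d : ℕ} {ι : Type*} [Fintype ι] [DecidableEq ι]

set_option maxHeartbeats 1000000 in
/-- Deterministic conditions on a sample under which the LASSO succeeds. The covariates in `S` are
`∑ l, A k l * z i l`, with dual vectors `g k`, and `c j` holds the coefficients of the population
regression of the covariate `j` on those in `S`. -/
theorem lassoSucceeds_of_conditions (hn : n ≠ 0) {β : Fin d → ℝ} {βI : Sym2 (Fin d) → ℝ}
    {lam Cmin γ β₀ : ℝ} {Y : Fin n → ℝ} {X : Fin n → Fin d → ℝ} (hlam : 0 < lam)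
    (hCmin : 0 < Cmin) (hγ : 0 < γ) {S : Finset (Fin d)} (hS : S = support β βI)
    (z : Fin n → ι → ℝ) (A g : Fin d → ι → ℝ) (c : Fin d → Fin d → ℝ)
    (hX : ∀ i, ∀ k ∈ S, X i k = ∑ l, A k l * z i l)
    (hdual : ∀ k ∈ S, ∀ k' ∈ S, ∑ l, A k' l * g k l = if k = k' then 1 else 0)
    (hspan : ∀ k ∈ S, ∀ l, g k l = ∑ k' ∈ S, (∑ m, g k m * g k' m) * A k' l)
    (hg : ∀ u : Fin d → ℝ, (∀ k, |u k| ≤ 1) →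
      ∑ l, (∑ k ∈ S, u k * g k l) ^ 2 ≤ S.card / Cmin)
    (hg1 : ∀ k ∈ S, ∑ l, g k l ^ 2 ≤ 1 / Cmin)
    (hc : ∀ j ∉ S, ∑ k ∈ S, |c j k| ≤ 1 - γ)
    {W : Fin n → ℝ} (hW : ∀ i, W i = Y i - β₀ - ∑ j, X i j * β j)
    {φ : Fin n → Option ι → ℝ} (hφ : ∀ i, φ i = withIntercept (z i))
    {e : Fin n → Fin d → ℝ} (he : ∀ i j, e i j = X i j - ∑ k ∈ S, c j k * X i k)
    {Zn : ℝ} (hZn : Zn = √(∑ l, ((n : ℝ)⁻¹ * ∑ i, W i * φ i l) ^ 2))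
    {Gn : Fin d → ℝ} (hGn : ∀ j, Gn j = √(∑ l, ((n : ℝ)⁻¹ * ∑ i, e i j * φ i l) ^ 2))
    (H1 : gramDev φ ≤ 1 / 4)
    (H3 : ∀ j ∉ S, |(n : ℝ)⁻¹ * ∑ i, e i j * W i| ≤ γ * lam / 4)
    (H4 : ∀ j ∉ S, Gn j * √(S.card / Cmin) ≤ γ / 16)
    (H4' : ∀ j ∉ S, Gn j * Zn ≤ γ * lam / 16)
    (H5 : ∀ k ∈ S, |(n : ℝ)⁻¹ * ∑ i, W i * ∑ l, g k l * z i l| ≤ (√S.card)⁻¹ / Cmin)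
    (H5' : √(gramDev φ) * Zn * √(1 / Cmin) ≤ (√S.card)⁻¹ / (2 * Cmin)) :
    LassoSucceeds β βI lam Cmin Y X := by
  have hβS : ∀ j ∉ S, β j = 0 := by
    intro j hj
    rw [hS, support, Finset.mem_filter] at hj
    have h1 : ¬ 0 < β j ^ 2 + ∑ k, βI s(j, k) ^ 2 := fun h => hj ⟨Finset.mem_univ _, h⟩
    have h2 : 0 ≤ ∑ k, βI s(j, k) ^ 2 := Finset.sum_nonneg fun k _ => sq_nonneg _
    by_contra h
    have : 0 < β j ^ 2 := by positivity
    exact h1 (by linarith)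
  set η := √(gramDev φ) with hη
  have hη0 : 0 ≤ η := Real.sqrt_nonneg _
  have hη1 : η ≤ 1 / 2 := by
    rw [hη, Real.sqrt_le_left (by norm_num)]; linarith
  have hgram := abs_gram_sub_le φ
  have hsqrt : ∀ t : Option ι → ℝ, √(∑ l, t l ^ 2) ^ 2 = ∑ l, t l ^ 2 := fun t =>
    Real.sq_sqrt (Finset.sum_nonneg fun l _ => sq_nonneg _)
  have hφsum : ∀ (t : Option ι → ℝ) i, ∑ l, t l * φ i l = t none + ∑ l, t (some l) * z i l := by
    intro t i
    simp [Fintype.sum_option, hφ, withIntercept]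
  have hlinS : ∀ (θ : Fin d → ℝ), (∀ j ∉ S, θ j = 0) → ∀ i, ∑ j, X i j * θ j =
      ∑ l, (∑ k ∈ S, θ k * A k l) * z i l := by
    intro θ hθ i
    rw [← Finset.sum_subset (Finset.subset_univ S) fun j _ hj => by rw [hθ j hj, mul_zero]]
    simp_rw [Finset.sum_mul]
    rw [Finset.sum_comm]
    refine Finset.sum_congr rfl fun k hk => ?_
    rw [hX i k hk, Finset.sum_mul]
    exact Finset.sum_congr rfl fun l _ => by ring
  have hcoef : ∀ (θ : Fin d → ℝ), ∀ k ∈ S, ∑ l, (∑ k' ∈ S, θ k' * A k' l) * g k l = θ k := by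
    intro θ k hk
    simp_rw [Finset.sum_mul]
    rw [Finset.sum_comm]
    have : ∀ k' ∈ S, ∑ l, θ k' * A k' l * g k l = if k = k' then θ k' else 0 := by
      intro k' hk'
      simp_rw [mul_assoc]
      rw [← Finset.mul_sum, hdual k hk k' hk']
      split_ifs <;> simp
    rw [Finset.sum_congr rfl this, Finset.sum_ite_eq, if_pos hk]
  obtain ⟨θ, hθS, hmin⟩ := exists_restricted_minimizer hn Y X hlam S
  obtain ⟨hst0, hstS⟩ := restricted_stationarity hlam hθS hmin
  set r := residual Y X θ with hr
  set D : Fin d → ℝ := fun j => θ.2 j - β j with hD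
  have hDS : ∀ j ∉ S, D j = 0 := fun j hj => by simp [hD, hθS j hj, hβS j hj]
  -- `v`, completed by the intercept error to `t`, is the estimation error expressed in the
  -- features, so that the residual is `W - ⟨t, φ⟩`.
  set v : ι → ℝ := fun l => ∑ k ∈ S, D k * A k l with hv
  set t : Option ι → ℝ := fun o => o.elim (θ.1 - β₀) v with ht
  have ht0 : t none = θ.1 - β₀ := rfl
  have htl : ∀ l, t (some l) = v l := fun _ => rfl
  have hrW : ∀ i, r i = W i - ∑ l, t l * φ i l := by
    intro i
    rw [hφsum, ht0, hr, residual, hW]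
    simp only [htl]
    rw [← hlinS D hDS]
    simp only [hD, mul_sub, Finset.sum_sub_distrib]
    ring
  -- The normalized score on `S`, a subgradient of the absolute values at the restricted minimizer;
  -- it is extended by zero so that the bound `hg` applies.
  set u : Fin d → ℝ := fun k => if k ∈ S then lam⁻¹ * ((n : ℝ)⁻¹ * ∑ i, r i * X i k) else 0 with hu
  have hu1 : ∀ k, |u k| ≤ 1 := by
    intro k
    simp only [hu]
    split_ifs with hk
    · rw [abs_mul, abs_inv, abs_of_pos hlam, inv_mul_le_iff₀ hlam, mul_one]
      exact (hstS k hk).1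
    · simp
  have hru : ∀ k ∈ S, (n : ℝ)⁻¹ * ∑ i, r i * X i k = lam * u k := by
    intro k hk
    simp only [hu, if_pos hk]
    field_simp
  set ψ : ι → ℝ := fun l => ∑ k ∈ S, u k * g k l with hψ
  have hψn : √(∑ l, ψ l ^ 2) ≤ √(S.card / Cmin) := Real.sqrt_le_sqrt (hg u hu1)
  set Q := √(S.card / Cmin) with hQ
  have hQ0 : 0 ≤ Q := Real.sqrt_nonneg _
  have hZ0 : 0 ≤ Zn := by rw [hZn]; exact Real.sqrt_nonneg _
  set Tn := √(∑ l, t l ^ 2) with hTn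
  have hT0 : 0 ≤ Tn := Real.sqrt_nonneg _
  have hvT : √(∑ l, v l ^ 2) ≤ Tn := by
    apply Real.sqrt_le_sqrt
    rw [Fintype.sum_option]
    simp only [htl]
    nlinarith [sq_nonneg (t none)]
  have hswap : ∀ (t : Option ι → ℝ) (w : Fin n → ℝ), (n : ℝ)⁻¹ * ∑ i, w i * ∑ l, t l * φ i l =
      ∑ l, t l * ((n : ℝ)⁻¹ * ∑ i, w i * φ i l) := by
    intro t w
    simp_rw [Finset.mul_sum]
    rw [Finset.sum_comm]
    exact Finset.sum_congr rfl fun l _ => Finset.sum_congr rfl fun i _ => by ring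
  -- The residual tested against the estimation error. The vector `ψ = ∑ u k • g k` represents the
  -- subgradient by duality with the active `A k`.
  have henergy : (n : ℝ)⁻¹ * ∑ i, r i * ∑ l, t l * φ i l = lam * ∑ l, v l * ψ l := by
    have h1 : ∀ i, r i * ∑ l, t l * φ i l = (θ.1 - β₀) * r i + ∑ k ∈ S, D k * (r i * X i k) := by
      intro i
      rw [hφsum, ht0]
      simp only [htl]
      rw [← hlinS D hDS, ← Finset.sum_subset (Finset.subset_univ S) fun j _ hj => by
        rw [hDS j hj, mul_zero], mul_add, Finset.mul_sum]
      congr 1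
      · ring
      · exact Finset.sum_congr rfl fun k _ => by ring
    simp_rw [h1]
    rw [Finset.sum_add_distrib, mul_add, ← Finset.mul_sum, mul_left_comm, hst0, mul_zero, zero_add,
      Finset.sum_comm, Finset.mul_sum]
    have h2 : ∀ k ∈ S, (n : ℝ)⁻¹ * ∑ i, D k * (r i * X i k) = lam * (D k * u k) := by
      intro k hk
      rw [← Finset.mul_sum, mul_left_comm, hru k hk]; ring
    rw [Finset.sum_congr rfl h2, ← Finset.mul_sum]
    congr 1
    simp only [hψ, Finset.mul_sum]
    rw [Finset.sum_comm]
    refine Finset.sum_congr rfl fun k hk => ?_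
    rw [← hcoef D k hk, Finset.sum_mul]
    exact Finset.sum_congr rfl fun l _ => by ring
  -- The energy identity reads `n⁻¹ ∑ ⟨t, φ⟩² = ⟨t, score⟩ - lam ⟨v, ψ⟩`. The left side is at least
  -- `(1 - η) |t|²` with `η ≤ 1 / 2`, and one factor `|t|` cancels.
  have hTbound : Tn ≤ 2 * (Zn + lam * Q) := by
    have h1 : (n : ℝ)⁻¹ * ∑ i, r i * ∑ l, t l * φ i l =
        ∑ l, t l * ((n : ℝ)⁻¹ * ∑ i, W i * φ i l) -
          (n : ℝ)⁻¹ * ∑ i, (∑ l, t l * φ i l) * (∑ l, t l * φ i l) := by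
      rw [← hswap, ← mul_sub, ← Finset.sum_sub_distrib]
      congr 1
      exact Finset.sum_congr rfl fun i _ => by rw [hrW]; ring
    rw [henergy] at h1
    have h2 := hgram t t
    have h3 : ∑ l, t l * t l = Tn ^ 2 := by
      rw [hTn, hsqrt]; exact Finset.sum_congr rfl fun l _ => by ring
    rw [h3, ← hTn, ← hη] at h2
    have h4 := abs_sum_mul_le_sqrt Finset.univ t fun l => (n : ℝ)⁻¹ * ∑ i, W i * φ i l
    rw [← hZn, ← hTn] at h4
    have h5 := abs_sum_mul_le_sqrt Finset.univ v ψ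
    have h6 : √(∑ l, v l ^ 2) * √(∑ l, ψ l ^ 2) ≤ Tn * Q :=
      mul_le_mul hvT hψn (Real.sqrt_nonneg _) hT0
    have h7 := (abs_le.1 h2).1
    have h8 := (abs_le.1 h4).2
    have h9 := (abs_le.1 (h5.trans h6)).1
    have h10 : (1 - η) * Tn ^ 2 ≤ Tn * (Zn + lam * Q) := by
      nlinarith [mul_le_mul_of_nonneg_left h9 hlam.le]
    rcases hT0.eq_or_lt with h | h
    · rw [← h]; positivity
    · have h11 : (1 - η) * Tn ≤ Zn + lam * Q := by
        by_contra hcon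
        push Not at hcon
        nlinarith [mul_lt_mul_of_pos_left hcon h]
      nlinarith
  -- strict dual feasibility
  have hdualfeas : ∀ j ∉ S, |(n : ℝ)⁻¹ * ∑ i, r i * X i j| < lam := by
    intro j hj
    -- The covariate `j` splits into its population regression on `S`, where stationarity applies,
    -- and the residual `e`. Incoherence leaves a margin `γ lam`, of which the two residual terms
    -- use a quarter each.
    have h1 : (n : ℝ)⁻¹ * ∑ i, r i * X i j = lam * ∑ k ∈ S, c j k * u k +
        ((n : ℝ)⁻¹ * ∑ i, e i j * W i - ∑ l, t l * ((n : ℝ)⁻¹ * ∑ i, e i j * φ i l)) := by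
      have e1 : ∀ i, r i * X i j = ∑ k ∈ S, c j k * (r i * X i k) +
          (e i j * W i - e i j * ∑ l, t l * φ i l) := by
        intro i
        have : X i j = ∑ k ∈ S, c j k * X i k + e i j := by rw [he]; ring
        rw [this, mul_add, Finset.mul_sum]
        congr 1
        · exact Finset.sum_congr rfl fun k _ => by ring
        · rw [hrW]; ring
      simp_rw [e1]
      rw [Finset.sum_add_distrib, mul_add, Finset.sum_sub_distrib, mul_sub, hswap,
        Finset.sum_comm]
      congr 1
      rw [Finset.mul_sum, Finset.mul_sum]
      refine Finset.sum_congr rfl fun k hk => ?_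
      rw [← Finset.mul_sum, mul_left_comm, hru k hk]; ring
    rw [h1]
    have h2 : |∑ k ∈ S, c j k * u k| ≤ 1 - γ := by
      refine (Finset.abs_sum_le_sum_abs _ _).trans (le_trans (Finset.sum_le_sum fun k _ => ?_)
        (hc j hj))
      rw [abs_mul]
      exact mul_le_of_le_one_right (abs_nonneg _) (hu1 k)
    have h3 := abs_sum_mul_le_sqrt Finset.univ t fun l => (n : ℝ)⁻¹ * ∑ i, e i j * φ i l
    rw [← hGn, ← hTn] at h3
    have hG0 : 0 ≤ Gn j := by rw [hGn]; exact Real.sqrt_nonneg _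
    have h4 : Tn * Gn j ≤ γ * lam / 4 := by
      calc Tn * Gn j ≤ 2 * (Zn + lam * Q) * Gn j := mul_le_mul_of_nonneg_right hTbound hG0
        _ = 2 * (Gn j * Zn) + 2 * lam * (Gn j * Q) := by ring
        _ ≤ 2 * (γ * lam / 16) + 2 * lam * (γ / 16) := by
            gcongr
            · exact H4' j hj
            · exact H4 j hj
        _ = _ := by ring
    have h5 : |lam * ∑ k ∈ S, c j k * u k| ≤ lam * (1 - γ) := by
      rw [abs_mul, abs_of_pos hlam]; gcongr
    refine (abs_add_le _ _).trans_lt ?_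
    have h6 := abs_sub ((n : ℝ)⁻¹ * ∑ i, e i j * W i)
      (∑ l, t l * ((n : ℝ)⁻¹ * ∑ i, e i j * φ i l))
    have h7 := H3 j hj
    have : 0 < γ * lam := mul_pos hγ hlam
    linarith
  obtain ⟨hsol, huniq⟩ := isLassoSolution_of_stationarity hθS hst0 hstS hdualfeas
  -- estimation error
  have herr : ∀ k ∈ S, |D k| ≤ signalBound β βI lam Cmin := by
    intro k hk
    have hgk : √(∑ l, g k l ^ 2) ≤ √(1 / Cmin) := Real.sqrt_le_sqrt (hg1 k hk)
    set go : Option ι → ℝ := fun o => o.elim 0 (g k) with hgo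
    have hgosum : ∀ i, ∑ l, go l * φ i l = ∑ l, g k l * z i l := by
      intro i; rw [hφsum]; simp [hgo]
    have hgon : ∑ l, go l ^ 2 = ∑ l, g k l ^ 2 := by
      rw [Fintype.sum_option]; simp [hgo]
    have h1 : (n : ℝ)⁻¹ * ∑ i, r i * ∑ l, g k l * z i l = lam * ∑ l, g k l * ψ l := by
      have e1 : ∀ i, ∑ l, g k l * z i l = ∑ k' ∈ S, (∑ m, g k m * g k' m) * X i k' := by
        intro i
        have : ∀ l, g k l * z i l = ∑ k' ∈ S, (∑ m, g k m * g k' m) * (A k' l * z i l) := by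
          intro l
          nth_rw 1 [hspan k hk l]
          rw [Finset.sum_mul]
          exact Finset.sum_congr rfl fun k' _ => by ring
        simp_rw [this]
        rw [Finset.sum_comm]
        refine Finset.sum_congr rfl fun k' hk' => ?_
        rw [hX i k' hk', Finset.mul_sum]
      have e2 : ∀ i, r i * ∑ l, g k l * z i l =
          ∑ k' ∈ S, (∑ m, g k m * g k' m) * (r i * X i k') := by
        intro i
        rw [e1, Finset.mul_sum]
        exact Finset.sum_congr rfl fun k' _ => by ring
      simp_rw [e2]
      rw [Finset.sum_comm, Finset.mul_sum]
      have e3 : ∀ k' ∈ S, (n : ℝ)⁻¹ * ∑ i, (∑ m, g k m * g k' m) * (r i * X i k') =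
          lam * ((∑ m, g k m * g k' m) * u k') := by
        intro k' hk'
        rw [← Finset.mul_sum, mul_left_comm, hru k' hk']; ring
      rw [Finset.sum_congr rfl e3, ← Finset.mul_sum]
      congr 1
      simp only [hψ, Finset.mul_sum, Finset.sum_mul]
      rw [Finset.sum_comm]
      exact Finset.sum_congr rfl fun k' _ => Finset.sum_congr rfl fun l _ => by ring
    have h2 : (n : ℝ)⁻¹ * ∑ i, r i * ∑ l, g k l * z i l =
        (n : ℝ)⁻¹ * ∑ i, W i * ∑ l, g k l * z i l -
          (n : ℝ)⁻¹ * ∑ i, (∑ l, t l * φ i l) * (∑ l, go l * φ i l) := by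
      rw [← mul_sub, ← Finset.sum_sub_distrib]
      congr 1
      exact Finset.sum_congr rfl fun i _ => by rw [hrW, hgosum]; ring
    have h3 := hgram t go
    rw [← hTn, hgon, ← hη] at h3
    have h4 : ∑ l, t l * go l = D k := by
      rw [Fintype.sum_option]
      simp only [hgo, Option.elim, mul_zero, zero_add, htl]
      exact hcoef D k hk
    rw [h4] at h3
    have h5 := abs_sum_mul_le_sqrt Finset.univ (g k) ψ
    have hs0 : 0 < (S.card : ℝ) := by
      exact_mod_cast Finset.card_pos.2 ⟨k, hk⟩
    have hQe : √(1 / Cmin) * Q = √S.card / Cmin := sqrt_inv_mul_sqrt_div hCmin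
    have h6 : |∑ l, g k l * ψ l| ≤ √S.card / Cmin := by
      rw [← hQe]
      exact h5.trans (mul_le_mul hgk hψn (Real.sqrt_nonneg _) (Real.sqrt_nonneg _))
    have h7 : η * Tn * √(∑ l, g k l ^ 2) ≤ 2 * (η * Zn * √(1 / Cmin)) + lam * (√S.card / Cmin) :=
      gram_error_le hη0 hη1 hlam hQ0 hTbound hT0 hgk (Real.sqrt_nonneg _) hQe
    have h8 := H5 k hk
    have h9 : |lam * ∑ l, g k l * ψ l| ≤ lam * (√S.card / Cmin) := by
      rw [abs_mul, abs_of_pos hlam]; gcongr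
    have hDle : |D k| ≤ (√S.card)⁻¹ / Cmin + lam * (√S.card / Cmin) +
        (2 * ((√S.card)⁻¹ / (2 * Cmin)) + lam * (√S.card / Cmin)) := by
      -- Testing the residual against the dual vector `g k` isolates one coefficient error: noise,
      -- minus shrinkage, minus the deviation of the Gram form from the identity.
      have e1 : D k = (n : ℝ)⁻¹ * ∑ i, W i * ∑ l, g k l * z i l - lam * ∑ l, g k l * ψ l -
          ((n : ℝ)⁻¹ * ∑ i, (∑ l, t l * φ i l) * (∑ l, go l * φ i l) - D k) := by
        rw [← h1, h2]; ring
      rw [e1]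
      refine (abs_sub _ _).trans (add_le_add ((abs_sub _ _).trans (add_le_add h8 h9)) ?_)
      refine h3.trans (h7.trans ?_)
      exact add_le_add (mul_le_mul_of_nonneg_left H5' zero_le_two) le_rfl
    refine hDle.trans ?_
    -- The interaction term of the signal bound is pure slack here; only its nonnegativity enters.
    have hI0 : 0 ≤ interactionNorm βI / (S.card : ℝ) :=
      div_nonneg (Real.sqrt_nonneg _) hs0.le
    rw [signalBound, ← hS, le_div_iff₀ hCmin]
    rw [error_budget_eq hCmin]
    linarith
  refine ⟨θ, ⟨hsol, fun θ' hθ' => ?_⟩, hS ▸ hθS, fun hsig j => ?_⟩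
  · obtain ⟨hfit, hz⟩ := huniq (θ' - θ) (by simpa using hθ')
    set h := θ' - θ with hh
    set t' : Option ι → ℝ := fun o => o.elim h.1 fun l => ∑ k ∈ S, h.2 k * A k l with ht'
    have hfit' : ∀ i, ∑ l, t' l * φ i l = 0 := by
      intro i
      rw [hφsum, ← hfit i, hlinS h.2 hz]
      simp [ht']
    -- With vanishing fitted values the Gram bound reads `|t'|² ≤ η |t'|²`, and `η ≤ 1 / 2` gives
    -- `t' = 0`; pairing with the dual vectors recovers `h`.
    have h1 := hgram t' t'
    simp only [hfit', mul_zero, Finset.sum_const_zero, zero_sub, abs_neg] at h1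
    rw [mul_assoc, Real.mul_self_sqrt (Finset.sum_nonneg fun l _ => sq_nonneg _),
      abs_of_nonneg (Finset.sum_nonneg fun l _ => mul_self_nonneg _)] at h1
    have h2 : ∑ l, t' l * t' l = ∑ l, t' l ^ 2 := Finset.sum_congr rfl fun l _ => by ring
    have h3 : 0 ≤ ∑ l, t' l ^ 2 := Finset.sum_nonneg fun l _ => sq_nonneg _
    rw [h2, ← hη] at h1
    have h4 : ∑ l, t' l ^ 2 = 0 := by nlinarith
    have h5 : ∀ l, t' l = 0 := fun l => by
      have := (Finset.sum_eq_zero_iff_of_nonneg fun l _ => sq_nonneg _).1 h4 l (Finset.mem_univ l)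
      exact pow_eq_zero_iff two_ne_zero |>.1 this
    have h6 : h = 0 := by
      refine Prod.ext (by simpa [ht'] using h5 none) (funext fun k => ?_)
      by_cases hk : k ∈ S
      · have h7 := hcoef h.2 k hk
        have h8 : ∀ l, ∑ k' ∈ S, h.2 k' * A k' l = 0 := fun l => by
          simpa [ht'] using h5 (some l)
        simp only [h8, zero_mul, Finset.sum_const_zero] at h7
        exact h7.symm
      · exact hz k hk
    exact sub_eq_zero.1 h6
  · by_cases hj : j ∈ S
    · have h1 := herr j hj
      have h2 := hsig j (hS ▸ hj)
      have h3 : |θ.2 j - β j| < |β j| := lt_of_le_of_lt h1 h2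
      rcases lt_trichotomy (β j) 0 with hb | hb | hb
      · rw [abs_of_neg hb] at h3
        have := (abs_lt.1 h3).2
        rw [sign_neg hb, sign_neg (by linarith)]
      · rw [hb] at h3; simp at h3
        exact absurd h3 (not_lt.2 (abs_nonneg _))
      · rw [abs_of_pos hb] at h3
        have := (abs_lt.1 h3).1
        rw [sign_pos hb, sign_pos (by linarith)]
    · rw [hθS j hj, hβS j hj]

end Success

/-! ### Elliptical laws with sub-Gaussian marginals -/

theorem HasSubgaussianMGF_mono {Ω : Type*} [MeasurableSpace Ω] {μ : Measure Ω} {f : Ω → ℝ}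
    {c c' : ℝ≥0} (h : HasSubgaussianMGF f c μ) (hc : c ≤ c') : HasSubgaussianMGF f c' μ :=
  ⟨h.integrable_exp_mul, fun t => (h.mgf_le t).trans (Real.exp_le_exp.2 (by gcongr))⟩

/-- A sub-Gaussian variable whose law is symmetric about `m` has `m = 0`. -/
theorem center_eq_zero_of_subgaussian {Ω : Type*} [MeasurableSpace Ω] {μ : Measure Ω}
    [IsProbabilityMeasure μ] {f : Ω → ℝ} {c : ℝ≥0} (h : HasSubgaussianMGF f c μ) {m : ℝ}
    {T : Ω → Ω} (hT : MeasurePreserving T μ μ) (hf : ∀ ω, f (T ω) = 2 * m - f ω) : m = 0 := by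
  -- `exp (t m)` is the geometric mean of the exponentials at `f` and at its mirror image, hence at
  -- most their average. A bound of a linear by a quadratic function for all `t` then forces `m =
  -- 0`.
  have key : ∀ t : ℝ, t * m ≤ c * t ^ 2 / 2 := by
    intro t
    have h1 : Integrable (fun ω => Real.exp (t * f (T ω))) μ :=
      hT.integrable_comp_of_integrable (h.integrable_exp_mul t)
    have h2 : ∫ ω, Real.exp (t * f (T ω)) ∂μ = ∫ ω, Real.exp (t * f ω) ∂μ := by
      have : AEStronglyMeasurable (fun ω => Real.exp (t * f ω)) (μ.map T) := by
        rw [hT.map_eq]; exact (h.integrable_exp_mul t).aestronglyMeasurable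
      have := integral_map hT.measurable.aemeasurable this
      rw [hT.map_eq] at this
      exact this.symm
    have h3 : ∫ _ω : Ω, 2 * Real.exp (t * m) ∂μ ≤
        ∫ ω, (Real.exp (t * f ω) + Real.exp (t * f (T ω))) ∂μ := by
      refine integral_mono (integrable_const _) ((h.integrable_exp_mul t).add h1) fun ω => ?_
      simp only
      rw [hf]
      have e1 : Real.exp (t * m) ^ 2 = Real.exp (t * f ω) * Real.exp (t * (2 * m - f ω)) := by
        rw [← Real.exp_add, ← Real.exp_nat_mul]; congr 1; push_cast; ring
      nlinarith [sq_nonneg (Real.exp (t * f ω) - Real.exp (t * (2 * m - f ω))),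
        Real.exp_pos (t * f ω), Real.exp_pos (t * (2 * m - f ω)), Real.exp_pos (t * m),
        sq_nonneg (Real.exp (t * f ω) + Real.exp (t * (2 * m - f ω)) - 2 * Real.exp (t * m))]
    rw [integral_add (h.integrable_exp_mul t) h1, h2] at h3
    simp only [integral_const, probReal_univ, one_smul] at h3
    have h4 := h.mgf_le t
    rw [mgf] at h4
    exact Real.exp_le_exp.1 (by linarith)
  have hc : (0 : ℝ) ≤ c := c.2
  have h1 : m ≤ 0 := by
    by_contra hm
    push Not at hm
    have := key (m / (c + 1))
    have e : (c : ℝ) * (m / (c + 1)) ^ 2 / 2 = (m / (c + 1)) * m * (c / (2 * (c + 1))) := by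
      field_simp
    rw [e] at this
    have hp : 0 < m / ((c : ℝ) + 1) * m := by positivity
    have hlt : (c : ℝ) / (2 * (c + 1)) < 1 := by rw [div_lt_one (by positivity)]; linarith
    nlinarith
  have h2 : 0 ≤ m := by
    by_contra hm
    push Not at hm
    have := key (m / (c + 1))
    have e : (c : ℝ) * (m / (c + 1)) ^ 2 / 2 = (m / (c + 1)) * m * (c / (2 * (c + 1))) := by
      field_simp
    rw [e] at this
    have hp : 0 < m / ((c : ℝ) + 1) * m := by
      rw [div_mul_eq_mul_div]; exact div_pos (mul_pos_of_neg_of_neg hm hm) (by positivity)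
    have hlt : (c : ℝ) / (2 * (c + 1)) < 1 := by rw [div_lt_one (by positivity)]; linarith
    nlinarith
  exact le_antisymm h1 h2

instance isProbabilityMeasure_uniformSphere (k : ℕ) : IsProbabilityMeasure (uniformSphere k) :=
  Measure.isProbabilityMeasure_map (by fun_prop)

theorem uniformSphere_map (k : ℕ) (L : Euc k ≃ₗᵢ[ℝ] Euc k) :
    (uniformSphere k).map L = uniformSphere k := by
  have hL : Measurable L := L.continuous.measurable
  have hg : Measurable fun g : Euc k => ‖g‖⁻¹ • g := by fun_prop
  rw [uniformSphere, Measure.map_map hL hg]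
  have : L ∘ (fun g : Euc k => ‖g‖⁻¹ • g) = (fun g : Euc k => ‖g‖⁻¹ • g) ∘ L := by
    ext1 g; simp
  rw [this, ← Measure.map_map hg hL, stdGaussian_map]

/-- An elliptical law with sub-Gaussian marginals, one of which is nondegenerate, is the law of
linear functionals of an isotropic vector. -/
theorem exists_isIsotropic_of_isElliptical {d : ℕ} {ν : Measure (Fin d → ℝ)} {b : ℝ≥0}
    (hell : IsElliptical ν)
    (hsub : ∀ j, HasSubgaussianMGF (fun v : Fin d → ℝ => v j) (b ^ 2) ν) {C : ℝ≥0} (hC : 0 < C)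
    {j₀ : Fin d} (hj₀ : C ≤ Var[fun v : Fin d → ℝ => v j₀; ν]) :
    ∃ (k : ℕ) (μ : Measure (Euc k)) (a : Fin d → Euc k), IsIsotropic μ (b ^ 2 / C) ∧
      ν = μ.map (fun w j => inner ℝ (a j) w) := by
  obtain ⟨k, m, A, ρ, hρ, -, rfl⟩ := hell
  -- The radial variable is absorbed into the vector. Rotation invariance is all that is kept of the
  -- spherical structure.
  set μ₀ : Measure (Euc k) := (ρ.prod (uniformSphere k)).map (fun z => z.1 • z.2) with hμ₀
  have hsm : Measurable fun z : ℝ × Euc k => z.1 • z.2 := by fun_prop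
  have hp₀ : IsProbabilityMeasure μ₀ := Measure.isProbabilityMeasure_map hsm.aemeasurable
  have hinv : ∀ L : Euc k ≃ₗᵢ[ℝ] Euc k, MeasurePreserving L μ₀ μ₀ := by
    intro L
    have hL : Measurable L := L.continuous.measurable
    refine ⟨hL, ?_⟩
    have h1 : MeasurePreserving (Prod.map id L) (ρ.prod (uniformSphere k))
        (ρ.prod (uniformSphere k)) :=
      (MeasurePreserving.id ρ).prod ⟨hL, uniformSphere_map k L⟩
    rw [hμ₀, Measure.map_map hL hsm]
    have : L ∘ (fun z : ℝ × Euc k => z.1 • z.2) =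
        (fun z : ℝ × Euc k => z.1 • z.2) ∘ Prod.map id L := by
      ext1 z; simp
    rw [this, ← Measure.map_map hsm h1.measurable, h1.map_eq]
  set a₀ : Fin d → Euc k := fun j => WithLp.toLp 2 (A j) with ha₀
  have hlin : Measurable fun w : Euc k => fun j => m j + inner ℝ (a₀ j) w := by fun_prop
  have hν : (ρ.prod (uniformSphere k)).map (fun z => m + z.1 • (A *ᵥ (z.2 : Fin k → ℝ))) =
      μ₀.map (fun w j => m j + inner ℝ (a₀ j) w) := by
    rw [hμ₀, Measure.map_map hlin hsm]
    congr 1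
    ext z j
    simp [ha₀, Matrix.mulVec, dotProduct, PiLp.inner_apply, Finset.mul_sum]
    exact Finset.sum_congr rfl fun l _ => by ring
  rw [hν] at hsub hj₀ ⊢
  have hsub' : ∀ j, HasSubgaussianMGF (fun w => m j + inner ℝ (a₀ j) w) (b ^ 2) μ₀ := fun j =>
    HasSubgaussianMGF.of_map (X := fun v : Fin d → ℝ => v j) hlin.aemeasurable (hsub j)
  have hm : ∀ j, m j = 0 := by
    intro j
    refine center_eq_zero_of_subgaussian (hsub' j) (hinv (LinearIsometryEquiv.neg ℝ)) fun w => ?_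
    simp; ring
  have hm' : m = 0 := funext hm
  subst hm'
  simp only [Pi.zero_apply, zero_add] at hsub' hlin hj₀ ⊢
  have hcomp : ∀ (L : Euc k ≃ₗᵢ[ℝ] Euc k) (F : Euc k → ℝ), ∫ w, F (L w) ∂μ₀ = ∫ w, F w ∂μ₀ :=
    fun L F => (hinv L).integral_comp L.toHomeomorph.measurableEmbedding F
  have hvar : Var[fun v : Fin d → ℝ => v j₀; μ₀.map (fun w j => inner ℝ (a₀ j) w)] =
      ∫ w, inner ℝ (a₀ j₀) w ^ 2 ∂μ₀ := by
    rw [variance_map (measurable_pi_apply j₀).aemeasurable hlin.aemeasurable, variance_eq_integral (by fun_prop)]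
    have : ∫ w, ((fun v : Fin d → ℝ => v j₀) ∘ fun w j => inner ℝ (a₀ j) w) w ∂μ₀ = 0 := by
      have h1 := hcomp (LinearIsometryEquiv.neg ℝ) fun w => inner ℝ (a₀ j₀) w
      simp only [LinearIsometryEquiv.coe_neg, inner_neg_right, integral_neg] at h1
      simp only [Function.comp_def]
      linarith
    rw [this]
    simp
  rw [hvar] at hj₀
  set V := ∫ w, inner ℝ (a₀ j₀) w ^ 2 ∂μ₀ with hV
  have hC' : (0 : ℝ) < C := by exact_mod_cast hC
  have hV0 : 0 < V := hC'.trans_le hj₀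
  have ha0 : a₀ j₀ ≠ 0 := by
    intro h; rw [hV, h] at hV0; simp at hV0
  set α := ‖a₀ j₀‖ with hα
  have hα0 : 0 < α := norm_pos_iff.2 ha0
  -- Up to a rotation, every functional is a multiple of the nondegenerate one. Variance and
  -- subgaussianity of that single coordinate therefore determine all others, and rescaling by `s`
  -- makes the covariance the identity; `V ≥ C` gives the proxy `b² / C`.
  have hrot : ∀ a : Euc k, ∃ L : Euc k ≃ₗᵢ[ℝ] Euc k, ∀ w,
      inner ℝ a (L w) = α⁻¹ * ‖a‖ * inner ℝ (a₀ j₀) w := by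
    intro a
    obtain ⟨L, hL, -, -⟩ := exists_isometry_swap (E := Euc k) (u := ‖a‖ • a₀ j₀) (v := α • a)
      (by rw [norm_smul, norm_smul, ← hα]; simp [abs_of_pos hα0, mul_comm])
    refine ⟨L, fun w => ?_⟩
    have h1 : inner ℝ (α • a) (L w) = inner ℝ (‖a‖ • a₀ j₀) w := by rw [← hL, L.inner_map_map]
    rw [real_inner_smul_left, real_inner_smul_left] at h1
    rw [mul_assoc, ← h1]
    field_simp
  set s := α⁻¹ * √V with hs
  have hs0 : 0 < s := by positivity
  have hs2 : s ^ 2 = V / α ^ 2 := by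
    rw [hs, mul_pow, Real.sq_sqrt hV0.le]; field_simp
  have hscale : Measurable fun w : Euc k => s⁻¹ • w := by fun_prop
  refine ⟨k, μ₀.map (fun w => s⁻¹ • w), fun j => s • a₀ j, ⟨?_, ?_, ?_, ?_⟩, ?_⟩
  · exact Measure.isProbabilityMeasure_map hscale.aemeasurable
  · intro L
    have hL : Measurable L := L.continuous.measurable
    rw [Measure.map_map hL hscale]
    have : L ∘ (fun w : Euc k => s⁻¹ • w) = (fun w : Euc k => s⁻¹ • w) ∘ L := by
      ext1 w; simp
    rw [this, ← Measure.map_map hscale hL, (hinv L).map_eq]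
  · intro a
    obtain ⟨L, hL⟩ := hrot a
    rw [integral_map hscale.aemeasurable (by fun_prop)]
    rw [← hcomp L]
    simp only [real_inner_smul_right, hL, mul_pow, integral_const_mul]
    rw [← hV, inv_pow, hs2]
    field_simp
  · intro a
    obtain ⟨L, hL⟩ := hrot a
    have h1 : HasSubgaussianMGF (fun w => inner ℝ a (s⁻¹ • w)) (b ^ 2 / C * ‖a‖₊ ^ 2) μ₀ := by
      have h2 := (hsub' j₀).const_mul (s⁻¹ * (α⁻¹ * ‖a‖))
      have hid : IdentDistrib (fun w => s⁻¹ * (α⁻¹ * ‖a‖) * inner ℝ (a₀ j₀) w)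
          (fun w => inner ℝ a (s⁻¹ • w)) μ₀ μ₀ := by
        have : (fun w => s⁻¹ * (α⁻¹ * ‖a‖) * inner ℝ (a₀ j₀) w) =
            (fun w => inner ℝ a (s⁻¹ • w)) ∘ L := by
          ext w
          simp only [Function.comp, real_inner_smul_right, hL]
          ring
        rw [this]
        refine ⟨?_, by fun_prop, ?_⟩
        · exact (Measurable.comp (by fun_prop) (hinv L).measurable).aemeasurable
        · rw [← Measure.map_map (by fun_prop) (hinv L).measurable, (hinv L).map_eq]
      refine HasSubgaussianMGF_mono (h2.congr_identDistrib hid) ?_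
      rw [← NNReal.coe_le_coe]
      push_cast
      have e1 : (s⁻¹ * (α⁻¹ * ‖a‖)) ^ 2 = ‖a‖ ^ 2 / V := by
        rw [mul_pow, inv_pow, hs2]; field_simp
      change (s⁻¹ * (α⁻¹ * ‖a‖)) ^ 2 * (b : ℝ) ^ 2 ≤ _
      rw [e1, div_mul_eq_mul_div, div_mul_eq_mul_div, mul_comm]
      gcongr
    have := (HasSubgaussianMGF.id_map_iff (X := fun w => inner ℝ a (s⁻¹ • w))
      (by fun_prop)).2 h1
    have e : μ₀.map (fun w => inner ℝ a (s⁻¹ • w)) =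
        (μ₀.map (fun w => s⁻¹ • w)).map (fun w => inner ℝ a w) := by
      rw [Measure.map_map (by fun_prop) hscale]; rfl
    rw [e] at this
    exact (HasSubgaussianMGF.id_map_iff (by fun_prop)).1 this
  · rw [Measure.map_map (by fun_prop) hscale]
    congr 1
    ext w j
    simp only [Function.comp, real_inner_smul_left, real_inner_smul_right]
    field_simp

/-- The coordinates of an isotropic vector can be chosen adapted to a set of linear
functionals. -/
theorem exists_adapted_coordinates {d k : ℕ} {μ : Measure (Euc k)} {c : ℝ≥0}
    (h : IsIsotropic μ c) (a : Fin d → Euc k) (S : Finset (Fin d)) :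
    ∃ (a' : Fin d → Euc k) (T : Finset (Fin k)),
      μ.map (fun w j => inner ℝ (a j) w) = μ.map (fun w j => inner ℝ (a' j) w) ∧
      T.card ≤ S.card ∧ (∀ j ∈ S, ∀ l ∉ T, a' j l = 0) ∧
      ∀ l ∈ T, ∃ α : Fin d → ℝ, EuclideanSpace.single l 1 = ∑ j ∈ S, α j • a' j := by
  set V := Submodule.span ℝ (a '' S) with hV
  set m := Module.finrank ℝ V with hm
  have hmS : m ≤ S.card := by
    have h1 := finrank_span_le_card (R := ℝ) (a '' (S : Set (Fin d)))
    have h2 : (a '' (S : Set (Fin d))).toFinset.card ≤ S.card := by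
      rw [Set.toFinset_image]
      simpa using Finset.card_image_le (s := S) (f := a)
    exact h1.trans h2
  have hmk : m ≤ k := by
    have := Submodule.finrank_le V
    simpa using this
  set o := stdOrthonormalBasis ℝ V with ho
  -- An orthonormal basis of the span of the active vectors occupies the first `m` slots and is
  -- completed to a basis of the whole space; `T` is that block of slots.
  set v : Fin k → Euc k := fun i => if hi : (i : ℕ) < m then (o ⟨i, hi⟩ : Euc k) else 0 with hv
  have hvon : Orthonormal ℝ (Set.domRestrict {i : Fin k | (i : ℕ) < m} v) := by
    have h1 : Orthonormal ℝ (fun i : Fin m => (o i : Euc k)) :=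
      o.orthonormal.comp_linearIsometry V.subtypeₗᵢ
    have h2 : Set.domRestrict {i : Fin k | (i : ℕ) < m} v =
        (fun i : Fin m => (o i : Euc k)) ∘ fun i => ⟨i.1, i.2⟩ := by
      ext1 i
      simp [Set.domRestrict, hv, show ((i : Fin k) : ℕ) < m from i.2]
    rw [h2]
    refine h1.comp _ fun i j hij => ?_
    simpa [Subtype.ext_iff, Fin.ext_iff] using hij
  obtain ⟨e, he⟩ := hvon.exists_orthonormalBasis_extension_of_card_eq (by simp)
  set L : Euc k ≃ₗᵢ[ℝ] Euc k := e.repr with hL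
  set T : Finset (Fin k) := Finset.univ.filter (fun i => (i : ℕ) < m) with hT
  have heV : ∀ l ∈ T, e l ∈ V := by
    intro l hl
    have hl' : (l : ℕ) < m := by simpa [hT] using hl
    rw [he l hl']
    simp [hv, hl']
  have horth : ∀ l ∉ T, ∀ x ∈ V, inner ℝ (e l) x = 0 := by
    intro l hl x hx
    have h1 : x = ∑ i, o.repr ⟨x, hx⟩ i • (o i : Euc k) := by
      have := o.sum_repr ⟨x, hx⟩
      have := congrArg (Subtype.val) this
      simpa using this.symm
    rw [h1, inner_sum]
    refine Finset.sum_eq_zero fun i _ => ?_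
    have him : (i : ℕ) < m := i.2
    have hik : (i : ℕ) < k := him.trans_le hmk
    have h2 : (o i : Euc k) = e ⟨i, hik⟩ := by
      rw [he ⟨i, hik⟩ i.2]
      simp [hv, him]
    rw [inner_smul_right, h2, e.inner_eq_ite, if_neg, mul_zero]
    rintro rfl
    exact hl (by simp [hT, him])
  refine ⟨fun j => L (a j), T, ?_, ?_, ?_, ?_⟩
  · have h1 : Measurable fun w : Euc k => fun j => inner ℝ (L (a j)) w := by fun_prop
    -- The functionals are rotated together with the law, and the law does not notice.
    conv_rhs => rw [← h.map_eq L]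
    rw [Measure.map_map h1 L.continuous.measurable]
    congr 1
    ext w j
    simp
  · refine le_trans ?_ hmS
    have : T.card = (Finset.univ.filter (fun i : Fin k => (i : ℕ) < m)).card := rfl
    rw [this, Fin.card_filter_val_lt]
    exact min_le_right _ _
  · intro j hj l hl
    rw [hL, e.repr_apply_apply]
    exact horth l hl _ (Submodule.subset_span ⟨j, hj, rfl⟩)
  · intro l hl
    have h1 := heV l hl
    rw [hV] at h1
    obtain ⟨α, hα⟩ := (Submodule.mem_span_image_finset_iff_exists_fun' ℝ).1 h1
    refine ⟨α, ?_⟩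
    have h2 := congrArg L hα
    rw [map_sum] at h2
    simp only [map_smul] at h2
    rw [h2, hL, e.repr_self]

/-! ### Spectral bounds for symmetric matrices -/

section Rayleigh

variable {ι : Type*} [Fintype ι] [DecidableEq ι]

theorem mul_dotProduct_le_of_le_spectrum {A : Matrix ι ι ℝ} (hA : A.IsHermitian) {c : ℝ}
    (h : ∀ x ∈ spectrum ℝ A, c ≤ x) (v : ι → ℝ) : c * (v ⬝ᵥ v) ≤ v ⬝ᵥ A *ᵥ v := by
  have hs : (A - algebraMap ℝ (Matrix ι ι ℝ) c).PosSemidef := by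
    rw [Matrix.posSemidef_iff_isHermitian_and_spectrum_nonneg]
    refine ⟨?_, ?_⟩
    · rw [Matrix.algebraMap_eq_diagonal]
      exact hA.sub (Matrix.isHermitian_diagonal _)
    · rw [← spectrum.sub_singleton_eq]
      rintro y ⟨x, hx, d, rfl, rfl⟩
      simpa using h x hx
  have := hs.dotProduct_mulVec_nonneg v
  rw [Matrix.sub_mulVec, dotProduct_sub, Algebra.algebraMap_eq_smul_one, Matrix.smul_mulVec,
    Matrix.one_mulVec, dotProduct_smul] at this
  simpa using this

theorem dotProduct_mulVec_le_of_spectrum_le {A : Matrix ι ι ℝ} (hA : A.IsHermitian) {c : ℝ}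
    (h : ∀ x ∈ spectrum ℝ A, x ≤ c) (v : ι → ℝ) : v ⬝ᵥ A *ᵥ v ≤ c * (v ⬝ᵥ v) := by
  have := mul_dotProduct_le_of_le_spectrum (A := -A) hA.neg (c := -c) (fun x hx => by
    rw [← spectrum.neg_eq] at hx
    have := h (-x) (by simpa using hx)
    linarith) v
  rw [Matrix.neg_mulVec, dotProduct_neg] at this
  linarith

/-- If `‖A‖² ≤ C²` then `|vᵀ A v| ≤ C ‖v‖²`. -/
theorem abs_dotProduct_mulVec_le_of_sq {A : Matrix ι ι ℝ} (hA : A.IsHermitian) {C : ℝ}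
    (hC : 0 ≤ C) (h : ∀ x ∈ spectrum ℝ (A * A), x ≤ C ^ 2) (v : ι → ℝ) :
    |v ⬝ᵥ A *ᵥ v| ≤ C * (v ⬝ᵥ v) := by
  have hAA : (A * A).IsHermitian := by
    rw [Matrix.IsHermitian, Matrix.conjTranspose_mul, hA.eq]
  have h1 := dotProduct_mulVec_le_of_spectrum_le hAA h v
  have h2 : v ⬝ᵥ (A * A) *ᵥ v = (A *ᵥ v) ⬝ᵥ (A *ᵥ v) := by
    rw [← Matrix.mulVec_mulVec, Matrix.dotProduct_mulVec, ← Matrix.mulVec_transpose]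
    congr 2
  have h3 : (v ⬝ᵥ A *ᵥ v) ^ 2 ≤ (v ⬝ᵥ v) * ((A *ᵥ v) ⬝ᵥ (A *ᵥ v)) := by
    have := Finset.sum_mul_sq_le_sq_mul_sq Finset.univ v (A *ᵥ v)
    simpa only [dotProduct, sq] using this
  have h0 : 0 ≤ v ⬝ᵥ v := by
    simpa [dotProduct] using Finset.sum_nonneg fun i _ => mul_self_nonneg (v i)
  rw [h2] at h1
  exact abs_le_of_sq_le_sq (by nlinarith) (by positivity)

end Rayleigh

/-! ### Dual families -/

section Dual

variable {E : Type*} [NormedAddCommGroup E] [InnerProductSpace ℝ E]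
variable {ι : Type*} [Fintype ι] [DecidableEq ι]

/-- The family dual to `a` inside its span, when the Gram matrix of `a` is invertible. -/
def dualFamily (a : ι → E) (i : ι) : E := ∑ j, (Matrix.gram ℝ a)⁻¹ i j • a j

theorem inner_dualFamily (a : ι → E) (v : E) (i : ι) :
    inner ℝ v (dualFamily a i) = ∑ j, inner ℝ v (a j) * (Matrix.gram ℝ a)⁻¹ j i := by
  have hsymm : ((Matrix.gram ℝ a)⁻¹)ᵀ = (Matrix.gram ℝ a)⁻¹ := by
    have := (Matrix.isHermitian_gram ℝ a).inv.eq
    rwa [Matrix.conjTranspose_eq_transpose_of_trivial] at this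
  rw [dualFamily, inner_sum]
  refine Finset.sum_congr rfl fun j _ => ?_
  rw [inner_smul_right, mul_comm]
  congr 1
  exact (congrFun (congrFun hsymm j) i)

theorem inner_dualFamily_self {a : ι → E} (h : IsUnit (Matrix.gram ℝ a)) (i j : ι) :
    inner ℝ (a j) (dualFamily a i) = if i = j then 1 else 0 := by
  rw [inner_dualFamily]
  have := congrFun (congrFun (Matrix.mul_nonsing_inv _ ((Matrix.isUnit_iff_isUnit_det _).1 h)) j) i
  rw [Matrix.mul_apply, Matrix.one_apply] at this
  simp only [Matrix.gram_apply] at this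
  rw [this]
  simp [eq_comm]

/-- The Gram matrix of the dual family is the inverse Gram matrix, so the defining coefficients are
themselves inner products of dual vectors. -/
theorem dualFamily_eq {a : ι → E} (h : IsUnit (Matrix.gram ℝ a)) (i : ι) :
    dualFamily a i = ∑ j, inner ℝ (dualFamily a i) (dualFamily a j) • a j := by
  have : ∀ j, inner ℝ (dualFamily a i) (dualFamily a j) = (Matrix.gram ℝ a)⁻¹ i j := by
    intro j
    rw [dualFamily, sum_inner]
    simp_rw [inner_smul_left, inner_dualFamily_self h]
    simp
  simp_rw [this]
  rfl

theorem eq_sum_inner_smul_dualFamily {a : ι → E} (h : IsUnit (Matrix.gram ℝ a)) (i : ι) :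
    a i = ∑ j, inner ℝ (a j) (a i) • dualFamily a j := by
  have := Matrix.mul_nonsing_inv _ ((Matrix.isUnit_iff_isUnit_det _).1 h)
  simp_rw [dualFamily, Finset.smul_sum, smul_smul]
  rw [Finset.sum_comm]
  simp_rw [← Finset.sum_smul]
  have h1 : ∀ j, ∑ l, inner ℝ (a l) (a i) * (Matrix.gram ℝ a)⁻¹ l j = if i = j then 1 else 0 := by
    intro j
    have h2 := congrFun (congrFun this i) j
    rw [Matrix.mul_apply, Matrix.one_apply] at h2
    rw [← h2]
    exact Finset.sum_congr rfl fun l _ => by rw [Matrix.gram_apply, real_inner_comm]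
  simp_rw [h1]
  simp

/-- Let `w` be the coefficients of the same vector in the family `a`. Duality gives `‖v‖² = ⟨u, w⟩`,
the spectral bound gives `c |w|² ≤ ‖v‖²`, and Cauchy–Schwarz closes the loop without inverting the
spectrum. -/
theorem norm_sum_smul_dualFamily_sq_le {a : ι → E} {c : ℝ} (hc : 0 < c)
    (h : ∀ x ∈ spectrum ℝ (Matrix.gram ℝ a), c ≤ x) (u : ι → ℝ) :
    ‖∑ i, u i • dualFamily a i‖ ^ 2 ≤ (∑ i, u i ^ 2) / c := by
  have hU : IsUnit (Matrix.gram ℝ a) := by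
    rw [← spectrum.zero_notMem_iff ℝ]
    exact fun h0 => (hc.trans_le (h 0 h0)).false
  set v := ∑ i, u i • dualFamily a i with hv
  obtain ⟨w, hw⟩ : ∃ w : ι → ℝ, v = ∑ j, w j • a j := by
    refine ⟨fun j => ∑ i, u i * (Matrix.gram ℝ a)⁻¹ i j, ?_⟩
    rw [hv]
    simp_rw [dualFamily, Finset.smul_sum, smul_smul, Finset.sum_smul]
    rw [Finset.sum_comm]
  have h1 : ‖v‖ ^ 2 = ∑ i, u i * w i := by
    rw [← real_inner_self_eq_norm_sq]
    nth_rewrite 1 [hw]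
    rw [hv, sum_inner]
    simp_rw [inner_sum, inner_smul_left, inner_smul_right, inner_dualFamily_self hU]
    exact Finset.sum_congr rfl fun i _ => by simp [mul_comm]
  have h2 : c * ∑ i, w i ^ 2 ≤ ‖v‖ ^ 2 := by
    have := mul_dotProduct_le_of_le_spectrum (Matrix.isHermitian_gram ℝ a) h w
    have h3 := Matrix.star_dotProduct_gram_mulVec (𝕜 := ℝ) a w w
    rw [star_trivial] at h3
    rw [h3, ← hw, real_inner_self_eq_norm_sq] at this
    simpa only [dotProduct, sq] using this
  have h3 := Finset.sum_mul_sq_le_sq_mul_sq Finset.univ u w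
  rw [← h1] at h3
  have hu : 0 ≤ ∑ i, u i ^ 2 := Finset.sum_nonneg fun i _ => sq_nonneg _
  rw [le_div_iff₀ hc]
  by_cases h0 : ‖v‖ ^ 2 = 0
  · rw [h0, zero_mul]; exact hu
  · have hpos : 0 < ‖v‖ ^ 2 := lt_of_le_of_ne (sq_nonneg _) (Ne.symm h0)
    have h4 : ‖v‖ ^ 2 * (‖v‖ ^ 2 * c) ≤ ‖v‖ ^ 2 * ∑ i, u i ^ 2 := by nlinarith
    exact le_of_mul_le_mul_left h4 hpos

end Dual

/-- Dual vectors for the subfamily indexed by `S`, and the regression of every `a j` on it. -/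
theorem exists_dual_vectors {d k : ℕ} (a : Fin d → Euc k) (S : Finset (Fin d)) {Cmin : ℝ}
    (hC : 0 < Cmin) (h : ∀ x ∈ spectrum ℝ (blockSS (Matrix.gram ℝ a) S), Cmin ≤ x) :
    ∃ g : Fin d → Euc k,
      (∀ i ∈ S, ∀ j ∈ S, inner ℝ (a j) (g i) = if i = j then (1 : ℝ) else 0) ∧
      (∀ i ∈ S, g i = ∑ j ∈ S, inner ℝ (g i) (g j) • a j) ∧
      (∀ u : Fin d → ℝ, ‖∑ i ∈ S, u i • g i‖ ^ 2 ≤ (∑ i ∈ S, u i ^ 2) / Cmin) ∧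
      (∀ i ∈ S, a i = ∑ j ∈ S, inner ℝ (a j) (a i) • g j) ∧
      ∀ j ∉ S, ∑ i ∈ S, |inner ℝ (a j) (g i)| ≤ maxRowSum
        (blockScS (Matrix.gram ℝ a) S * (blockSS (Matrix.gram ℝ a) S)⁻¹) := by
  classical
  let a' : {j // j ∈ S} → Euc k := fun j => a j
  have hg : blockSS (Matrix.gram ℝ a) S = Matrix.gram ℝ a' := rfl
  rw [hg] at h ⊢
  have hU : IsUnit (Matrix.gram ℝ a') := by
    rw [← spectrum.zero_notMem_iff ℝ]
    exact fun h0 => (hC.trans_le (h 0 h0)).false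
  let g : Fin d → Euc k := fun i => if hi : i ∈ S then dualFamily a' ⟨i, hi⟩ else 0
  have hgi : ∀ i : {j // j ∈ S}, g i = dualFamily a' i := fun i => by
    simp [g, i.2]
  refine ⟨g, fun i hi j hj => ?_, fun i hi => ?_, fun u => ?_, fun i hi => ?_, fun j hj => ?_⟩
  · have := inner_dualFamily_self hU ⟨i, hi⟩ ⟨j, hj⟩
    rw [← hgi] at this
    simpa [a'] using this
  · have := dualFamily_eq hU ⟨i, hi⟩
    simp_rw [← hgi] at this
    rw [← Finset.sum_coe_sort S (fun j => inner ℝ (g i) (g j) • a j)]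
    exact this
  · have := norm_sum_smul_dualFamily_sq_le hC h (fun i => u i)
    simp_rw [← hgi] at this
    rw [Finset.sum_coe_sort S (fun j => u j • g j), Finset.sum_coe_sort S (fun j => u j ^ 2)] at this
    exact this
  · have := eq_sum_inner_smul_dualFamily hU ⟨i, hi⟩
    simp_rw [← hgi] at this
    rw [← Finset.sum_coe_sort S (fun j => inner ℝ (a j) (a i) • g j)]
    exact this
  · rw [maxRowSum, ← Finset.sum_coe_sort S (fun i => |inner ℝ (a j) (g i)|)]
    refine le_trans (le_of_eq ?_) (le_ciSup (f := fun i : {j // j ∉ S} =>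
      ∑ l, |(blockScS (Matrix.gram ℝ a) S * (Matrix.gram ℝ a')⁻¹) i l|)
      (Set.finite_range _).bddAbove ⟨j, hj⟩)
    refine Finset.sum_congr rfl fun i _ => ?_
    rw [hgi, inner_dualFamily, Matrix.mul_apply]
    rfl

/-- The regression residual is orthogonal to the regressors. -/
theorem inner_regression_residual {d k : ℕ} {a g : Fin d → Euc k} {S : Finset (Fin d)}
    (h : ∀ i ∈ S, a i = ∑ j ∈ S, inner ℝ (a j) (a i) • g j) (v : Euc k) {i : Fin d} (hi : i ∈ S) :
    inner ℝ (v - ∑ j ∈ S, inner ℝ v (g j) • a j) (a i) = 0 := by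
  rw [inner_sub_left, sum_inner]
  nth_rewrite 1 [h i hi]
  rw [inner_sum, sub_eq_zero]
  refine Finset.sum_congr rfl fun j _ => ?_
  rw [inner_smul_left, inner_smul_right]
  simp [mul_comm]

theorem norm_regression_residual_sq_le {d k : ℕ} {a g : Fin d → Euc k} {S : Finset (Fin d)}
    (h : ∀ i ∈ S, a i = ∑ j ∈ S, inner ℝ (a j) (a i) • g j) (v : Euc k) :
    ‖v - ∑ j ∈ S, inner ℝ v (g j) • a j‖ ^ 2 ≤ ‖v‖ ^ 2 := by
  set f := v - ∑ j ∈ S, inner ℝ v (g j) • a j with hf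
  have h0 : inner ℝ f (∑ j ∈ S, inner ℝ v (g j) • a j) = 0 := by
    rw [inner_sum]
    refine Finset.sum_eq_zero fun j hj => ?_
    rw [inner_smul_right, inner_regression_residual h v hj, mul_zero]
  have hv : v = f + ∑ j ∈ S, inner ℝ v (g j) • a j := by rw [hf]; abel
  have := norm_add_sq_eq_norm_sq_add_norm_sq_of_inner_eq_zero _ _ h0
  rw [← hv] at this
  nlinarith [norm_nonneg (∑ j ∈ S, inner ℝ v (g j) • a j)]

/-- Comparing first orders in `t`: `1 + t m ≤ E exp (t f) ≤ exp (c t² / 2)`. Thus centering is a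
consequence of the moment generating bound rather than an assumption. -/
theorem integral_nonpos_of_subgaussian {Ω : Type*} [MeasurableSpace Ω] {μ : Measure Ω}
    [IsProbabilityMeasure μ] {f : Ω → ℝ} {c : ℝ≥0} (h : HasSubgaussianMGF f c μ) :
    ∫ ω, f ω ∂μ ≤ 0 := by
  by_contra hm
  push Not at hm
  set m := ∫ ω, f ω ∂μ
  have hc : (0 : ℝ) ≤ c := c.2
  -- The first bound makes `c t² ≤ 1`, where `exp (c t² / 2) ≤ 1 + c t²`; the second makes `c t`
  -- less than `m`, a contradiction.
  set t : ℝ := min (1 / (c + 1)) (m / (2 * (c + 1))) with ht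
  have ht0 : 0 < t := by positivity
  have h1 : t * m ≤ Real.exp (c * t ^ 2 / 2) - 1 := by
    have hi : Integrable (fun ω => t * f ω + 1) μ :=
      (h.allMoments.integrable.const_mul t).add (integrable_const _)
    have h2 := integral_mono hi (h.integrable_exp_mul t) fun ω => Real.add_one_le_exp (t * f ω)
    rw [integral_add (h.allMoments.integrable.const_mul t) (integrable_const _),
      integral_const_mul] at h2
    simp only [integral_const, probReal_univ, one_smul] at h2
    have h3 := h.mgf_le t
    rw [mgf] at h3
    linarith
  have ht1 : t * (c + 1) ≤ 1 := by
    rw [← le_div_iff₀ (by positivity)]; exact min_le_left _ _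
  have ht2 : t * (2 * (c + 1)) ≤ m := by
    rw [← le_div_iff₀ (by positivity)]; exact min_le_right _ _
  have hy : (c : ℝ) * t ^ 2 ≤ 1 := by nlinarith [mul_nonneg hc ht0.le]
  have h4 : Real.exp (c * t ^ 2 / 2) ≤ 1 + c * t ^ 2 := by
    have h5 := Real.exp_bound_div_one_sub_of_interval (x := c * t ^ 2 / 2) (by positivity)
      (by linarith)
    refine h5.trans ?_
    rw [div_le_iff₀ (by linarith)]
    nlinarith [mul_nonneg hc (sq_nonneg t)]
  have h6 : t * m ≤ t * (c * t) := by linarith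
  have h7 := le_of_mul_le_mul_left h6 ht0
  nlinarith

theorem integral_eq_zero_of_subgaussian {Ω : Type*} [MeasurableSpace Ω] {μ : Measure Ω}
    [IsProbabilityMeasure μ] {f : Ω → ℝ} {c : ℝ≥0} (h : HasSubgaussianMGF f c μ) :
    ∫ ω, f ω ∂μ = 0 := by
  refine le_antisymm (integral_nonpos_of_subgaussian h) ?_
  have := integral_nonpos_of_subgaussian h.neg
  simp only [Pi.neg_apply, integral_neg] at this
  linarith

theorem errorSD_sq {η : Measure ℝ} [IsProbabilityMeasure η] {c : ℝ≥0}
    (h : HasSubgaussianMGF (fun e : ℝ => e) c η) : errorSD η ^ 2 = ∫ e, e ^ 2 ∂η := by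
  rw [errorSD, Real.sq_sqrt (variance_nonneg _ _),
    variance_of_integral_eq_zero aemeasurable_id' (integral_eq_zero_of_subgaussian h)]

/-! ### Second moments of linear images -/

namespace IsIsotropic

variable {k : ℕ} {μ : Measure (Euc k)} {c : ℝ≥0}

theorem integral_inner (h : IsIsotropic μ c) (a : Euc k) : ∫ w, inner ℝ a w ∂μ = 0 :=
  have := h.isProbabilityMeasure
  integral_eq_zero_of_subgaussian (h.subgaussian a)

theorem integral_inner_mul_inner (h : IsIsotropic μ c) (a b : Euc k) :
    ∫ w, inner ℝ a w * inner ℝ b w ∂μ = inner ℝ a b := by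
  have h1 := h.integral_sq (a + b)
  have ha := h.allMoments_inner a
  have hb := h.allMoments_inner b
  have := h.isProbabilityMeasure
  have e : ∀ w : Euc k, inner ℝ (a + b) w ^ 2 =
      inner ℝ a w ^ 2 + (2 * (inner ℝ a w * inner ℝ b w) + inner ℝ b w ^ 2) := by
    intro w; rw [inner_add_left]; ring
  simp_rw [e] at h1
  have i1 : Integrable (fun w => 2 * ((inner ℝ a w : ℝ) * inner ℝ b w)) μ :=
    ((ha.mul hb).const_mul 2).integrable
  have i2 : Integrable (fun w => (inner ℝ b w : ℝ) ^ 2) μ := (hb.pow 2).integrable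
  have i12 : Integrable (fun w => 2 * ((inner ℝ a w : ℝ) * inner ℝ b w) + inner ℝ b w ^ 2) μ :=
    i1.add i2
  rw [integral_add (ha.pow 2).integrable i12, integral_add i1 i2, integral_const_mul,
    h.integral_sq, h.integral_sq, norm_add_sq_real] at h1
  linarith

theorem integral_apply_mul_apply (h : IsIsotropic μ c) (l m : Fin k) :
    ∫ w, w l * w m ∂μ = if l = m then 1 else 0 := by
  have := h.integral_inner_mul_inner (EuclideanSpace.single l 1) (EuclideanSpace.single m 1)
  simp only [EuclideanSpace.inner_single_left, map_one, one_mul] at this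
  rw [this]
  simp [PiLp.single_apply]

theorem measurable_linearImage {d : ℕ} (a : Fin d → Euc k) :
    Measurable (fun w : Euc k => fun j => (inner ℝ (a j) w : ℝ)) := by
  fun_prop

theorem covMatrix_map (h : IsIsotropic μ c) {d : ℕ} (a : Fin d → Euc k) :
    covMatrix (μ.map fun w j => inner ℝ (a j) w) = Matrix.gram ℝ a := by
  have := h.isProbabilityMeasure
  ext i j
  rw [covMatrix, Matrix.of_apply, Matrix.gram_apply,
    covariance_map_fun (measurable_pi_apply i).aestronglyMeasurable
      (measurable_pi_apply j).aestronglyMeasurable (measurable_linearImage a).aemeasurable,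
    covariance_eq_sub (h.allMoments_inner _).memLp_two (h.allMoments_inner _).memLp_two,
    h.integral_inner, zero_mul, sub_zero]
  exact h.integral_inner_mul_inner _ _

end IsIsotropic

/-! ### The interaction effect as a quadratic form -/

/-- Ordered pairs are grouped by the unordered pair they define. A fibre off the diagonal has two
elements, which cancels the factor `1 / 2` in the matrix. -/
theorem sum_sym2_mul {d : ℕ} (βI : Sym2 (Fin d) → ℝ) (v : Fin d → ℝ) :
    ∑ z : Sym2 (Fin d), (z.map v).mul * βI z = v ⬝ᵥ coefMatrix βI *ᵥ v := by
  have h1 : v ⬝ᵥ coefMatrix βI *ᵥ v =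
      ∑ x : Fin d × Fin d, v x.1 * v x.2 * coefMatrix βI x.1 x.2 := by
    rw [Fintype.sum_prod_type]
    simp only [dotProduct, Matrix.mulVec, Finset.mul_sum]
    exact Finset.sum_congr rfl fun i _ => Finset.sum_congr rfl fun j _ => by ring
  rw [h1, ← Finset.sum_fiberwise (s := Finset.univ) (g := fun x : Fin d × Fin d => s(x.1, x.2))]
  refine Finset.sum_congr rfl fun z _ => ?_
  induction z using Sym2.ind with
  | _ i j =>
    by_cases hij : i = j
    · subst hij
      have : (Finset.univ.filter fun x : Fin d × Fin d => s(x.1, x.2) = s(i, i)) = {(i, i)} := by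
        ext ⟨x, y⟩; simp
      rw [this]
      simp [coefMatrix]
    · have : (Finset.univ.filter fun x : Fin d × Fin d => s(x.1, x.2) = s(i, j)) =
          {(i, j), (j, i)} := by
        ext ⟨x, y⟩; simp
      rw [this, Finset.sum_pair (by simp [hij])]
      have hs : s(j, i) = s(i, j) := Sym2.eq_swap
      simp only [coefMatrix, Matrix.of_apply, hij, Ne.symm hij, if_false, Sym2.map_mk,
        Sym2.mul_mk, hs]
      ring

theorem coefMatrix_isHermitian {d : ℕ} (βI : Sym2 (Fin d) → ℝ) :
    (coefMatrix βI).IsHermitian := by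
  ext i j
  simp only [coefMatrix, Matrix.conjTranspose_apply, Matrix.of_apply, star_trivial]
  by_cases hij : i = j
  · simp [hij]
  · simp [hij, Ne.symm hij, Sym2.eq_swap (a := i)]

theorem coefMatrix_eq_zero {d : ℕ} (β : Fin d → ℝ) (βI : Sym2 (Fin d) → ℝ) {i j : Fin d}
    (hi : i ∉ support β βI) : coefMatrix βI i j = 0 := by
  have h : ∀ j, βI s(i, j) = 0 := by
    simp only [support, Finset.mem_filter_univ, not_lt] at hi
    have h1 : ∑ k, βI s(i, k) ^ 2 ≤ 0 := by nlinarith [sq_nonneg (β i)]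
    have h2 := (Finset.sum_eq_zero_iff_of_nonneg fun k _ => sq_nonneg (βI s(i, k))).1
      (le_antisymm h1 (Finset.sum_nonneg fun k _ => sq_nonneg _))
    exact fun j => by simpa using h2 j (Finset.mem_univ j)
  by_cases hij : i = j
  · subst hij; simp [coefMatrix, h]
  · simp [coefMatrix, hij, h]

theorem coefMatrix_eq_zero' {d : ℕ} (β : Fin d → ℝ) (βI : Sym2 (Fin d) → ℝ) {i j : Fin d}
    (hj : j ∉ support β βI) : coefMatrix βI i j = 0 := by
  have := (coefMatrix_isHermitian βI).apply i j
  rw [← this, coefMatrix_eq_zero β βI hj, star_zero]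

/-- Truncating `v` to the support does not change the form, so the spectral bound is paid on `s`
coordinates instead of all of them. -/
theorem abs_coefMatrix_form_le {d : ℕ} (β : Fin d → ℝ) (βI : Sym2 (Fin d) → ℝ) {CB : ℝ}
    (hCB : 0 ≤ CB) (h : ∀ x ∈ spectrum ℝ (coefMatrix βI * coefMatrix βI), x ≤ CB ^ 2)
    (v : Fin d → ℝ) :
    |v ⬝ᵥ coefMatrix βI *ᵥ v| ≤ CB * ∑ j ∈ support β βI, v j ^ 2 := by
  set u : Fin d → ℝ := fun j => if j ∈ support β βI then v j else 0 with hu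
  have h1 : v ⬝ᵥ coefMatrix βI *ᵥ v = u ⬝ᵥ coefMatrix βI *ᵥ u := by
    simp only [dotProduct, Matrix.mulVec, Finset.mul_sum]
    refine Finset.sum_congr rfl fun i _ => Finset.sum_congr rfl fun j _ => ?_
    by_cases hi : i ∈ support β βI
    · by_cases hj : j ∈ support β βI
      · simp [hu, hi, hj]
      · simp [coefMatrix_eq_zero' β βI hj]
    · simp [coefMatrix_eq_zero β βI hi]
  have h2 : u ⬝ᵥ u = ∑ j ∈ support β βI, v j ^ 2 := by
    simp [dotProduct, hu, Finset.sum_ite_mem, sq]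
  rw [h1, ← h2]
  exact abs_dotProduct_mulVec_le_of_sq (coefMatrix_isHermitian βI) hCB h u

/-- The matrix of the form `v ↦ vᵀ B v` in the coordinates `w`, where `v j = ⟪a j, w⟫`. -/
def pulledForm {d k : ℕ} (a : Fin d → Euc k) (B : Matrix (Fin d) (Fin d) ℝ) :
    Matrix (Fin k) (Fin k) ℝ :=
  (Matrix.of fun j l => a j l)ᵀ * B * (Matrix.of fun j l => a j l)

section PulledForm

variable {d k : ℕ} (a : Fin d → Euc k) (B : Matrix (Fin d) (Fin d) ℝ)

theorem pulledForm_apply (l m : Fin k) :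
    pulledForm a B l m = ∑ j, ∑ i, a i l * B i j * a j m := by
  simp [pulledForm, Matrix.mul_apply, Finset.sum_mul]

theorem pulledForm_isHermitian {B : Matrix (Fin d) (Fin d) ℝ} (hB : B.IsHermitian) :
    (pulledForm a B).IsHermitian := by
  rw [Matrix.IsHermitian, Matrix.conjTranspose_eq_transpose_of_trivial, pulledForm,
    Matrix.transpose_mul, Matrix.transpose_mul, Matrix.transpose_transpose, Matrix.mul_assoc]
  rw [Matrix.IsHermitian, Matrix.conjTranspose_eq_transpose_of_trivial] at hB
  rw [hB]

theorem dotProduct_pulledForm (w : Euc k) :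
    (w : Fin k → ℝ) ⬝ᵥ pulledForm a B *ᵥ (w : Fin k → ℝ) =
      (fun j => inner ℝ (a j) w) ⬝ᵥ B *ᵥ (fun j => inner ℝ (a j) w) := by
  have : (Matrix.of fun j l => a j l) *ᵥ (w : Fin k → ℝ) = fun j => inner ℝ (a j) w := by
    ext j
    simp [Matrix.mulVec, dotProduct, PiLp.inner_apply, mul_comm]
  rw [pulledForm, ← Matrix.mulVec_mulVec, ← Matrix.mulVec_mulVec, this, Matrix.dotProduct_mulVec,
    Matrix.vecMul_transpose, this]

theorem trace_pulledForm : (pulledForm a B).trace = ∑ i, ∑ j, B i j * inner ℝ (a i) (a j) := by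
  simp only [Matrix.trace, Matrix.diag, pulledForm_apply, PiLp.inner_apply, RCLike.inner_apply,
    conj_trivial, Finset.mul_sum]
  rw [Finset.sum_comm, Finset.sum_comm (s := Finset.univ (α := Fin d)) (t := Finset.univ (α := Fin d))]
  refine Finset.sum_congr rfl fun j _ => ?_
  rw [Finset.sum_comm]
  exact Finset.sum_congr rfl fun i _ => Finset.sum_congr rfl fun l _ => by ring

/-- In adapted coordinates the interaction form ignores everything outside `T`. This is the source
both of its rank deficiency and of the conditioning on `T`. -/
theorem pulledForm_eq_zero {S : Finset (Fin d)} {T : Finset (Fin k)}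
    (ha : ∀ j ∈ S, ∀ l ∉ T, a j l = 0) {B : Matrix (Fin d) (Fin d) ℝ}
    (hB : ∀ i j, j ∉ S → B i j = 0) {l m : Fin k} (hm : m ∉ T) : pulledForm a B l m = 0 := by
  rw [pulledForm_apply]
  refine Finset.sum_eq_zero fun j _ => Finset.sum_eq_zero fun i _ => ?_
  by_cases hj : j ∈ S
  · rw [ha j hj m hm, mul_zero]
  · rw [hB i j hj]; ring

end PulledForm

open IsIsotropic in
/-- The interaction effect in the isotropic coordinates. -/
theorem interactionEffect_linearImage {d k : ℕ} {μ : Measure (Euc k)} {c : ℝ≥0}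
    (h : IsIsotropic μ c) (a : Fin d → Euc k) (βI : Sym2 (Fin d) → ℝ) (w : Euc k) :
    interactionEffect (μ.map fun w j => inner ℝ (a j) w) βI (fun j => inner ℝ (a j) w) =
      centeredForm (pulledForm a (coefMatrix βI)) w := by
  have hA := measurable_linearImage a
  have hmean : ∑ z : Sym2 (Fin d),
      (∫ v, (z.map v).mul ∂(μ.map fun w j => inner ℝ (a j) w)) * βI z =
      (pulledForm a (coefMatrix βI)).trace := by
    have h1 : ∀ z : Sym2 (Fin d), Measurable fun v : Fin d → ℝ => (z.map v).mul := by
      intro z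
      induction z using Sym2.ind with
      | _ i j => simp only [Sym2.map_mk, Sym2.mul_mk]; fun_prop
    have h2 : ∀ z : Sym2 (Fin d),
        Integrable (fun w : Euc k => (z.map fun j => (inner ℝ (a j) w : ℝ)).mul) μ := by
      intro z
      induction z using Sym2.ind with
      | _ i j =>
        simp only [Sym2.map_mk, Sym2.mul_mk]
        exact ((h.allMoments_inner _).mul (h.allMoments_inner _)).integrable
    have h3 : ∀ z : Sym2 (Fin d),
        (∫ v, (z.map v).mul ∂(μ.map fun w j => inner ℝ (a j) w)) * βI z =
          ∫ w, (z.map fun j => (inner ℝ (a j) w : ℝ)).mul * βI z ∂μ := by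
      intro z
      rw [integral_map hA.aemeasurable (h1 z).aestronglyMeasurable, integral_mul_const]
    simp_rw [h3]
    rw [← integral_finsetSum _ fun z _ => (h2 z).mul_const _]
    simp_rw [sum_sym2_mul]
    rw [trace_pulledForm]
    simp only [dotProduct, Matrix.mulVec, Finset.mul_sum]
    have h4 : ∀ i j, Integrable (fun w : Euc k =>
        (inner ℝ (a i) w : ℝ) * (coefMatrix βI i j * inner ℝ (a j) w)) μ := fun i j =>
      ((h.allMoments_inner _).mul ((h.allMoments_inner _).const_mul _)).integrable
    rw [integral_finsetSum _ fun i _ => integrable_finsetSum _ fun j _ => h4 i j]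
    refine Finset.sum_congr rfl fun i _ => ?_
    rw [integral_finsetSum _ fun j _ => h4 i j]
    refine Finset.sum_congr rfl fun j _ => ?_
    rw [← h.integral_inner_mul_inner, ← integral_const_mul]
    exact integral_congr_ae (.of_forall fun w => by simp only; ring)
  rw [interactionEffect]
  simp_rw [sub_mul]
  rw [Finset.sum_sub_distrib, hmean, sum_sym2_mul, centeredForm, dotProduct_pulledForm]

namespace IsIsotropic

variable {k : ℕ} {μ : Measure (Euc k)} {c : ℝ≥0}

theorem allMoments_centeredForm (h : IsIsotropic μ c) (Q : Matrix (Fin k) (Fin k) ℝ) :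
    AllMoments (centeredForm Q) μ := by
  have := h.isProbabilityMeasure
  have h1 : AllMoments (fun w : Euc k => ∑ l, ∑ m, Q l m * (w l * w m)) μ :=
    .sum _ fun l _ => .sum _ fun m _ =>
      ((h.allMoments_apply l).mul (h.allMoments_apply m)).const_mul _
  have h2 := h1.sub (AllMoments.const (μ := μ) Q.trace)
  convert h2 using 2 with w
  simp only [centeredForm, dotProduct, Matrix.mulVec, Finset.mul_sum]
  congr 1
  exact Finset.sum_congr rfl fun i _ => Finset.sum_congr rfl fun j _ => by ring

theorem integral_centeredForm (h : IsIsotropic μ c) (Q : Matrix (Fin k) (Fin k) ℝ) :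
    ∫ w, centeredForm Q w ∂μ = 0 := by
  have := h.isProbabilityMeasure
  have i1 : ∀ l m, Integrable (fun w : Euc k => w l * (Q l m * w m)) μ := fun l m =>
    ((h.allMoments_apply l).mul ((h.allMoments_apply m).const_mul _)).integrable
  have i2 : Integrable (fun w : Euc k => ∑ l, ∑ m, w l * (Q l m * w m)) μ :=
    integrable_finsetSum _ fun l _ => integrable_finsetSum _ fun m _ => i1 l m
  simp only [centeredForm, dotProduct, Matrix.mulVec, Finset.mul_sum]
  rw [integral_sub i2 (integrable_const _),
    integral_finsetSum _ fun l _ => integrable_finsetSum _ fun m _ => i1 l m]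
  simp_rw [integral_finsetSum _ fun m _ => i1 _ m]
  have h3 : ∀ l m, ∫ w : Euc k, w l * (Q l m * w m) ∂μ = if l = m then Q l m else 0 := by
    intro l m
    have : ∀ w : Euc k, w l * (Q l m * w m) = Q l m * (w l * w m) := fun w => by ring
    simp_rw [this]
    rw [integral_const_mul, h.integral_apply_mul_apply]
    simp
  simp [h3, Matrix.trace]

theorem centeredForm_neg (Q : Matrix (Fin k) (Fin k) ℝ) (w : Euc k) :
    centeredForm Q (-w) = centeredForm Q w := by
  simp [centeredForm, Matrix.mulVec_neg]

/-- A form supported on `T` only depends on the coordinates in `T`. -/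
theorem centeredForm_congr {Q : Matrix (Fin k) (Fin k) ℝ} {T : Finset (Fin k)}
    (hQ : Q.IsHermitian) (hQT : ∀ l, ∀ m ∉ T, Q l m = 0) {w w' : Euc k} (hw : ∀ l ∈ T, w l = w' l) :
    centeredForm Q w = centeredForm Q w' := by
  simp only [centeredForm, dotProduct, Matrix.mulVec, Finset.mul_sum]
  congr 1
  refine Finset.sum_congr rfl fun l _ => Finset.sum_congr rfl fun m _ => ?_
  by_cases hl : l ∈ T
  · by_cases hm : m ∈ T
    · rw [hw l hl, hw m hm]
    · rw [hQT l m hm]; ring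
  · have : Q l m = 0 := by
      rw [← hQ.apply, hQT m l hl, star_zero]
    rw [this]; ring

theorem det_eq_zero_of_notMem {Q : Matrix (Fin k) (Fin k) ℝ} {T : Finset (Fin k)}
    (hQT : ∀ l, ∀ m ∉ T, Q l m = 0) {m : Fin k} (hm : m ∉ T) : Q.det = 0 :=
  Matrix.det_eq_zero_of_column_eq_zero m fun l => hQT l m hm

theorem interactionSD_sq (h : IsIsotropic μ c) {d : ℕ} (a : Fin d → Euc k)
    (βI : Sym2 (Fin d) → ℝ) :
    interactionSD (μ.map fun w j => inner ℝ (a j) w) βI ^ 2 =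
      ∫ w, centeredForm (pulledForm a (coefMatrix βI)) w ^ 2 ∂μ := by
  have hA := measurable_linearImage a
  have hm : Measurable (interactionEffect (μ.map fun w j => inner ℝ (a j) w) βI) := by
    refine Finset.measurable_sum _ fun z _ => ?_
    induction z using Sym2.ind with
    | _ i j => simp only [Sym2.map_mk, Sym2.mul_mk]; fun_prop
  have h0 : ∫ v, interactionEffect (μ.map fun w j => inner ℝ (a j) w) βI v
      ∂(μ.map fun w j => inner ℝ (a j) w) = 0 := by
    rw [integral_map hA.aemeasurable hm.aestronglyMeasurable]
    simp_rw [interactionEffect_linearImage h]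
    exact h.integral_centeredForm _
  rw [interactionSD, Real.sq_sqrt (variance_nonneg _ _),
    variance_of_integral_eq_zero hm.aemeasurable h0,
    integral_map hA.aemeasurable (hm.pow_const 2).aestronglyMeasurable]
  simp_rw [interactionEffect_linearImage h]

/-- Eighth moment of a form bounded by `C ∑ ⟪a j, w⟫²`. -/
theorem integral_centeredForm_pow_eight_le (h : IsIsotropic μ c) (hc : 0 < c)
    {Q : Matrix (Fin k) (Fin k) ℝ} {d : ℕ} {a : Fin d → Euc k} {S : Finset (Fin d)} {C V : ℝ}
    (hC : 0 ≤ C) (hQ : ∀ w : Euc k, |(w : Fin k → ℝ) ⬝ᵥ Q *ᵥ (w : Fin k → ℝ)| ≤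
      C * ∑ j ∈ S, inner ℝ (a j) w ^ 2) (ha : ∀ j ∈ S, ‖a j‖ ^ 2 ≤ V) :
    ∫ w, centeredForm Q w ^ 8 ∂μ ≤
      128 * (C ^ 8 * (S.card ^ 8 * (4 * (Nat.factorial 16) * (c * V) ^ 8) + S.card ^ 8 * V ^ 8)) := by
  have := h.isProbabilityMeasure
  -- The trace is the mean of the uncentered form, so the pointwise bound on the form controls it as
  -- well.
  have htr : |Q.trace| ≤ C * (S.card * V) := by
    have i1 := (h.allMoments_centeredForm Q).integrable
    have e1 : ∫ w : Euc k, (w : Fin k → ℝ) ⬝ᵥ Q *ᵥ (w : Fin k → ℝ) ∂μ = Q.trace := by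
      have h0 := h.integral_centeredForm Q
      have : ∀ w : Euc k, (w : Fin k → ℝ) ⬝ᵥ Q *ᵥ (w : Fin k → ℝ) =
          centeredForm Q w + Q.trace := fun w => by simp [centeredForm]
      simp_rw [this]
      rw [integral_add i1 (integrable_const _), h0]
      simp
    rw [← e1]
    refine (abs_integral_le_integral_abs).trans ?_
    have i2 : Integrable (fun w : Euc k => C * ∑ j ∈ S, (inner ℝ (a j) w : ℝ) ^ 2) μ :=
      ((AllMoments.sum S fun j _ => (h.allMoments_inner (a j)).pow 2).const_mul C).integrable
    refine (integral_mono_of_nonneg (.of_forall fun w => abs_nonneg _) i2 (.of_forall hQ)).trans ?_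
    rw [integral_const_mul, integral_finsetSum _ fun j _ => ((h.allMoments_inner _).pow 2).integrable]
    gcongr
    simp_rw [h.integral_sq]
    calc ∑ j ∈ S, ‖a j‖ ^ 2 ≤ ∑ _j ∈ S, V := Finset.sum_le_sum ha
      _ = S.card * V := by simp
  have hpt : ∀ w : Euc k, centeredForm Q w ^ 8 ≤
      128 * (C ^ 8 * (S.card ^ 7 * ∑ j ∈ S, inner ℝ (a j) w ^ 16 + S.card ^ 8 * V ^ 8)) := by
    intro w
    have h1 : centeredForm Q w ^ 8 ≤ 2 ^ 7 * ((C * ∑ j ∈ S, inner ℝ (a j) w ^ 2) ^ 8 +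
        (C * (S.card * V)) ^ 8) := by
      calc centeredForm Q w ^ 8 = |centeredForm Q w| ^ 8 := (Even.pow_abs (by decide) _).symm
        _ ≤ (|(w : Fin k → ℝ) ⬝ᵥ Q *ᵥ (w : Fin k → ℝ)| + |Q.trace|) ^ 8 := by
            gcongr; exact abs_sub _ _
        _ ≤ (C * ∑ j ∈ S, inner ℝ (a j) w ^ 2 + C * (S.card * V)) ^ 8 := by
            gcongr; exact hQ w
        _ ≤ _ := add_pow_le (mul_nonneg hC (Finset.sum_nonneg fun _ _ => sq_nonneg _))
            ((abs_nonneg _).trans htr) 8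
    refine h1.trans ?_
    have h2 : (∑ j ∈ S, inner ℝ (a j) w ^ 2) ^ 8 ≤ S.card ^ 7 * ∑ j ∈ S, inner ℝ (a j) w ^ 16 := by
      have := pow_sum_le_card_mul_sum_pow (s := S) (f := fun j => (inner ℝ (a j) w : ℝ) ^ 2)
        (fun j _ => sq_nonneg _) 7
      simpa only [← pow_mul] using this
    rw [mul_pow, mul_pow C, mul_pow (S.card : ℝ), ← mul_add]
    norm_num
    gcongr
  have i3 : ∀ j, Integrable (fun w : Euc k => (inner ℝ (a j) w : ℝ) ^ 16) μ := fun j =>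
    ((h.allMoments_inner (a j)).pow 16).integrable
  have i4 : Integrable (fun w : Euc k => (S.card : ℝ) ^ 7 * ∑ j ∈ S, (inner ℝ (a j) w : ℝ) ^ 16) μ :=
    (integrable_finsetSum _ fun j _ => i3 j).const_mul _
  refine (integral_mono ((h.allMoments_centeredForm Q).pow 8).integrable
    (((i4.add (integrable_const ((S.card : ℝ) ^ 8 * V ^ 8))).const_mul (C ^ 8)).const_mul 128)
    hpt).trans ?_
  simp only [Pi.add_apply]
  rw [integral_const_mul, integral_const_mul, integral_add i4 (integrable_const _),
    integral_const_mul, integral_finsetSum _ fun j _ => i3 j]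
  simp only [integral_const, probReal_univ, one_smul]
  have h5 : ∑ j ∈ S, ∫ w, (inner ℝ (a j) w : ℝ) ^ 16 ∂μ ≤
      S.card * (4 * (Nat.factorial 16) * (c * V) ^ 8) := by
    calc ∑ j ∈ S, ∫ w, (inner ℝ (a j) w : ℝ) ^ 16 ∂μ ≤
        ∑ _j ∈ S, 4 * (Nat.factorial 16) * ((c : ℝ) * V) ^ 8 := Finset.sum_le_sum fun j hj => by
          refine (h.integral_inner_pow_le hc (a := a j) 8).trans ?_
          have := ha j hj
          gcongr
      _ = _ := by simp
  have h6 : (S.card : ℝ) ^ 8 * (4 * (Nat.factorial 16) * (c * V) ^ 8) =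
    S.card ^ 7 * (S.card * (4 * (Nat.factorial 16) * (c * V) ^ 8)) := by ring
  rw [h6]
  gcongr

end IsIsotropic

/-! ### Moments of the sample features -/

theorem sum_mul_mul_le_sqrt {ι : Type*} [Fintype ι] (D : ι → ι → ℝ) (t : ι → ℝ) :
    ∑ l, ∑ m, t l * t m * D l m ≤ √(∑ l, ∑ m, D l m ^ 2) * ∑ l, t l ^ 2 := by
  have h1 : ∑ l, ∑ m, t l * t m * D l m = ∑ x : ι × ι, D x.1 x.2 * (t x.1 * t x.2) := by
    rw [Fintype.sum_prod_type]
    exact Finset.sum_congr rfl fun l _ => Finset.sum_congr rfl fun m _ => by ring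
  have h2 : ∑ x : ι × ι, (t x.1 * t x.2) ^ 2 = (∑ l, t l ^ 2) ^ 2 := by
    rw [Fintype.sum_prod_type, sq (∑ l, t l ^ 2), Finset.sum_mul_sum]
    exact Finset.sum_congr rfl fun l _ => Finset.sum_congr rfl fun m _ => by ring
  have h3 := (le_abs_self _).trans (abs_sum_mul_le_sqrt Finset.univ (fun x : ι × ι => D x.1 x.2)
    fun x => t x.1 * t x.2)
  rw [h2, Real.sqrt_sq (Finset.sum_nonneg fun l _ => sq_nonneg _),
    Fintype.sum_prod_type (f := fun x : ι × ι => D x.1 x.2 ^ 2)] at h3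
  rw [h1]
  exact h3

section Sample

variable {Z : Type*} [MeasurableSpace Z] {π : Measure Z} [IsProbabilityMeasure π] {n : ℕ}

theorem integral_le_of_integral_sq_le {f : Z → ℝ} (hf : MemLp f 2 π) {K : ℝ} (hK : 0 ≤ K)
    (h : ∫ z, f z ^ 2 ∂π ≤ K ^ 2) : ∫ z, f z ∂π ≤ K := by
  have h1 := variance_nonneg f π
  rw [variance_eq_sub hf] at h1
  simp only [Pi.pow_apply] at h1
  exact abs_le_of_sq_le_sq' (by linarith) hK |>.2

/-- Chebyshev rather than Markov: the mean is at most `K` and the deviation allowed is again `K`.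
The rate `1 / n` is what survives a union over the active variables. -/
theorem measure_sample_mean_gt_two_mul_le (hn : n ≠ 0) {f : Z → ℝ} (hf : MemLp f 2 π) {K : ℝ}
    (hK : 0 < K) (h : ∫ z, f z ^ 2 ∂π ≤ K ^ 2) :
    (Measure.pi fun _ : Fin n => π) {ω | 2 * K < (n : ℝ)⁻¹ * ∑ i, f (ω i)} ≤
      ENNReal.ofReal (n : ℝ)⁻¹ := by
  have h1 := measure_sum_sq_sample_mean_gt_le (μ := π) hn ({()} : Finset Unit) (f := fun _ => f)
    (fun _ _ => hf) (C := K ^ 2) (t := K ^ 2) (by simpa using h) (by positivity)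
  rw [mul_div_assoc, div_self (by positivity), mul_one] at h1
  refine (measure_mono fun ω hω => ?_).trans h1
  have hω' : 2 * K < (n : ℝ)⁻¹ * ∑ i, f (ω i) := hω
  have hm := integral_le_of_integral_sq_le hf hK.le h
  change K ^ 2 < ∑ a ∈ ({()} : Finset Unit), _
  rw [Finset.sum_singleton]
  exact pow_lt_pow_left₀ (by linarith) hK.le two_ne_zero

end Sample

/-- The regression features: the intercept and the coordinates in `T`. -/
def features {k : ℕ} (T : Finset (Fin k)) (z : Euc k × ℝ) : Option {l // l ∈ T} → ℝ :=
  withIntercept fun l => z.1 l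

/-- The average squared coordinate off `T`. -/
def offMean {k : ℕ} (T : Finset (Fin k)) (z : Euc k × ℝ) : ℝ :=
  (Tᶜ.card : ℝ)⁻¹ * ∑ l ∈ Tᶜ, z.1 l ^ 2

/-- The effective noise: the centered quadratic effect plus the error. -/
def noise {k : ℕ} (Q : Matrix (Fin k) (Fin k) ℝ) (z : Euc k × ℝ) : ℝ :=
  IsIsotropic.centeredForm Q z.1 + z.2

namespace IsIsotropic

variable {k : ℕ} {μ : Measure (Euc k)} {c : ℝ≥0}

/-- The arithmetic-geometric mean inequality is weighted by the norms so that the fourth moments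
recombine into a bound homogeneous in both vectors. -/
theorem integral_inner_sq_mul_inner_sq_le (h : IsIsotropic μ c) (hc : 0 < c) (a b : Euc k) :
    ∫ w, inner ℝ a w ^ 2 * inner ℝ b w ^ 2 ∂μ ≤ 96 * (c : ℝ) ^ 2 * (‖a‖ ^ 2 * ‖b‖ ^ 2) := by
  have := h.isProbabilityMeasure
  by_cases ha : a = 0
  · simp [ha]
  by_cases hb : b = 0
  · simp [hb]
  have ha' : 0 < ‖a‖ ^ 2 := by positivity
  have hb' : 0 < ‖b‖ ^ 2 := by positivity
  have hpt : ∀ w : Euc k, inner ℝ a w ^ 2 * inner ℝ b w ^ 2 ≤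
      (‖b‖ ^ 2 / ‖a‖ ^ 2 / 2) * inner ℝ a w ^ 4 + (‖a‖ ^ 2 / ‖b‖ ^ 2 / 2) * inner ℝ b w ^ 4 := by
    intro w
    generalize (inner ℝ a w : ℝ) = x
    generalize (inner ℝ b w : ℝ) = y
    generalize ‖a‖ ^ 2 = A at *
    generalize ‖b‖ ^ 2 = B at *
    have : B / A / 2 * x ^ 4 + A / B / 2 * y ^ 4 - x ^ 2 * y ^ 2 =
        (B * x ^ 2 - A * y ^ 2) ^ 2 / (2 * A * B) := by field_simp; ring
    have : 0 ≤ (B * x ^ 2 - A * y ^ 2) ^ 2 / (2 * A * B) := by positivity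
    linarith
  have ia : Integrable (fun w : Euc k => (‖b‖ ^ 2 / ‖a‖ ^ 2 / 2) * (inner ℝ a w : ℝ) ^ 4) μ :=
    (((h.allMoments_inner a).pow 4).const_mul _).integrable
  have ib : Integrable (fun w : Euc k => (‖a‖ ^ 2 / ‖b‖ ^ 2 / 2) * (inner ℝ b w : ℝ) ^ 4) μ :=
    (((h.allMoments_inner b).pow 4).const_mul _).integrable
  refine (integral_mono (((h.allMoments_inner a).pow 2).mul
    ((h.allMoments_inner b).pow 2)).integrable (ia.add ib) hpt).trans ?_
  simp only [Pi.add_apply]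
  rw [integral_add ia ib, integral_const_mul, integral_const_mul]
  have h1 := h.integral_inner_pow_le hc (a := a) 2
  have h2 := h.integral_inner_pow_le hc (a := b) 2
  norm_num [Nat.factorial] at h1 h2
  calc _ ≤ (‖b‖ ^ 2 / ‖a‖ ^ 2 / 2) * (96 * ((c : ℝ) * ‖a‖ ^ 2) ^ 2) +
        (‖a‖ ^ 2 / ‖b‖ ^ 2 / 2) * (96 * ((c : ℝ) * ‖b‖ ^ 2) ^ 2) := by gcongr
    _ = _ := by
      generalize ‖a‖ ^ 2 = A at *
      generalize ‖b‖ ^ 2 = B at *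
      field_simp
      ring

variable {η : Measure ℝ} [IsProbabilityMeasure η]

theorem allMoments_fst (h : IsIsotropic μ c) {f : Euc k → ℝ} (hf : AllMoments f μ) :
    AllMoments (fun z : Euc k × ℝ => f z.1) (μ.prod η) :=
  have := h.isProbabilityMeasure
  hf.comp_measurePreserving measurePreserving_fst

theorem integral_fst' (h : IsIsotropic μ c) {f : Euc k → ℝ} (hf : AllMoments f μ) :
    ∫ z : Euc k × ℝ, f z.1 ∂(μ.prod η) = ∫ w, f w ∂μ := by
  have := h.isProbabilityMeasure
  have h1 : (μ.prod η).map Prod.fst = μ := (measurePreserving_fst (μ := μ) (ν := η)).map_eq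
  have h2 := integral_map (μ := μ.prod η) measurable_fst.aemeasurable
    (f := f) (by rw [h1]; exact hf.integrable.aestronglyMeasurable)
  rw [h1] at h2
  exact h2.symm

theorem allMoments_snd (h : IsIsotropic μ c) {f : ℝ → ℝ} (hf : AllMoments f η) :
    AllMoments (fun z : Euc k × ℝ => f z.2) (μ.prod η) :=
  have := h.isProbabilityMeasure
  hf.comp_measurePreserving measurePreserving_snd

theorem integral_snd' (h : IsIsotropic μ c) {f : ℝ → ℝ} (hf : AllMoments f η) :
    ∫ z : Euc k × ℝ, f z.2 ∂(μ.prod η) = ∫ e, f e ∂η := by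
  have := h.isProbabilityMeasure
  have h1 : (μ.prod η).map Prod.snd = η := (measurePreserving_snd (μ := μ) (ν := η)).map_eq
  have h2 := integral_map (μ := μ.prod η) measurable_snd.aemeasurable
    (f := f) (by rw [h1]; exact hf.integrable.aestronglyMeasurable)
  rw [h1] at h2
  exact h2.symm

variable {T : Finset (Fin k)}

theorem allMoments_features (h : IsIsotropic μ c) (o : Option {l // l ∈ T}) :
    AllMoments (fun z => features T z o) (μ.prod η) := by
  have := h.isProbabilityMeasure
  cases o with
  | none => exact AllMoments.const 1
  | some l => exact h.allMoments_fst (h.allMoments_apply l)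

theorem integral_features_mul (h : IsIsotropic μ c) (o o' : Option {l // l ∈ T}) :
    ∫ z, features T z o * features T z o' ∂(μ.prod η) = if o = o' then 1 else 0 := by
  have := h.isProbabilityMeasure
  have h0 : ∀ l : Fin k, ∫ z : Euc k × ℝ, z.1 l ∂(μ.prod η) = 0 := fun l => by
    rw [h.integral_fst' (h.allMoments_apply l)]
    simpa [EuclideanSpace.inner_single_left] using h.integral_inner (EuclideanSpace.single l 1)
  cases o with
  | none => cases o' with
    | none => simp [features, withIntercept]
    | some l => simpa [features, withIntercept] using h0 l
  | some l => cases o' with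
    | none => simpa [features, withIntercept] using h0 l
    | some m =>
      simp only [features, withIntercept, Option.elim]
      rw [h.integral_fst' ((h.allMoments_apply l).mul (h.allMoments_apply m)),
        h.integral_apply_mul_apply]
      by_cases hlm : l = m
      · simp [hlm]
      · have : (l : Fin k) ≠ m := fun h => hlm (Subtype.ext h)
        simp [this, hlm]

theorem integral_features_pow_le (h : IsIsotropic μ c) (hc : 0 < c) (o : Option {l // l ∈ T})
    (m : ℕ) : ∫ z, features T z o ^ (2 * m) ∂(μ.prod η) ≤ 1 + 4 * (2 * m).factorial * (c : ℝ) ^ m := by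
  have := h.isProbabilityMeasure
  cases o with
  | none =>
    simp only [features, withIntercept, Option.elim, one_pow, integral_const, probReal_univ,
      one_smul]
    have : (0 : ℝ) ≤ 4 * (2 * m).factorial * (c : ℝ) ^ m := by positivity
    linarith
  | some l =>
    simp only [features, withIntercept, Option.elim]
    rw [h.integral_fst' ((h.allMoments_apply l).pow _)]
    linarith [h.integral_apply_pow_le hc l m]

theorem integral_features_sq_mul_sq_le (h : IsIsotropic μ c) (hc : 0 < c)
    (o o' : Option {l // l ∈ T}) :
    ∫ z, (features T z o * features T z o') ^ 2 ∂(μ.prod η) ≤ 1 + 96 * (c : ℝ) ^ 2 := by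
  have := h.isProbabilityMeasure
  have i1 : ∀ o : Option {l // l ∈ T}, Integrable (fun z => features T z o ^ 4) (μ.prod η) :=
    fun o => ((h.allMoments_features o).pow 4).integrable
  have h1 : ∀ o : Option {l // l ∈ T}, ∫ z, features T z o ^ 4 ∂(μ.prod η) ≤ 1 + 96 * (c : ℝ) ^ 2 :=
    fun o => (h.integral_features_pow_le hc o 2).trans_eq (by norm_num [Nat.factorial])
  refine (integral_mono (((h.allMoments_features o).mul (h.allMoments_features o')).pow 2).integrable
    (((i1 o).add (i1 o')).const_mul (1 / 2)) fun z => ?_).trans ?_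
  · simp only [Pi.add_apply]
    nlinarith [sq_nonneg (features T z o ^ 2 - features T z o' ^ 2)]
  · simp only [Pi.add_apply]
    rw [integral_const_mul, integral_add (i1 o) (i1 o')]
    linarith [h1 o, h1 o']

/-- The empirical Gram matrix of the features is close to the identity. -/
theorem measure_gramDev_gt_le (h : IsIsotropic μ c) (hc : 0 < c) {n : ℕ} (hn : n ≠ 0) {x : ℝ}
    (hx : 0 < x) :
    (Measure.pi fun _ : Fin n => μ.prod η) {ω | x < gramDev fun i => features T (ω i)} ≤
      ENNReal.ofReal ((n : ℝ)⁻¹ * ((T.card + 1) ^ 2 * (1 + 96 * (c : ℝ) ^ 2)) / x) := by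
  have := h.isProbabilityMeasure
  have h1 := measure_sum_sq_sample_mean_gt_le (μ := μ.prod η) hn
    (Finset.univ : Finset (Option {l // l ∈ T} × Option {l // l ∈ T}))
    (f := fun a z => features T z a.1 * features T z a.2)
    (C := (T.card + 1) ^ 2 * (1 + 96 * (c : ℝ) ^ 2)) (t := x)
    (fun a _ => ((h.allMoments_features a.1).mul (h.allMoments_features a.2)).memLp_two)
    ((Finset.sum_le_sum fun a _ => h.integral_features_sq_mul_sq_le hc a.1 a.2).trans_eq
      (by simp [Fintype.card_option]; ring)) hx
  simp_rw [Fintype.sum_prod_type, h.integral_features_mul] at h1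
  exact h1

theorem measurable_features (o : Option {l // l ∈ T}) :
    Measurable (fun z : Euc k × ℝ => features T z o) := by
  cases o with
  | none => exact measurable_const
  | some l => simp only [features, withIntercept, Option.elim]; fun_prop

theorem measurable_offMean : Measurable (offMean T) := by
  unfold offMean; fun_prop

theorem offMean_nonneg (z : Euc k × ℝ) : 0 ≤ offMean T z :=
  mul_nonneg (by positivity) (Finset.sum_nonneg fun _ _ => sq_nonneg _)

theorem allMoments_offMean (h : IsIsotropic μ c) : AllMoments (offMean T) (μ.prod η) := by
  have := h.isProbabilityMeasure
  exact (AllMoments.sum Tᶜ fun l _ => h.allMoments_fst ((h.allMoments_apply l).pow 2)).const_mul _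

/-- Weighted averages of squared coordinates off `T` inherit a common bound. -/
theorem integral_offMean_mul_le (h : IsIsotropic μ c) {F : Euc k × ℝ → ℝ}
    (hF : AllMoments F (μ.prod η)) {C : ℝ} (hC : 0 ≤ C)
    (hb : ∀ l ∉ T, ∫ z, z.1 l ^ 2 * F z ∂(μ.prod η) ≤ C) :
    ∫ z, offMean T z * F z ∂(μ.prod η) ≤ C := by
  have := h.isProbabilityMeasure
  have i1 : ∀ l, Integrable (fun z : Euc k × ℝ => z.1 l ^ 2 * F z) (μ.prod η) := fun l =>
    ((h.allMoments_fst ((h.allMoments_apply l).pow 2)).mul hF).integrable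
  have e : ∀ z : Euc k × ℝ, offMean T z * F z = (Tᶜ.card : ℝ)⁻¹ * ∑ l ∈ Tᶜ, z.1 l ^ 2 * F z := by
    intro z; rw [offMean, mul_assoc, Finset.sum_mul]
  simp_rw [e]
  rw [integral_const_mul, integral_finsetSum _ fun l _ => i1 l]
  calc _ ≤ (Tᶜ.card : ℝ)⁻¹ * ∑ _l ∈ Tᶜ, C := by
        gcongr with l hl; exact hb l (by simpa using hl)
    _ = (Tᶜ.card : ℝ)⁻¹ * Tᶜ.card * C := by simp [mul_assoc]
    -- Only an inequality: if `T` is everything, the inverse of the cardinality is `0` and so is the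
    -- average.
    _ ≤ 1 * C := by gcongr; exact inv_mul_le_one
    _ = C := one_mul C

theorem integral_offMean_pow_four_le (h : IsIsotropic μ c) (hc : 0 < c) :
    ∫ z, offMean T z ^ 4 ∂(μ.prod η) ≤ 161280 * (c : ℝ) ^ 4 := by
  have := h.isProbabilityMeasure
  have i1 : ∀ l, Integrable (fun z : Euc k × ℝ => z.1 l ^ 8) (μ.prod η) := fun l =>
    (h.allMoments_fst ((h.allMoments_apply l).pow 8)).integrable
  have hpt : ∀ z : Euc k × ℝ, offMean T z ^ 4 ≤ (Tᶜ.card : ℝ)⁻¹ * ∑ l ∈ Tᶜ, z.1 l ^ 8 := by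
    intro z
    have h1 := pow_sum_le_card_mul_sum_pow (s := Tᶜ) (f := fun l => z.1 l ^ 2)
      (fun j _ => sq_nonneg _) 3
    simp only [← pow_mul] at h1
    norm_num at h1
    by_cases h0 : Tᶜ.card = 0
    · simp [offMean, h0]
    · have h0' : (0 : ℝ) < Tᶜ.card := by exact_mod_cast Nat.pos_of_ne_zero h0
      rw [offMean, mul_pow]
      calc _ ≤ (Tᶜ.card : ℝ)⁻¹ ^ 4 * ((Tᶜ.card : ℝ) ^ 3 * ∑ l ∈ Tᶜ, z.1 l ^ 8) := by
            gcongr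
        _ = _ := by field_simp
  refine (integral_mono ((h.allMoments_offMean).pow 4).integrable
    ((integrable_finsetSum _ fun l _ => i1 l).const_mul _) hpt).trans ?_
  rw [integral_const_mul, integral_finsetSum _ fun l _ => i1 l]
  have h8 : ∀ l, ∫ z : Euc k × ℝ, z.1 l ^ 8 ∂(μ.prod η) ≤ 161280 * (c : ℝ) ^ 4 := fun l => by
    rw [h.integral_fst' ((h.allMoments_apply l).pow 8)]
    exact (h.integral_apply_pow_le hc l 4).trans_eq (by norm_num [Nat.factorial])
  calc _ ≤ (Tᶜ.card : ℝ)⁻¹ * ∑ _l ∈ Tᶜ, 161280 * (c : ℝ) ^ 4 := by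
        gcongr with l hl; exact h8 l
    _ = (Tᶜ.card : ℝ)⁻¹ * Tᶜ.card * (161280 * (c : ℝ) ^ 4) := by simp [mul_assoc]
    _ ≤ 1 * (161280 * (c : ℝ) ^ 4) := by gcongr; exact inv_mul_le_one
    _ = _ := one_mul _

/-- The deviation of the weighted empirical Gram matrix of the features from its mean. -/
def weightedGramDev {n : ℕ} (π : Measure (Euc k × ℝ)) (T : Finset (Fin k))
    (ω : Fin n → Euc k × ℝ) : ℝ :=
  ∑ o, ∑ o', ((n : ℝ)⁻¹ * ∑ i, offMean T (ω i) * (features T (ω i) o * features T (ω i) o') -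
    ∫ z, offMean T z * (features T z o * features T z o') ∂π) ^ 2

/-- Second moments of the weighted entries reduce, by the arithmetic-geometric mean inequality, to
fourth moments of the weight and eighth moments of the features; `161280 = 4 · 8!`. -/
theorem measure_weightedGramDev_gt_le (h : IsIsotropic μ c) (hc : 0 < c) {n : ℕ} (hn : n ≠ 0) :
    (Measure.pi fun _ : Fin n => μ.prod η) {ω | 1 < weightedGramDev (μ.prod η) T ω} ≤
      ENNReal.ofReal ((n : ℝ)⁻¹ * ((T.card + 1) ^ 2 * (1 + 161280 * (c : ℝ) ^ 4))) := by
  have := h.isProbabilityMeasure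
  have hb : ∀ o o' : Option {l // l ∈ T},
      ∫ z, (offMean T z * (features T z o * features T z o')) ^ 2 ∂(μ.prod η) ≤
        1 + 161280 * (c : ℝ) ^ 4 := by
    intro o o'
    have i1 : ∀ o : Option {l // l ∈ T}, Integrable (fun z => features T z o ^ 8) (μ.prod η) :=
      fun o => ((h.allMoments_features o).pow 8).integrable
    have h1 : ∀ o : Option {l // l ∈ T},
        ∫ z, features T z o ^ 8 ∂(μ.prod η) ≤ 1 + 161280 * (c : ℝ) ^ 4 :=
      fun o => (h.integral_features_pow_le hc o 4).trans_eq (by norm_num [Nat.factorial])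
    have i2 : Integrable (fun z => offMean T z ^ 4) (μ.prod η) :=
      ((h.allMoments_offMean).pow 4).integrable
    have i3 : Integrable (fun z => features T z o ^ 8 + features T z o' ^ 8) (μ.prod η) :=
      (i1 o).add (i1 o')
    refine (integral_mono (((h.allMoments_offMean (T := T)).mul ((h.allMoments_features o).mul
      (h.allMoments_features o'))).pow 2).integrable
      ((i2.const_mul (1 / 2)).add (i3.const_mul (1 / 4))) fun z => ?_).trans ?_
    · simp only [Pi.add_apply]
      generalize offMean T z = r
      generalize features T z o = a
      generalize features T z o' = b
      nlinarith [sq_nonneg (r ^ 2 - (a * b) ^ 2), sq_nonneg (a ^ 4 - b ^ 4)]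
    · simp only [Pi.add_apply]
      rw [integral_add (i2.const_mul _) (i3.const_mul _), integral_const_mul, integral_const_mul,
        integral_add (i1 o) (i1 o')]
      linarith [h1 o, h1 o', h.integral_offMean_pow_four_le (η := η) (T := T) hc]
  have h1 := measure_sum_sq_sample_mean_gt_le (μ := μ.prod η) hn
    (Finset.univ : Finset (Option {l // l ∈ T} × Option {l // l ∈ T}))
    (f := fun a z => offMean T z * (features T z a.1 * features T z a.2))
    (C := (T.card + 1) ^ 2 * (1 + 161280 * (c : ℝ) ^ 4)) (t := 1)
    (fun a _ => (h.allMoments_offMean.mul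
      ((h.allMoments_features a.1).mul (h.allMoments_features a.2))).memLp_two)
    ((Finset.sum_le_sum fun a _ => hb a.1 a.2).trans_eq
      (by simp [Fintype.card_option]; ring)) one_pos
  simp_rw [Fintype.sum_prod_type, div_one] at h1
  exact h1

theorem sum_mul_features (t : Option {l // l ∈ T} → ℝ) (z : Euc k × ℝ) :
    ∑ o, t o * features T z o =
      t none + inner ℝ (∑ l : {l // l ∈ T}, t (some l) • EuclideanSpace.single (l : Fin k) (1 : ℝ)) z.1 := by
  rw [Fintype.sum_option, sum_inner]
  simp [features, withIntercept, inner_smul_left, EuclideanSpace.inner_single_left]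

theorem norm_sum_smul_single_sq (t : {l // l ∈ T} → ℝ) :
    ‖∑ l : {l // l ∈ T}, t l • EuclideanSpace.single (l : Fin k) (1 : ℝ)‖ ^ 2 = ∑ l, t l ^ 2 := by
  rw [← real_inner_self_eq_norm_sq, sum_inner]
  simp_rw [inner_sum, inner_smul_left, inner_smul_right, EuclideanSpace.inner_single_left]
  refine Finset.sum_congr rfl fun l _ => ?_
  rw [Finset.sum_eq_single l]
  · simp [sq]
  · intro m _ hm
    have : (l : Fin k) ≠ m := fun h => hm (Subtype.ext h.symm)
    simp [this]
  · simp

/-- The weighted population Gram matrix has operator norm bounded independently of the dimension: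
for each coordinate off `T` the claim is a mixed fourth moment of two functionals. -/
theorem integral_offMean_mul_features_sq_le (h : IsIsotropic μ c) (hc : 0 < c)
    (t : Option {l // l ∈ T} → ℝ) :
    ∫ z, offMean T z * (∑ o, t o * features T z o) ^ 2 ∂(μ.prod η) ≤
      (2 + 192 * (c : ℝ) ^ 2) * ∑ o, t o ^ 2 := by
  have := h.isProbabilityMeasure
  have hm : AllMoments (fun z => (∑ o, t o * features T z o) ^ 2) (μ.prod η) :=
    (AllMoments.sum _ fun o _ => (h.allMoments_features o).const_mul _).pow 2
  refine h.integral_offMean_mul_le hm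
    (mul_nonneg (by positivity) (Finset.sum_nonneg fun _ _ => sq_nonneg _)) fun l _ => ?_
  set a := ∑ l : {l // l ∈ T}, t (some l) • EuclideanSpace.single (l : Fin k) (1 : ℝ) with ha
  have hna : ‖a‖ ^ 2 = ∑ l, t (some l) ^ 2 := norm_sum_smul_single_sq _
  have hx : ∀ z : Euc k × ℝ, z.1 l = inner ℝ (EuclideanSpace.single l (1 : ℝ)) z.1 := fun z => by
    simp [EuclideanSpace.inner_single_left]
  simp_rw [sum_mul_features, ← ha]
  have m1 : AllMoments (fun w : Euc k => w l ^ 2) μ := (h.allMoments_apply l).pow 2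
  have m2 : AllMoments (fun w : Euc k => w l ^ 2 * inner ℝ a w ^ 2) μ :=
    m1.mul ((h.allMoments_inner a).pow 2)
  have hle : ∀ w : Euc k, w l ^ 2 * (t none + inner ℝ a w) ^ 2 ≤
      2 * t none ^ 2 * w l ^ 2 + 2 * (w l ^ 2 * inner ℝ a w ^ 2) := by
    intro w
    nlinarith [mul_nonneg (sq_nonneg (w l)) (sq_nonneg (t none - inner ℝ a w))]
  have m3 : AllMoments (fun w : Euc k => w l ^ 2 * (t none + inner ℝ a w) ^ 2) μ :=
    m1.mul (((AllMoments.const _).add (h.allMoments_inner a)).pow 2)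
  rw [h.integral_fst' m3]
  refine (integral_mono m3.integrable
    ((m1.const_mul _).integrable.add (m2.const_mul 2).integrable) hle).trans ?_
  simp only [Pi.add_apply]
  rw [integral_add (m1.const_mul _).integrable (m2.const_mul 2).integrable, integral_const_mul,
    integral_const_mul, h.integral_apply_sq, Fintype.sum_option, ← hna]
  have h1 := h.integral_inner_sq_mul_inner_sq_le hc (EuclideanSpace.single l 1) a
  simp only [EuclideanSpace.inner_single_left, map_one, one_mul, PiLp.norm_single,
    norm_one, one_pow] at h1
  nlinarith [sq_nonneg ‖a‖, sq_nonneg (t none), mul_nonneg (sq_nonneg (c : ℝ)) (sq_nonneg (t none))]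

/-- Uniform bound for the weighted empirical second moments of the features. -/
theorem sample_offMean_mul_features_sq_le (h : IsIsotropic μ c) (hc : 0 < c) {n : ℕ}
    {ω : Fin n → Euc k × ℝ} (hω : weightedGramDev (μ.prod η) T ω ≤ 1)
    (t : Option {l // l ∈ T} → ℝ) :
    (n : ℝ)⁻¹ * ∑ i, offMean T (ω i) * (∑ o, t o * features T (ω i) o) ^ 2 ≤
      (3 + 192 * (c : ℝ) ^ 2) * ∑ o, t o ^ 2 := by
  have := h.isProbabilityMeasure
  have h1 := sum_mul_mul_le_sqrt (fun o o' => (n : ℝ)⁻¹ *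
    ∑ i, offMean T (ω i) * (features T (ω i) o * features T (ω i) o') -
    ∫ z, offMean T z * (features T z o * features T z o') ∂(μ.prod η)) t
  have hs : √(weightedGramDev (μ.prod η) T ω) ≤ 1 := by
    rw [Real.sqrt_le_one]; exact hω
  have hexp : ∀ z : Euc k × ℝ, offMean T z * (∑ o, t o * features T z o) ^ 2 =
      ∑ o, ∑ o', t o * t o' * (offMean T z * (features T z o * features T z o')) := by
    intro z
    rw [sq, Finset.sum_mul_sum, Finset.mul_sum]
    refine Finset.sum_congr rfl fun o _ => ?_
    rw [Finset.mul_sum]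
    exact Finset.sum_congr rfl fun o' _ => by ring
  have i1 : ∀ o o' : Option {l // l ∈ T}, Integrable
      (fun z => t o * t o' * (offMean T z * (features T z o * features T z o'))) (μ.prod η) :=
    fun o o' => ((h.allMoments_offMean.mul
      ((h.allMoments_features o).mul (h.allMoments_features o'))).const_mul _).integrable
  have h2 := h.integral_offMean_mul_features_sq_le (η := η) hc t
  simp_rw [hexp] at h2 ⊢
  rw [integral_finsetSum _ fun o _ => integrable_finsetSum _ fun o' _ => i1 o o'] at h2
  simp_rw [integral_finsetSum _ fun o' _ => i1 _ o', integral_const_mul] at h2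
  have h3 : (n : ℝ)⁻¹ * ∑ i, ∑ o, ∑ o', t o * t o' *
      (offMean T (ω i) * (features T (ω i) o * features T (ω i) o')) =
      ∑ o, ∑ o', t o * t o' * ((n : ℝ)⁻¹ *
        ∑ i, offMean T (ω i) * (features T (ω i) o * features T (ω i) o')) := by
    rw [Finset.sum_comm, Finset.mul_sum]
    refine Finset.sum_congr rfl fun o _ => ?_
    rw [Finset.sum_comm, Finset.mul_sum]
    refine Finset.sum_congr rfl fun o' _ => ?_
    rw [← Finset.mul_sum]; ring
  simp_rw [mul_sub, Finset.sum_sub_distrib] at h1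
  rw [h3]
  have h4 : √(weightedGramDev (μ.prod η) T ω) * ∑ o, t o ^ 2 ≤ 1 * ∑ o, t o ^ 2 :=
    mul_le_mul_of_nonneg_right hs (Finset.sum_nonneg fun _ _ => sq_nonneg _)
  have h5 := h1.trans h4
  linarith

end IsIsotropic

/-! ### Moments of the effective noise -/

theorem noise_neg {k : ℕ} (Q : Matrix (Fin k) (Fin k) ℝ) (z : Euc k × ℝ) :
    noise Q (-z.1, z.2) = noise Q z := by
  simp [noise, IsIsotropic.centeredForm_neg]

theorem noise_congr {k : ℕ} {Q : Matrix (Fin k) (Fin k) ℝ} {T : Finset (Fin k)}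
    (hQ : Q.IsHermitian) (hQT : ∀ l, ∀ m ∉ T, Q l m = 0) {w w' : Euc k} (hw : ∀ l ∈ T, w l = w' l)
    (e : ℝ) : noise Q (w, e) = noise Q (w', e) := by
  simp [noise, IsIsotropic.centeredForm_congr hQ hQT hw]

theorem measurable_noise {k : ℕ} (Q : Matrix (Fin k) (Fin k) ℝ) : Measurable (noise Q) := by
  unfold noise IsIsotropic.centeredForm
  simp only [dotProduct, Matrix.mulVec]
  fun_prop

namespace IsIsotropic

variable {k : ℕ} {μ : Measure (Euc k)} {c ce : ℝ≥0} {η : Measure ℝ} [IsProbabilityMeasure η]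
  {T : Finset (Fin k)} {Q : Matrix (Fin k) (Fin k) ℝ}

theorem allMoments_noise (h : IsIsotropic μ c) (hη : HasSubgaussianMGF (fun e : ℝ => e) ce η) :
    AllMoments (noise Q) (μ.prod η) :=
  (h.allMoments_fst (h.allMoments_centeredForm Q)).add (h.allMoments_snd hη.allMoments)

theorem integral_noise (h : IsIsotropic μ c) (hη : HasSubgaussianMGF (fun e : ℝ => e) ce η) :
    ∫ z, noise Q z ∂(μ.prod η) = 0 := by
  have i1 := (h.allMoments_fst (η := η) (h.allMoments_centeredForm Q)).integrable
  have i2 := (h.allMoments_snd hη.allMoments).integrable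
  simp only [noise]
  rw [integral_add i1 i2, h.integral_fst' (h.allMoments_centeredForm Q),
    h.integral_snd' hη.allMoments, h.integral_centeredForm, integral_eq_zero_of_subgaussian hη,
    add_zero]

theorem measurePreserving_neg_fst (h : IsIsotropic μ c) :
    MeasurePreserving (fun z : Euc k × ℝ => (-z.1, z.2)) (μ.prod η) (μ.prod η) :=
  have := h.isProbabilityMeasure
  (h.measurePreserving (LinearIsometryEquiv.neg ℝ)).prod (MeasurePreserving.id η)

/-- The noise is even and the coordinate odd under `w ↦ -w`. Hence the nonlinear effect does not
bias the linear regression. -/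
theorem integral_noise_mul_apply (h : IsIsotropic μ c)
    (hη : HasSubgaussianMGF (fun e : ℝ => e) ce η) (l : Fin k) :
    ∫ z, noise Q z * z.1 l ∂(μ.prod η) = 0 := by
  have hN := h.measurePreserving_neg_fst (η := η)
  have hm : AllMoments (fun z : Euc k × ℝ => noise Q z * z.1 l) (μ.prod η) :=
    (h.allMoments_noise hη).mul (h.allMoments_fst (h.allMoments_apply l))
  have h1 := integral_map (μ := μ.prod η) hN.measurable.aemeasurable
    (f := fun z : Euc k × ℝ => noise Q z * z.1 l)
    (by rw [hN.map_eq]; exact hm.integrable.aestronglyMeasurable)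
  rw [hN.map_eq] at h1
  simp only [noise_neg, PiLp.neg_apply, mul_neg, integral_neg] at h1
  linarith

theorem integral_noise_mul_features (h : IsIsotropic μ c)
    (hη : HasSubgaussianMGF (fun e : ℝ => e) ce η) (o : Option {l // l ∈ T}) :
    ∫ z, noise Q z * features T z o ∂(μ.prod η) = 0 := by
  cases o with
  | none => simpa [features, withIntercept] using h.integral_noise hη
  | some l => exact h.integral_noise_mul_apply hη l

/-- A weight that is harmless relative to the quadratic part, and bounded in mean, is harmless for
the whole noise: the error part factorizes by independence. -/
theorem integral_mul_noise_sq_le (h : IsIsotropic μ c)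
    (hη : HasSubgaussianMGF (fun e : ℝ => e) ce η) {f : Euc k → ℝ} (hf : AllMoments f μ)
    (hf0 : ∀ w, 0 ≤ f w) {K D : ℝ} (hK : 0 ≤ K) (h1 : ∫ w, f w ∂μ ≤ K)
    (h2 : ∫ w, f w * centeredForm Q w ^ 2 ∂μ ≤ K * ∫ w, centeredForm Q w ^ 2 ∂μ)
    (hD : ∫ w, centeredForm Q w ^ 2 ∂μ + ∫ e, e ^ 2 ∂η ≤ D) :
    ∫ z, f z.1 * noise Q z ^ 2 ∂(μ.prod η) ≤ 2 * K * D := by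
  have := h.isProbabilityMeasure
  have m1 : AllMoments (fun w => f w * centeredForm Q w ^ 2) μ :=
    hf.mul ((h.allMoments_centeredForm Q).pow 2)
  have m2 : AllMoments (fun e : ℝ => e ^ 2) η := hη.allMoments.pow 2
  have i1 : Integrable (fun z : Euc k × ℝ => 2 * (f z.1 * centeredForm Q z.1 ^ 2)) (μ.prod η) :=
    ((h.allMoments_fst m1).const_mul 2).integrable
  have i2 : Integrable (fun z : Euc k × ℝ => 2 * (f z.1 * z.2 ^ 2)) (μ.prod η) :=
    (((h.allMoments_fst hf).mul (h.allMoments_snd m2)).const_mul 2).integrable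
  refine (integral_mono ((h.allMoments_fst hf).mul ((h.allMoments_noise hη).pow 2)).integrable
    (i1.add i2) fun z => ?_).trans ?_
  · simp only [Pi.add_apply, noise]
    nlinarith [mul_nonneg (hf0 z.1) (sq_nonneg (centeredForm Q z.1 - z.2))]
  · simp only [Pi.add_apply]
    rw [integral_add i1 i2, integral_const_mul, integral_const_mul, h.integral_fst' m1,
      integral_prod_mul (μ := μ) (ν := η) f (fun e => e ^ 2)]
    have h3 : 0 ≤ ∫ e, e ^ 2 ∂η := integral_nonneg fun e => sq_nonneg e
    have h4 : (∫ w, f w ∂μ) * ∫ e, e ^ 2 ∂η ≤ K * ∫ e, e ^ 2 ∂η :=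
      mul_le_mul_of_nonneg_right h1 h3
    nlinarith [mul_le_mul_of_nonneg_left hD hK]

/-- Relative second moment bounds for the noise against the coordinates. -/
theorem integral_apply_sq_mul_noise_sq_le (h : IsIsotropic μ c) (hc : 0 < c)
    (hη : HasSubgaussianMGF (fun e : ℝ => e) ce η) (hQ : Q.IsHermitian) (hQ0 : Q.det = 0) {D : ℝ}
    (hD : ∫ w, centeredForm Q w ^ 2 ∂μ + ∫ e, e ^ 2 ∂η ≤ D) (l : Fin k) :
    ∫ z, z.1 l ^ 2 * noise Q z ^ 2 ∂(μ.prod η) ≤ 2 * (60000 * (c : ℝ) ^ 3 + 16 * c + 1) * D := by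
  have := h.isProbabilityMeasure
  have hpos : (0 : ℝ) ≤ 60000 * (c : ℝ) ^ 3 + 16 * c := by positivity
  refine h.integral_mul_noise_sq_le hη (f := fun w => w l ^ 2) ((h.allMoments_apply l).pow 2)
    (fun w => sq_nonneg _) (by positivity) ?_ ?_ hD
  · rw [h.integral_apply_sq]; linarith
  · have h1 := h.integral_inner_sq_mul_centeredForm_sq_le hc hQ hQ0 (EuclideanSpace.single l 1)
    simp only [EuclideanSpace.inner_single_left, map_one, one_mul, PiLp.norm_single,
      norm_one, one_pow, mul_one] at h1
    refine h1.trans (mul_le_mul_of_nonneg_right (by linarith) ?_)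
    exact integral_nonneg fun w => sq_nonneg _

theorem integral_features_sq_mul_noise_sq_le (h : IsIsotropic μ c) (hc : 0 < c)
    (hη : HasSubgaussianMGF (fun e : ℝ => e) ce η) (hQ : Q.IsHermitian) (hQ0 : Q.det = 0) {D : ℝ}
    (hD : ∫ w, centeredForm Q w ^ 2 ∂μ + ∫ e, e ^ 2 ∂η ≤ D) (o : Option {l // l ∈ T}) :
    ∫ z, (noise Q z * features T z o) ^ 2 ∂(μ.prod η) ≤
      2 * (60000 * (c : ℝ) ^ 3 + 16 * c + 1) * D := by
  have := h.isProbabilityMeasure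
  have hpos : (0 : ℝ) ≤ 60000 * (c : ℝ) ^ 3 + 16 * c := by positivity
  cases o with
  | none =>
    have h1 := h.integral_mul_noise_sq_le hη (Q := Q) (f := fun _ => 1) (AllMoments.const 1)
      (fun _ => zero_le_one) (K := 60000 * (c : ℝ) ^ 3 + 16 * c + 1) (by positivity)
      (by simpa using hpos) ?_ hD
    · simpa [features, withIntercept] using h1
    · have h0 : 0 ≤ ∫ w, centeredForm Q w ^ 2 ∂μ := integral_nonneg fun w => sq_nonneg _
      simp only [one_mul]
      nlinarith
  | some l =>
    have h1 := h.integral_apply_sq_mul_noise_sq_le hc hη hQ hQ0 hD l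
    simp only [features, withIntercept, Option.elim]
    simpa only [mul_pow, mul_comm] using h1

theorem measure_offMean_mul_noise_sq_gt_le (h : IsIsotropic μ c) (hc : 0 < c)
    (hη : HasSubgaussianMGF (fun e : ℝ => e) ce η) (hQ : Q.IsHermitian) (hQ0 : Q.det = 0) {D : ℝ}
    (hD : ∫ w, centeredForm Q w ^ 2 ∂μ + ∫ e, e ^ 2 ∂η ≤ D) {n : ℕ} (hn : n ≠ 0) {V : ℝ}
    (hV : 0 < V) :
    (Measure.pi fun _ : Fin n => μ.prod η)
      {ω | V < (n : ℝ)⁻¹ * ∑ i, offMean T (ω i) * noise Q (ω i) ^ 2} ≤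
      ENNReal.ofReal (2 * (60000 * (c : ℝ) ^ 3 + 16 * c + 1) * D / V) := by
  have := h.isProbabilityMeasure
  have hm : AllMoments (fun z => noise Q z ^ 2) (μ.prod η) := (h.allMoments_noise hη).pow 2
  have hD0 : 0 ≤ D := le_trans (add_nonneg (integral_nonneg fun w => sq_nonneg _)
    (integral_nonneg fun e => sq_nonneg e)) hD
  exact measure_sample_mean_gt_le hn (h.allMoments_offMean.mul hm).integrable
    (fun z => mul_nonneg (offMean_nonneg z) (sq_nonneg _))
    (h.integral_offMean_mul_le hm (by positivity)
      fun l _ => h.integral_apply_sq_mul_noise_sq_le hc hη hQ hQ0 hD l) hV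

theorem measure_score_gt_le (h : IsIsotropic μ c)
    (hη : HasSubgaussianMGF (fun e : ℝ => e) ce η) {B : ℝ}
    (hB : ∀ o : Option {l // l ∈ T}, ∫ z, (noise Q z * features T z o) ^ 2 ∂(μ.prod η) ≤ B)
    {n : ℕ} (hn : n ≠ 0) {x : ℝ} (hx : 0 < x) :
    (Measure.pi fun _ : Fin n => μ.prod η)
      {ω | x < ∑ o, ((n : ℝ)⁻¹ * ∑ i, noise Q (ω i) * features T (ω i) o) ^ 2} ≤
      ENNReal.ofReal ((n : ℝ)⁻¹ * ((T.card + 1) * B) / x) := by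
  have := h.isProbabilityMeasure
  have h1 := measure_sum_sq_sample_mean_gt_le (μ := μ.prod η) hn
    (Finset.univ : Finset (Option {l // l ∈ T})) (f := fun o z => noise Q z * features T z o)
    (C := (T.card + 1) * B) (t := x)
    (fun o _ => ((h.allMoments_noise hη).mul (h.allMoments_features o)).memLp_two)
    ((Finset.sum_le_sum fun o _ => hB o).trans_eq (by simp [Fintype.card_option])) hx
  simpa only [h.integral_noise_mul_features hη, sub_zero] using h1

theorem integral_noise_pow_eight_le (h : IsIsotropic μ c)
    (hη : HasSubgaussianMGF (fun e : ℝ => e) ce η) (hce : 0 < ce) :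
    ∫ z, noise Q z ^ 8 ∂(μ.prod η) ≤
      128 * (∫ w, centeredForm Q w ^ 8 ∂μ + 161280 * (ce : ℝ) ^ 4) := by
  have := h.isProbabilityMeasure
  have m1 : AllMoments (fun w => centeredForm Q w ^ 8) μ := (h.allMoments_centeredForm Q).pow 8
  have m2 : AllMoments (fun e : ℝ => e ^ 8) η := hη.allMoments.pow 8
  have i1 := (h.allMoments_fst (η := η) m1).integrable
  have i2 := (h.allMoments_snd m2).integrable
  refine (integral_mono ((h.allMoments_noise hη).pow 8).integrable
    ((i1.add i2).const_mul 128) fun z => ?_).trans ?_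
  · simp only [Pi.add_apply, noise]
    have h1 := add_pow_le (abs_nonneg (centeredForm Q z.1)) (abs_nonneg z.2) 8
    have h2 : (centeredForm Q z.1 + z.2) ^ 8 ≤ (|centeredForm Q z.1| + |z.2|) ^ 8 := by
      rw [← Even.pow_abs (by decide : Even 8)]
      gcongr
      exact abs_add_le _ _
    rw [Even.pow_abs (by decide : Even 8), Even.pow_abs (by decide : Even 8)] at h1
    norm_num at h1
    exact h2.trans h1
  · simp only [Pi.add_apply]
    rw [integral_const_mul, integral_add i1 i2, h.integral_fst' m1, h.integral_snd' m2]
    have h3 := (integral_pow_le_of_subgaussian hce hη 4).trans_eq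
      (by norm_num [Nat.factorial] : _ = 161280 * (ce : ℝ) ^ 4)
    norm_num at h3
    linarith

/-- A cruder bound, absolute instead of relative to `τ² + σ²`, that requires no zero eigenvalue and
so is available even when `T` exhausts all coordinates. The weights in the inequality balance
`noise` against the scale `s`. -/
theorem integral_features_sq_mul_noise_sq_le_card (h : IsIsotropic μ c) (hc : 0 < c)
    (hη : HasSubgaussianMGF (fun e : ℝ => e) ce η) {K s : ℝ} (hs : 0 < s)
    (hK : ∫ z, noise Q z ^ 8 ∂(μ.prod η) ≤ K * s ^ 8) (o : Option {l // l ∈ T}) :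
    ∫ z, (noise Q z * features T z o) ^ 2 ∂(μ.prod η) ≤ (K + 1 + 96 * (c : ℝ) ^ 2) * s ^ 2 := by
  have := h.isProbabilityMeasure
  have hK0 : 0 ≤ K := by
    have h0 : (0 : ℝ) ≤ ∫ z, noise Q z ^ 8 ∂(μ.prod η) :=
      integral_nonneg fun z => (by decide : Even 8).pow_nonneg _
    exact nonneg_of_mul_nonneg_left (h0.trans hK) (by positivity)
  have i1 : Integrable (fun z => (s ^ 6)⁻¹ / 4 * noise Q z ^ 8) (μ.prod η) :=
    (((h.allMoments_noise hη).pow 8).const_mul _).integrable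
  have i2 : Integrable (fun z => s ^ 2 / 2 * features T z o ^ 4) (μ.prod η) :=
    (((h.allMoments_features o).pow 4).const_mul _).integrable
  have i3 : Integrable (fun z => s ^ 2 / 2 * features T z o ^ 4 + s ^ 2 / 4) (μ.prod η) :=
    i2.add (integrable_const _)
  refine (integral_mono (((h.allMoments_noise hη).mul (h.allMoments_features o)).pow 2).integrable
    (i1.add i3) fun z => ?_).trans ?_
  · simp only [Pi.add_apply]
    generalize noise Q z = a
    generalize features T z o = b
    have e : (s ^ 6)⁻¹ / 4 * a ^ 8 + (s ^ 2 / 2 * b ^ 4 + s ^ 2 / 4) - (a * b) ^ 2 =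
        ((a ^ 2 - s ^ 2 * b ^ 2) ^ 2 / (2 * s ^ 2)) + (a ^ 4 - s ^ 4) ^ 2 / (4 * s ^ 6) := by
      field_simp; ring
    have : 0 ≤ ((a ^ 2 - s ^ 2 * b ^ 2) ^ 2 / (2 * s ^ 2)) + (a ^ 4 - s ^ 4) ^ 2 / (4 * s ^ 6) := by
      positivity
    linarith
  · simp only [Pi.add_apply]
    rw [integral_add i1 i3, integral_add i2 (integrable_const _), integral_const_mul,
      integral_const_mul]
    simp only [integral_const, probReal_univ, one_smul]
    have h4 : ∫ z, features T z o ^ 4 ∂(μ.prod η) ≤ 1 + 96 * (c : ℝ) ^ 2 :=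
      (h.integral_features_pow_le hc o 2).trans_eq (by norm_num [Nat.factorial])
    have h5 : (s ^ 6)⁻¹ / 4 * ∫ z, noise Q z ^ 8 ∂(μ.prod η) ≤ K * s ^ 2 / 4 := by
      calc _ ≤ (s ^ 6)⁻¹ / 4 * (K * s ^ 8) := by gcongr
        _ = _ := by field_simp
    have h6 : s ^ 2 / 2 * ∫ z, features T z o ^ 4 ∂(μ.prod η) ≤
        s ^ 2 / 2 * (1 + 96 * (c : ℝ) ^ 2) := by gcongr
    nlinarith [mul_nonneg hK0 (sq_nonneg s), sq_nonneg s,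
      mul_nonneg (sq_nonneg (c : ℝ)) (sq_nonneg s)]

/-- The empirical second moment of the noise against a linear functional. -/
theorem measure_noise_sq_mul_inner_sq_gt_le (h : IsIsotropic μ c) (hc : 0 < c)
    (hη : HasSubgaussianMGF (fun e : ℝ => e) ce η) {K s : ℝ} (hs : 0 < s)
    (hK : ∫ z, noise Q z ^ 8 ∂(μ.prod η) ≤ K * s ^ 8) {g : Euc k} {G : ℝ} (hg : ‖g‖ ^ 2 ≤ G)
    {n : ℕ} (hn : n ≠ 0) :
    (Measure.pi fun _ : Fin n => μ.prod η)
      {ω | 2 * ((K + 161280 * ((c : ℝ) * G) ^ 4 + 1) * s ^ 2) <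
        (n : ℝ)⁻¹ * ∑ i, (noise Q (ω i) * inner ℝ g (ω i).1) ^ 2} ≤
      ENNReal.ofReal (n : ℝ)⁻¹ := by
  have := h.isProbabilityMeasure
  have hG : 0 ≤ G := (sq_nonneg _).trans hg
  have hK0 : 0 ≤ K := by
    have h0 : (0 : ℝ) ≤ ∫ z, noise Q z ^ 8 ∂(μ.prod η) :=
      integral_nonneg fun z => (by decide : Even 8).pow_nonneg _
    exact nonneg_of_mul_nonneg_left (h0.trans hK) (by positivity)
  have m1 : AllMoments (fun z : Euc k × ℝ => (inner ℝ g z.1 : ℝ)) (μ.prod η) :=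
    h.allMoments_fst (h.allMoments_inner g)
  have m2 : AllMoments (fun z => (noise Q z * inner ℝ g z.1) ^ 2) (μ.prod η) :=
    ((h.allMoments_noise hη).mul m1).pow 2
  refine measure_sample_mean_gt_two_mul_le hn m2.memLp_two (by positivity) ?_
  have i1 : Integrable (fun z => (s ^ 4)⁻¹ / 2 * noise Q z ^ 8) (μ.prod η) :=
    (((h.allMoments_noise hη).pow 8).const_mul _).integrable
  have i2 : Integrable (fun z : Euc k × ℝ => s ^ 4 / 2 * (inner ℝ g z.1 : ℝ) ^ 8) (μ.prod η) :=
    ((m1.pow 8).const_mul _).integrable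
  -- The second moment obtained is `D s⁴`; `D ≥ 1` lets it be replaced by `(D s²)²`, the square
  -- required of the threshold.
  have hD : 1 ≤ K + 161280 * ((c : ℝ) * G) ^ 4 + 1 := by
    have : 0 ≤ 161280 * ((c : ℝ) * G) ^ 4 := by positivity
    linarith
  have hb : ∫ z, ((noise Q z * inner ℝ g z.1) ^ 2) ^ 2 ∂(μ.prod η) ≤
      (K + 161280 * ((c : ℝ) * G) ^ 4 + 1) * s ^ 4 := by
    refine (integral_mono (m2.pow 2).integrable (i1.add i2) fun z => ?_).trans ?_
    · simp only [Pi.add_apply]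
      generalize noise Q z = a
      generalize (inner ℝ g z.1 : ℝ) = b
      have e : (s ^ 4)⁻¹ / 2 * a ^ 8 + s ^ 4 / 2 * b ^ 8 - ((a * b) ^ 2) ^ 2 =
          (a ^ 4 - s ^ 4 * b ^ 4) ^ 2 / (2 * s ^ 4) := by
        field_simp; ring
      have : 0 ≤ (a ^ 4 - s ^ 4 * b ^ 4) ^ 2 / (2 * s ^ 4) := by positivity
      linarith
    · simp only [Pi.add_apply]
      rw [integral_add i1 i2, integral_const_mul, integral_const_mul,
        h.integral_fst' ((h.allMoments_inner g).pow 8)]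
      have h4 : ∫ w, (inner ℝ g w : ℝ) ^ 8 ∂μ ≤ 161280 * ((c : ℝ) * G) ^ 4 := by
        refine (h.integral_inner_pow_le hc (a := g) 4).trans ?_
        norm_num [Nat.factorial]
        gcongr
      have h5 : (s ^ 4)⁻¹ / 2 * ∫ z, noise Q z ^ 8 ∂(μ.prod η) ≤ K * s ^ 4 / 2 := by
        calc _ ≤ (s ^ 4)⁻¹ / 2 * (K * s ^ 8) := by gcongr
          _ = _ := by field_simp
      have h6 : s ^ 4 / 2 * ∫ w, (inner ℝ g w : ℝ) ^ 8 ∂μ ≤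
          s ^ 4 / 2 * (161280 * ((c : ℝ) * G) ^ 4) := by gcongr
      have h7 : 0 ≤ 161280 * ((c : ℝ) * G) ^ 4 := by positivity
      nlinarith [mul_nonneg hK0 (by positivity : 0 ≤ s ^ 4), mul_nonneg h7 (by positivity : 0 ≤ s ^ 4),
        (by positivity : 0 < s ^ 4)]
  refine hb.trans ?_
  generalize K + 161280 * ((c : ℝ) * G) ^ 4 + 1 = D at hD
  nlinarith [(by positivity : 0 < s ^ 4), mul_nonneg (sub_nonneg.2 hD) (mul_nonneg (zero_le_one.trans hD) (by positivity : 0 ≤ s ^ 4))]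

end IsIsotropic

/-! ### Sign flips and conditional tail bounds -/

/-- The isometry changing the signs of the coordinates where `s` is false. -/
def signFlip {k : ℕ} (s : Fin k → Bool) : Euc k ≃ₗᵢ[ℝ] Euc k :=
  LinearIsometryEquiv.piLpCongrRight 2 fun l =>
    if s l then LinearIsometryEquiv.refl ℝ ℝ else LinearIsometryEquiv.neg ℝ

theorem signFlip_apply {k : ℕ} (s : Fin k → Bool) (w : Euc k) (l : Fin k) :
    signFlip s w l = (if s l then 1 else -1) * w l := by
  simp only [signFlip, LinearIsometryEquiv.piLpCongrRight_apply]
  cases s l <;> simp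

theorem setLIntegral_eq_lintegral_indicator_mul {Ω : Type*} [MeasurableSpace Ω] {μ : Measure Ω}
    {E : Set Ω} (hE : MeasurableSet E) (f : Ω → ℝ≥0∞) :
    ∫⁻ ω in E, f ω ∂μ = ∫⁻ ω, E.indicator 1 ω * f ω ∂μ := by
  rw [← lintegral_indicator hE]
  refine lintegral_congr fun ω => ?_
  by_cases hω : ω ∈ E <;> simp [hω]

theorem indicator_mul_le_indicator_mul {Ω : Type*} {E : Set Ω} {f g : Ω → ℝ≥0∞}
    (h : ∀ ω ∈ E, f ω ≤ g ω) (ω : Ω) :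
    E.indicator 1 ω * f ω ≤ E.indicator (1 : Ω → ℝ≥0∞) ω * g ω := by
  by_cases hω : ω ∈ E
  · simpa [hω] using h ω hω
  · simp [hω]

namespace IsIsotropic

variable {k : ℕ} {μ : Measure (Euc k)} {c : ℝ≥0} {η : Measure ℝ} [IsProbabilityMeasure η]
  {T : Finset (Fin k)} {Q : Matrix (Fin k) (Fin k) ℝ} {n : ℕ}

theorem measurePreserving_sample (h : IsIsotropic μ c) (L : Fin n → Euc k ≃ₗᵢ[ℝ] Euc k) :
    MeasurePreserving (fun (ω : Fin n → Euc k × ℝ) i => (L i (ω i).1, (ω i).2))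
      (Measure.pi fun _ : Fin n => μ.prod η) (Measure.pi fun _ : Fin n => μ.prod η) := by
  have := h.isProbabilityMeasure
  exact measurePreserving_pi (fun _ : Fin n => μ.prod η) (fun _ : Fin n => μ.prod η)
    fun i => (h.measurePreserving (L i)).prod (MeasurePreserving.id η)

/-- Two samples agree in the coordinates in `T`, in the average squared coordinate off `T` and in
the errors. -/
def AgreeOn (T : Finset (Fin k)) (z z' : Euc k × ℝ) : Prop :=
  (∀ l ∈ T, z.1 l = z'.1 l) ∧ offMean T z = offMean T z' ∧ z.2 = z'.2

/-- The total norm and the part on `T` are preserved, hence so is the part off `T`. -/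
theorem agreeOn_of_isometry {L : Euc k ≃ₗᵢ[ℝ] Euc k}
    (hL : ∀ l ∈ T, ∀ w, L w l = w l) (z : Euc k × ℝ) : AgreeOn T (L z.1, z.2) z := by
  refine ⟨fun l hl => hL l hl _, ?_, rfl⟩
  simp only [offMean]
  congr 1
  have h1 := EuclideanSpace.real_norm_sq_eq (L z.1)
  have h2 := EuclideanSpace.real_norm_sq_eq z.1
  rw [L.norm_map, h2, ← Finset.sum_add_sum_compl T, ← Finset.sum_add_sum_compl T] at h1
  have h3 : ∑ l ∈ T, (L z.1) l ^ 2 = ∑ l ∈ T, z.1 l ^ 2 :=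
    Finset.sum_congr rfl fun l hl => by rw [hL l hl]
  linarith

/-- Conditionally on the coordinates in `T`, the errors and the average squared coordinates off
`T`, linear functionals of the coordinates off `T` are sub-Gaussian. -/
theorem lintegral_exp_sum_mul_inner_le (h : IsIsotropic μ c) {f : Euc k}
    (hf : ∀ l ∈ T, f l = 0) {u : Euc k × ℝ → ℝ} (hum : Measurable u)
    (hu : ∀ z z', AgreeOn T z z' → u z = u z') {F : (Fin n → Euc k × ℝ) → ℝ≥0∞}
    (hFm : Measurable F) (hF : ∀ ω ω', (∀ i, AgreeOn T (ω i) (ω' i)) → F ω = F ω') :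
    ∫⁻ ω, F ω * ENNReal.ofReal (Real.exp (∑ i, u (ω i) * inner ℝ f (ω i).1))
        ∂(Measure.pi fun _ : Fin n => μ.prod η) ≤
      ∫⁻ ω, F ω * ENNReal.ofReal (Real.exp (‖f‖ ^ 2 * (∑ i, u (ω i) ^ 2 * offMean T (ω i)) / 2))
        ∂(Measure.pi fun _ : Fin n => μ.prod η) := by
  classical
  have := h.isProbabilityMeasure
  by_cases hK : Tᶜ.card = 0
  · have hf0 : f = 0 := by
      ext l
      refine hf l ?_
      by_contra hl
      have : l ∈ Tᶜ := by simpa using hl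
      rw [Finset.card_eq_zero] at hK
      simp [hK] at this
    simp [hf0]
  have hK' : (0 : ℝ) < Tᶜ.card := by exact_mod_cast Nat.pos_of_ne_zero hK
  -- A reflection fixing `T` replaces `f` by the flat vector of the same norm off `T`. Its squared
  -- summands add up to `‖f‖²` times `offMean`, a quantity among those conditioned on, which would
  -- fail for a general `f`.
  set α : ℝ := ‖f‖ / √(Tᶜ.card : ℝ) with hα
  have hα2 : α ^ 2 = ‖f‖ ^ 2 * (Tᶜ.card : ℝ)⁻¹ := by
    rw [hα, div_pow, Real.sq_sqrt hK'.le, div_eq_mul_inv]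
  set v : Euc k := WithLp.toLp 2 fun l => if l ∈ T then 0 else α with hv
  have hvl : ∀ l, v l = if l ∈ T then 0 else α := fun l => rfl
  have hvn : ‖f‖ = ‖v‖ := by
    have h1 : ‖v‖ ^ 2 = ‖f‖ ^ 2 := by
      rw [EuclideanSpace.real_norm_sq_eq, ← Finset.sum_add_sum_compl T,
        Finset.sum_eq_zero (s := T) (fun l hl => by simp [hvl, hl]),
        Finset.sum_congr rfl (s₁ := Tᶜ) (g := fun _ => α ^ 2)
          (fun l hl => by rw [hvl, if_neg (by simpa using hl)])]
      rw [Finset.sum_const, nsmul_eq_mul, hα2]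
      field_simp
      simp
    exact (sq_eq_sq₀ (norm_nonneg _) (norm_nonneg _)).1 h1.symm
  obtain ⟨L, hLf, hLv, hLx⟩ := exists_isometry_swap hvn
  have hLT : ∀ l ∈ T, ∀ w, L w l = w l := by
    intro l hl w
    have h1 : L (EuclideanSpace.single l 1) = EuclideanSpace.single l (1 : ℝ) := hLx _ (by
      simp [EuclideanSpace.inner_single_left, hf l hl, hvl, hl])
    have h2 := L.inner_map_map (EuclideanSpace.single l (1 : ℝ)) w
    rw [h1] at h2
    simpa [EuclideanSpace.inner_single_left] using h2
  have hrot : ∫⁻ ω, F ω * ENNReal.ofReal (Real.exp (∑ i, u (ω i) * inner ℝ f (ω i).1))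
        ∂(Measure.pi fun _ : Fin n => μ.prod η) =
      ∫⁻ ω, F ω * ENNReal.ofReal (Real.exp (∑ i, u (ω i) * inner ℝ v (ω i).1))
        ∂(Measure.pi fun _ : Fin n => μ.prod η) := by
    have hM := h.measurePreserving_sample (η := η) fun _ : Fin n => L
    have hm : Measurable fun ω : Fin n → Euc k × ℝ =>
        F ω * ENNReal.ofReal (Real.exp (∑ i, u (ω i) * inner ℝ v (ω i).1)) := by
      fun_prop
    rw [← hM.lintegral_comp hm]
    refine lintegral_congr fun ω => ?_
    have hag : ∀ i, AgreeOn T (L (ω i).1, (ω i).2) (ω i) := fun i => agreeOn_of_isometry hLT _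
    rw [hF _ ω hag]
    simp_rw [hu _ _ (hag _), ← hLf, L.inner_map_map]
  rw [hrot]
  -- Each coordinate off `T` of each observation is flipped separately. The signs on `T` are kept,
  -- so the weight `u` and the factor `F` are unchanged.
  let Y : Fin n × {l // l ∉ T} → (Fin n → Euc k × ℝ) → ℝ := fun x ω =>
    u (ω x.1) * (α * (ω x.1).1 x.2)
  let σ : (Fin n × {l // l ∉ T} → Bool) → Fin n → Fin k → Bool := fun ξ i l =>
    if hl : l ∉ T then ξ (i, ⟨l, hl⟩) else true
  have hσT : ∀ ξ i, ∀ l ∈ T, ∀ w, signFlip (σ ξ i) w l = w l := fun ξ i l hl w => by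
    simp [signFlip_apply, σ, hl]
  have hag : ∀ ξ (ω : Fin n → Euc k × ℝ) i,
      AgreeOn T (signFlip (σ ξ i) (ω i).1, (ω i).2) (ω i) :=
    fun ξ ω i => agreeOn_of_isometry (hσT ξ i) _
  have key := lintegral_mul_exp_sum_le_of_flips
    (μ := Measure.pi fun _ : Fin n => μ.prod η)
    (fun ξ (ω : Fin n → Euc k × ℝ) i => (signFlip (σ ξ i) (ω i).1, (ω i).2))
    (fun ξ => h.measurePreserving_sample fun i => signFlip (σ ξ i)) hFm
    (fun ξ ω => hF _ _ fun i => hag ξ ω i) (Y := Y)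
    (fun x => by simp only [Y]; fun_prop)
    (fun ξ x ω => by
      have h1 : σ ξ x.1 x.2 = ξ x := by simp [σ, x.2.2]
      simp only [Y]
      rw [hu _ _ (hag ξ ω x.1), signFlip_apply, h1]
      ring)
  have e1 : ∀ ω, ∑ x, Y x ω = ∑ i, u (ω i) * inner ℝ v (ω i).1 := by
    intro ω
    rw [Fintype.sum_prod_type]
    refine Finset.sum_congr rfl fun i _ => ?_
    simp only [Y, ← Finset.mul_sum]
    congr 1
    rw [PiLp.inner_apply, ← Finset.sum_add_sum_compl T,
      Finset.sum_eq_zero (s := T) (fun l hl => by simp [hvl, hl]), zero_add,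
      Finset.sum_subtype Tᶜ (p := fun l => l ∉ T) (fun l => by simp), Finset.mul_sum]
    refine Finset.sum_congr rfl fun l _ => ?_
    simp [hvl, l.2, mul_comm]
  have e2 : ∀ ω, ∑ x, Y x ω ^ 2 = ‖f‖ ^ 2 * ∑ i, u (ω i) ^ 2 * offMean T (ω i) := by
    intro ω
    rw [Fintype.sum_prod_type, Finset.mul_sum]
    refine Finset.sum_congr rfl fun i _ => ?_
    simp only [Y, mul_pow, ← Finset.mul_sum, offMean]
    rw [hα2, Finset.sum_subtype Tᶜ (p := fun l => l ∉ T) (fun l => by simp)]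
    ring
  simp_rw [e1, e2] at key
  exact key

theorem measurable_weightedGramDev (π : Measure (Euc k × ℝ)) :
    Measurable (weightedGramDev (n := n) π T) := by
  have h1 := measurable_features (T := T)
  have h2 := measurable_offMean (T := T)
  unfold weightedGramDev
  fun_prop

theorem features_congr {z z' : Euc k × ℝ} (h : AgreeOn T z z') : features T z = features T z' := by
  ext o
  cases o with
  | none => rfl
  | some l => exact h.1 l l.2

theorem noise_agreeOn (hQ : Q.IsHermitian) (hQT : ∀ l, ∀ m ∉ T, Q l m = 0) {z z' : Euc k × ℝ}
    (h : AgreeOn T z z') : noise Q z = noise Q z' := by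
  obtain ⟨w, e⟩ := z
  obtain ⟨w', e'⟩ := z'
  obtain ⟨h1, -, h3⟩ := h
  simp only at h1 h3
  subst h3
  exact noise_congr hQ hQT h1 e

/-- Tail bound for the correlation of the noise with a functional of the coordinates off `T`. -/
theorem measure_abs_mean_inner_mul_noise_gt_le (h : IsIsotropic μ c) (hQ : Q.IsHermitian)
    (hQT : ∀ l, ∀ m ∉ T, Q l m = 0) {f : Euc k} (hf : ∀ l ∈ T, f l = 0) {B V : ℝ}
    (hB : ‖f‖ ^ 2 ≤ B) (hB0 : 0 < B) (hV : 0 < V) (hn : n ≠ 0) {t : ℝ} (ht : 0 ≤ t) :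
    (Measure.pi fun _ : Fin n => μ.prod η)
      ({ω | t < |(n : ℝ)⁻¹ * ∑ i, inner ℝ f (ω i).1 * noise Q (ω i)|} ∩
        {ω | (n : ℝ)⁻¹ * ∑ i, offMean T (ω i) * noise Q (ω i) ^ 2 ≤ V}) ≤
      ENNReal.ofReal (2 * Real.exp (-(t ^ 2 / (2 * (B * V / n))))) := by
  have hn' : (0 : ℝ) < n := by exact_mod_cast Nat.pos_of_ne_zero hn
  have hnm := measurable_noise Q
  have hom := measurable_offMean (T := T)
  set E : Set (Fin n → Euc k × ℝ) :=
    {ω | (n : ℝ)⁻¹ * ∑ i, offMean T (ω i) * noise Q (ω i) ^ 2 ≤ V} with hE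
  have hEm : MeasurableSet E := measurableSet_le (by fun_prop) measurable_const
  have hGm : Measurable fun ω : Fin n → Euc k × ℝ =>
      (n : ℝ)⁻¹ * ∑ i, inner ℝ f (ω i).1 * noise Q (ω i) := by fun_prop
  -- The variance event depends only on the conditioned quantities, so its indicator can serve as
  -- the invariant factor `F`. Restricting to the event thus plays the role of conditioning.
  have hInv : ∀ ω ω' : Fin n → Euc k × ℝ, (∀ i, AgreeOn T (ω i) (ω' i)) →
      E.indicator (1 : (Fin n → Euc k × ℝ) → ℝ≥0∞) ω = E.indicator 1 ω' := by
    intro ω ω' hag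
    have : ω ∈ E ↔ ω' ∈ E := by
      simp only [hE, Set.mem_ofPred_eq]
      simp_rw [noise_agreeOn hQ hQT (hag _), (hag _).2.1]
    simp only [Set.indicator, this, Pi.one_apply]
  have := measure_abs_gt_le_of_lintegral_exp_le
    (μ := (Measure.pi fun _ : Fin n => μ.prod η).restrict E) hGm (L := B * V / n) (by positivity)
    (fun s => ?_) ht
  · rwa [Measure.restrict_apply (measurableSet_lt measurable_const hGm.abs)] at this
  · rw [setLIntegral_eq_lintegral_indicator_mul hEm]
    have h1 := h.lintegral_exp_sum_mul_inner_le (η := η) hf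
      (u := fun z => s * (n : ℝ)⁻¹ * noise Q z) (by fun_prop)
      (fun z z' hz => by rw [noise_agreeOn hQ hQT hz])
      (measurable_one.indicator hEm) hInv
    have e1 : ∀ ω : Fin n → Euc k × ℝ, ∑ i, s * (n : ℝ)⁻¹ * noise Q (ω i) * inner ℝ f (ω i).1 =
        s * ((n : ℝ)⁻¹ * ∑ i, inner ℝ f (ω i).1 * noise Q (ω i)) := fun ω => by
      rw [Finset.mul_sum, Finset.mul_sum]
      exact Finset.sum_congr rfl fun i _ => by ring
    simp_rw [e1] at h1
    refine h1.trans ?_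
    refine (lintegral_mono (indicator_mul_le_indicator_mul
      (g := fun _ => ENNReal.ofReal (Real.exp (s ^ 2 * (B * V / n) / 2))) fun ω hω => ?_)).trans ?_
    · have hω' : (n : ℝ)⁻¹ * ∑ i, offMean T (ω i) * noise Q (ω i) ^ 2 ≤ V := hω
      refine ENNReal.ofReal_le_ofReal (Real.exp_le_exp.2 ?_)
      have e2 : ∑ i, (s * (n : ℝ)⁻¹ * noise Q (ω i)) ^ 2 * offMean T (ω i) =
          s ^ 2 * (n : ℝ)⁻¹ * ((n : ℝ)⁻¹ * ∑ i, offMean T (ω i) * noise Q (ω i) ^ 2) := by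
        rw [Finset.mul_sum, Finset.mul_sum]
        exact Finset.sum_congr rfl fun i _ => by ring
      rw [e2]
      have h0 : 0 ≤ (n : ℝ)⁻¹ * ∑ i, offMean T (ω i) * noise Q (ω i) ^ 2 :=
        mul_nonneg (by positivity) (Finset.sum_nonneg fun i _ =>
          mul_nonneg (offMean_nonneg _) (sq_nonneg _))
      calc _ ≤ B * (s ^ 2 * (n : ℝ)⁻¹ * V) / 2 := by gcongr
        _ = _ := by ring
    · have := h.isProbabilityMeasure
      rw [lintegral_mul_const _ (measurable_one.indicator hEm), lintegral_indicator_one hEm]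
      exact mul_le_of_le_one_left zero_le prob_le_one

/-- Tail bound for the correlations of the features with a functional of the coordinates
off `T`. -/
theorem measure_sum_sq_mean_inner_mul_features_gt_le (h : IsIsotropic μ c) (hc : 0 < c)
    {f : Euc k} (hf : ∀ l ∈ T, f l = 0) {B : ℝ}
    (hB : ‖f‖ ^ 2 ≤ B) (hB0 : 0 < B) (hn : n ≠ 0) {x : ℝ} :
    (Measure.pi fun _ : Fin n => μ.prod η)
      ({ω | x < ∑ o, ((n : ℝ)⁻¹ * ∑ i, inner ℝ f (ω i).1 * features T (ω i) o) ^ 2} ∩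
        {ω | weightedGramDev (μ.prod η) T ω ≤ 1}) ≤
      ENNReal.ofReal (2 ^ (T.card + 1) *
        Real.exp (-(x / (4 * (B * (3 + 192 * (c : ℝ) ^ 2) / n))))) := by
  have := h.isProbabilityMeasure
  have hn' : (0 : ℝ) < n := by exact_mod_cast Nat.pos_of_ne_zero hn
  have hfm := measurable_features (T := T)
  have hwm := measurable_weightedGramDev (n := n) (T := T) (μ.prod η)
  set E : Set (Fin n → Euc k × ℝ) := {ω | weightedGramDev (μ.prod η) T ω ≤ 1} with hE
  have hEm : MeasurableSet E := measurableSet_le hwm measurable_const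
  set L : ℝ := B * (3 + 192 * (c : ℝ) ^ 2) / n with hL
  have hL0 : 0 < L := by positivity
  set G : Option {l // l ∈ T} → (Fin n → Euc k × ℝ) → ℝ := fun o ω =>
    (n : ℝ)⁻¹ * ∑ i, inner ℝ f (ω i).1 * features T (ω i) o with hG
  have hGm : ∀ o, Measurable (G o) := fun o => by simp only [hG]; fun_prop
  have hInv : ∀ ω ω' : Fin n → Euc k × ℝ, (∀ i, AgreeOn T (ω i) (ω' i)) →
      E.indicator (1 : (Fin n → Euc k × ℝ) → ℝ≥0∞) ω = E.indicator 1 ω' := by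
    intro ω ω' hag
    have : ω ∈ E ↔ ω' ∈ E := by
      simp only [hE, Set.mem_ofPred_eq, weightedGramDev]
      simp_rw [features_congr (hag _), (hag _).2.1]
    simp only [Set.indicator, this, Pi.one_apply]
  -- The vector of correlations is treated as a whole by Gaussian decoupling. The price `2 ^ (|T| +
  -- 1)` is exponential in the sparsity only.
  have key := lintegral_exp_sum_sq_le
    (μ := (Measure.pi fun _ : Fin n => μ.prod η).restrict E) hGm hL0 (fun t => ?_)
  · have hmeas : Measurable fun ω => ∑ o, G o ω ^ 2 := by fun_prop
    have hms : MeasurableSet {ω | x < ∑ o, G o ω ^ 2} := measurableSet_lt measurable_const hmeas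
    have hmk : ENNReal.ofReal (Real.exp (x / (4 * L))) *
        (Measure.pi fun _ : Fin n => μ.prod η).restrict E {ω | x < ∑ o, G o ω ^ 2} ≤
        2 ^ Fintype.card (Option {l // l ∈ T}) := by
      refine le_trans ?_ key
      refine le_trans ?_ (mul_meas_ge_le_lintegral (by fun_prop)
        (ENNReal.ofReal (Real.exp (x / (4 * L)))))
      gcongr
      intro hω
      exact ENNReal.ofReal_le_ofReal (Real.exp_le_exp.2 (by gcongr))
    rw [Measure.restrict_apply hms] at hmk
    have he : ENNReal.ofReal (Real.exp (-(x / (4 * L)))) * ENNReal.ofReal (Real.exp (x / (4 * L))) =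
        1 := by
      rw [← ENNReal.ofReal_mul (Real.exp_pos _).le, ← Real.exp_add]; simp
    calc _ = ENNReal.ofReal (Real.exp (-(x / (4 * L)))) * (ENNReal.ofReal (Real.exp (x / (4 * L))) *
          (Measure.pi fun _ : Fin n => μ.prod η) ({ω | x < ∑ o, G o ω ^ 2} ∩ E)) := by
            rw [← mul_assoc, he, one_mul]
      _ ≤ ENNReal.ofReal (Real.exp (-(x / (4 * L)))) *
          2 ^ Fintype.card (Option {l // l ∈ T}) := by gcongr
      _ = _ := by
        rw [ENNReal.ofReal_mul (by positivity), ENNReal.ofReal_pow (by positivity), mul_comm]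
        simp [Fintype.card_option]
  · rw [setLIntegral_eq_lintegral_indicator_mul hEm]
    have h1 := h.lintegral_exp_sum_mul_inner_le (η := η) hf
      (u := fun z => (n : ℝ)⁻¹ * ∑ o, t o * features T z o) (by fun_prop)
      (fun z z' hz => by rw [features_congr hz])
      (measurable_one.indicator hEm) hInv
    have e1 : ∀ ω : Fin n → Euc k × ℝ,
        ∑ i, (n : ℝ)⁻¹ * (∑ o, t o * features T (ω i) o) * inner ℝ f (ω i).1 =
        ∑ o, t o * G o ω := fun ω => by
      simp only [hG, Finset.mul_sum, Finset.sum_mul]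
      rw [Finset.sum_comm]
      exact Finset.sum_congr rfl fun o _ => Finset.sum_congr rfl fun i _ => by ring
    simp_rw [e1] at h1
    refine h1.trans ?_
    refine (lintegral_mono (indicator_mul_le_indicator_mul
      (g := fun _ => ENNReal.ofReal (Real.exp (L * (∑ o, t o ^ 2) / 2))) fun ω hω => ?_)).trans ?_
    · have hω' : weightedGramDev (μ.prod η) T ω ≤ 1 := hω
      refine ENNReal.ofReal_le_ofReal (Real.exp_le_exp.2 ?_)
      have e2 : ∑ i, ((n : ℝ)⁻¹ * ∑ o, t o * features T (ω i) o) ^ 2 * offMean T (ω i) =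
          (n : ℝ)⁻¹ * ((n : ℝ)⁻¹ * ∑ i, offMean T (ω i) * (∑ o, t o * features T (ω i) o) ^ 2) := by
        rw [Finset.mul_sum, Finset.mul_sum]
        exact Finset.sum_congr rfl fun i _ => by ring
      rw [e2]
      have h2 := h.sample_offMean_mul_features_sq_le hc hω' t
      have h0 : 0 ≤ (n : ℝ)⁻¹ * ∑ i, offMean T (ω i) * (∑ o, t o * features T (ω i) o) ^ 2 :=
        mul_nonneg (by positivity) (Finset.sum_nonneg fun i _ =>
          mul_nonneg (offMean_nonneg _) (sq_nonneg _))
      calc _ ≤ B * ((n : ℝ)⁻¹ * ((3 + 192 * (c : ℝ) ^ 2) * ∑ o, t o ^ 2)) / 2 := by gcongr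
        _ = _ := by rw [hL]; ring
    · rw [lintegral_mul_const _ (measurable_one.indicator hEm), lintegral_indicator_one hEm]
      exact mul_le_of_le_one_left zero_le prob_le_one

/-- Tail bound for the correlation of the noise with a linear functional. -/
theorem measure_abs_mean_noise_mul_inner_gt_le (h : IsIsotropic μ c) (g : Euc k) {V : ℝ}
    (hV : 0 < V) (hn : n ≠ 0) {t : ℝ} (ht : 0 ≤ t) :
    (Measure.pi fun _ : Fin n => μ.prod η)
      ({ω | t < |(n : ℝ)⁻¹ * ∑ i, noise Q (ω i) * inner ℝ g (ω i).1|} ∩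
        {ω | (n : ℝ)⁻¹ * ∑ i, (noise Q (ω i) * inner ℝ g (ω i).1) ^ 2 ≤ V}) ≤
      ENNReal.ofReal (2 * Real.exp (-(t ^ 2 / (2 * (V / n))))) := by
  have := h.isProbabilityMeasure
  have hn' : (0 : ℝ) < n := by exact_mod_cast Nat.pos_of_ne_zero hn
  have hnm := measurable_noise Q
  set E : Set (Fin n → Euc k × ℝ) :=
    {ω | (n : ℝ)⁻¹ * ∑ i, (noise Q (ω i) * inner ℝ g (ω i).1) ^ 2 ≤ V} with hE
  have hEm : MeasurableSet E := measurableSet_le (by fun_prop) measurable_const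
  have hGm : Measurable fun ω : Fin n → Euc k × ℝ =>
      (n : ℝ)⁻¹ * ∑ i, noise Q (ω i) * inner ℝ g (ω i).1 := by fun_prop
  -- Here an entire observation changes sign: the noise is even and the functional odd, so no
  -- splitting of the coordinates is needed.
  have hflip : ∀ (b : Bool) (w : Euc k),
      signFlip (fun _ => b) w = (if b then (1 : ℝ) else -1) • w := by
    intro b w
    ext l
    rw [signFlip_apply]
    rfl
  have hflipn : ∀ (b : Bool) (z : Euc k × ℝ),
      noise Q (signFlip (fun _ => b) z.1, z.2) = noise Q z := by
    intro b z
    rw [hflip]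
    cases b
    · simpa using noise_neg Q z
    · simp
  have hinner : ∀ (b : Bool) (z : Euc k × ℝ),
      (inner ℝ g (signFlip (fun _ => b) z.1) : ℝ) = (if b then 1 else -1) * inner ℝ g z.1 := by
    intro b z
    rw [hflip, inner_smul_right]
  have := measure_abs_gt_le_of_lintegral_exp_le
    (μ := (Measure.pi fun _ : Fin n => μ.prod η).restrict E) hGm (L := V / n) (by positivity)
    (fun s => ?_) ht
  · rwa [Measure.restrict_apply (measurableSet_lt measurable_const hGm.abs)] at this
  · rw [setLIntegral_eq_lintegral_indicator_mul hEm]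
    have h1 := lintegral_mul_exp_sum_le_of_flips
      (μ := Measure.pi fun _ : Fin n => μ.prod η)
      (fun (ξ : Fin n → Bool) (ω : Fin n → Euc k × ℝ) i =>
        (signFlip (fun _ => ξ i) (ω i).1, (ω i).2))
      (fun ξ => h.measurePreserving_sample fun i => signFlip fun _ => ξ i)
      (F := E.indicator 1) (measurable_one.indicator hEm)
      (fun ξ ω => by
        have : (fun i => (signFlip (fun _ => ξ i) (ω i).1, (ω i).2)) ∈ E ↔ ω ∈ E := by
          simp only [hE, Set.mem_ofPred_eq]
          have e : ∀ i, (noise Q (signFlip (fun _ => ξ i) (ω i).1, (ω i).2) *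
              inner ℝ g (signFlip (fun _ => ξ i) (ω i).1)) ^ 2 =
              (noise Q (ω i) * inner ℝ g (ω i).1) ^ 2 := by
            intro i
            rw [hflipn, hinner]
            cases ξ i <;> simp
          simp_rw [e]
        simp only [Set.indicator, this, Pi.one_apply])
      (Y := fun i ω => s * (n : ℝ)⁻¹ * (noise Q (ω i) * inner ℝ g (ω i).1))
      (fun i => by fun_prop)
      (fun ξ i ω => by
        rw [hflipn, hinner]
        ring)
    have e1 : ∀ ω : Fin n → Euc k × ℝ,
        ∑ i, s * (n : ℝ)⁻¹ * (noise Q (ω i) * inner ℝ g (ω i).1) =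
        s * ((n : ℝ)⁻¹ * ∑ i, noise Q (ω i) * inner ℝ g (ω i).1) := fun ω => by
      rw [← Finset.mul_sum, mul_assoc]
    simp_rw [e1] at h1
    refine h1.trans ?_
    refine (lintegral_mono (indicator_mul_le_indicator_mul
      (g := fun _ => ENNReal.ofReal (Real.exp (s ^ 2 * (V / n) / 2))) fun ω hω => ?_)).trans ?_
    · have hω' : (n : ℝ)⁻¹ * ∑ i, (noise Q (ω i) * inner ℝ g (ω i).1) ^ 2 ≤ V := hω
      refine ENNReal.ofReal_le_ofReal (Real.exp_le_exp.2 ?_)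
      have e2 : ∑ i, (s * (n : ℝ)⁻¹ * (noise Q (ω i) * inner ℝ g (ω i).1)) ^ 2 =
          s ^ 2 * (n : ℝ)⁻¹ * ((n : ℝ)⁻¹ * ∑ i, (noise Q (ω i) * inner ℝ g (ω i).1) ^ 2) := by
        rw [Finset.mul_sum, Finset.mul_sum]
        exact Finset.sum_congr rfl fun i _ => by ring
      rw [e2]
      calc _ ≤ s ^ 2 * (n : ℝ)⁻¹ * V / 2 := by gcongr
        _ = _ := by ring
    · rw [lintegral_mul_const _ (measurable_one.indicator hEm), lintegral_indicator_one hEm]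
      exact mul_le_of_le_one_left zero_le prob_le_one

end IsIsotropic

/-! ### The exceptional events -/

namespace IsIsotropic

variable {k : ℕ} {μ : Measure (Euc k)} {c ce : ℝ≥0} {η : Measure ℝ} [IsProbabilityMeasure η]
  {T : Finset (Fin k)} {Q : Matrix (Fin k) (Fin k) ℝ} {n d : ℕ}

/-- The exceptional event for the inactive variables. -/
theorem measure_inactive_le (h : IsIsotropic μ c) (hc : 0 < c)
    (hη : HasSubgaussianMGF (fun e : ℝ => e) ce η) (hQ : Q.IsHermitian)
    (hQT : ∀ l, ∀ m ∉ T, Q l m = 0) {D : ℝ}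
    (hD : ∫ w, centeredForm Q w ^ 2 ∂μ + ∫ e, e ^ 2 ∂η ≤ D) {f : Fin d → Euc k}
    {S : Finset (Fin d)} (hf : ∀ j ∉ S, ∀ l ∈ T, f j l = 0) {B : ℝ} (hB0 : 0 < B)
    (hB : ∀ j ∉ S, ‖f j‖ ^ 2 ≤ B) (hn : n ≠ 0) {V x y t : ℝ} (hV : 0 < V) (hx : 0 < x)
    (hy : 0 < y) (ht : 0 ≤ t) :
    (Measure.pi fun _ : Fin n => μ.prod η) {ω | ¬ ∀ j ∉ S,
      |(n : ℝ)⁻¹ * ∑ i, inner ℝ (f j) (ω i).1 * noise Q (ω i)| ≤ t ∧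
      ∑ o, ((n : ℝ)⁻¹ * ∑ i, inner ℝ (f j) (ω i).1 * features T (ω i) o) ^ 2 ≤ x ∧
      (∑ o, ((n : ℝ)⁻¹ * ∑ i, inner ℝ (f j) (ω i).1 * features T (ω i) o) ^ 2) *
        (∑ o, ((n : ℝ)⁻¹ * ∑ i, noise Q (ω i) * features T (ω i) o) ^ 2) ≤ x * y} ≤
      ENNReal.ofReal ((n : ℝ)⁻¹ * ((T.card + 1) ^ 2 * (1 + 161280 * (c : ℝ) ^ 4))) +
      ENNReal.ofReal (2 * (60000 * (c : ℝ) ^ 3 + 16 * c + 1) * D / V) +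
      ENNReal.ofReal ((n : ℝ)⁻¹ * ((T.card + 1) * (2 * (60000 * (c : ℝ) ^ 3 + 16 * c + 1) * D)) / y) +
      ENNReal.ofReal (d * (2 * Real.exp (-(t ^ 2 / (2 * (B * V / n)))))) +
      ENNReal.ofReal (d * (2 ^ (T.card + 1) *
        Real.exp (-(x / (4 * (B * (3 + 192 * (c : ℝ) ^ 2) / n)))))) := by
  -- If no coordinate lies off `T`, all residual vectors vanish and the event is empty. Otherwise a
  -- coordinate off `T` makes the form singular.
  by_cases hT : ∀ l, l ∈ T
  · have hf0 : ∀ j ∉ S, f j = 0 := fun j hj => by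
      ext l; exact hf j hj l (hT l)
    refine le_of_eq_of_le ?_ (zero_le (a := _))
    convert measure_empty (μ := Measure.pi fun _ : Fin n => μ.prod η)
    rw [Set.eq_empty_iff_forall_notMem]
    intro ω hω
    refine hω fun j hj => ?_
    simp [hf0 j hj, ht, hx.le, (mul_pos hx hy).le]
  push Not at hT
  obtain ⟨l₀, hl₀⟩ := hT
  have hQ0 := det_eq_zero_of_notMem hQT hl₀
  set ζ := Measure.pi fun _ : Fin n => μ.prod η with hζ
  have b1 := h.measure_weightedGramDev_gt_le (η := η) (T := T) hc hn
  have b2 := h.measure_offMean_mul_noise_sq_gt_le (T := T) hc hη hQ hQ0 hD hn hV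
  have b3 := h.measure_score_gt_le hη (T := T)
    (fun o => h.integral_features_sq_mul_noise_sq_le hc hη hQ hQ0 hD o) hn hy
  have b4 : ∀ j ∈ Sᶜ, _ := fun j hj => h.measure_abs_mean_inner_mul_noise_gt_le (η := η) hQ hQT
    (hf j (by simpa using hj)) (hB j (by simpa using hj)) hB0 hV hn ht
  have b5 : ∀ j ∈ Sᶜ, _ := fun j hj => h.measure_sum_sq_mean_inner_mul_features_gt_le (η := η) hc
    (hf j (by simpa using hj)) (hB j (by simpa using hj)) hB0 hn (x := x)
  rw [← hζ] at b1 b2 b3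
  simp_rw [← hζ] at b4 b5
  have u4 := (measure_biUnion_finset_le (μ := ζ) Sᶜ _).trans (Finset.sum_le_sum b4)
  have u5 := (measure_biUnion_finset_le (μ := ζ) Sᶜ _).trans (Finset.sum_le_sum b5)
  have hcard : ((Sᶜ : Finset (Fin d)).card : ℝ) ≤ d := by
    exact_mod_cast (Finset.card_le_univ _).trans_eq (Fintype.card_fin d)
  have hsum : ∀ r : ℝ, 0 ≤ r → ∑ _j ∈ (Sᶜ : Finset (Fin d)), ENNReal.ofReal r ≤
      ENNReal.ofReal (d * r) := by
    intro r hr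
    rw [Finset.sum_const, nsmul_eq_mul, ENNReal.ofReal_mul (by positivity)]
    gcongr
    rw [← ENNReal.ofReal_natCast]
    exact ENNReal.ofReal_le_ofReal hcard
  replace u4 := u4.trans (hsum _ (by positivity))
  replace u5 := u5.trans (hsum _ (by positivity))
  refine le_trans (measure_mono ?_) ((measure_union_le _ _).trans (add_le_add
    ((measure_union_le _ _).trans (add_le_add
      ((measure_union_le _ _).trans (add_le_add
        ((measure_union_le _ _).trans (add_le_add b1 b2)) b3)) u4)) u5))
  intro ω hω
  by_contra hcon
  simp only [Set.mem_union, not_or, Set.mem_iUnion, not_exists, Set.mem_inter_iff,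
    Set.mem_ofPred_eq, not_lt, not_and, not_le] at hcon
  obtain ⟨⟨⟨⟨c1, c2⟩, c3⟩, c4⟩, c5⟩ := hcon
  refine hω fun j hj => ?_
  have hj' : j ∈ Sᶜ := by simpa using hj
  have d4 : |(n : ℝ)⁻¹ * ∑ i, inner ℝ (f j) (ω i).1 * noise Q (ω i)| ≤ t := by
    by_contra hlt
    exact absurd c2 (not_le.2 (c4 j hj' (not_le.1 hlt)))
  have d5 : ∑ o, ((n : ℝ)⁻¹ * ∑ i, inner ℝ (f j) (ω i).1 * features T (ω i) o) ^ 2 ≤ x := by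
    by_contra hlt
    exact absurd c1 (not_le.2 (c5 j hj' (not_le.1 hlt)))
  exact ⟨d4, d5, mul_le_mul d5 c3 (Finset.sum_nonneg fun _ _ => sq_nonneg _) hx.le⟩

/-- The exceptional event for the active variables. -/
theorem measure_active_le (h : IsIsotropic μ c) (hc : 0 < c)
    (hη : HasSubgaussianMGF (fun e : ℝ => e) ce η) {K s : ℝ} (hs : 0 < s)
    (hK : ∫ z, noise Q z ^ 8 ∂(μ.prod η) ≤ K * s ^ 8) {g : Fin d → Euc k} {S : Finset (Fin d)}
    {G : ℝ} (hg : ∀ j ∈ S, ‖g j‖ ^ 2 ≤ G) (hn : n ≠ 0) {x y t : ℝ} (hx : 0 < x)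
    (hy : 0 < y) (ht : 0 ≤ t) :
    (Measure.pi fun _ : Fin n => μ.prod η) {ω | ¬ (gramDev (fun i => features T (ω i)) ≤ x ∧
      ∑ o, ((n : ℝ)⁻¹ * ∑ i, noise Q (ω i) * features T (ω i) o) ^ 2 ≤ y ∧
      ∀ j ∈ S, |(n : ℝ)⁻¹ * ∑ i, noise Q (ω i) * inner ℝ (g j) (ω i).1| ≤ t)} ≤
      ENNReal.ofReal ((n : ℝ)⁻¹ * ((T.card + 1) ^ 2 * (1 + 96 * (c : ℝ) ^ 2)) / x) +
      ENNReal.ofReal ((n : ℝ)⁻¹ * ((T.card + 1) * ((K + 1 + 96 * (c : ℝ) ^ 2) * s ^ 2)) / y) +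
      ENNReal.ofReal (S.card * (n : ℝ)⁻¹) +
      ENNReal.ofReal (S.card * (2 * Real.exp
        (-(t ^ 2 / (2 * (2 * ((K + 161280 * ((c : ℝ) * G) ^ 4 + 1) * s ^ 2) / n)))))) := by
  have hK0 : 0 ≤ K := by
    have h0 : (0 : ℝ) ≤ ∫ z, noise Q z ^ 8 ∂(μ.prod η) :=
      integral_nonneg fun z => (by decide : Even 8).pow_nonneg _
    exact nonneg_of_mul_nonneg_left (h0.trans hK) (by positivity)
  set ζ := Measure.pi fun _ : Fin n => μ.prod η with hζ
  have b1 := h.measure_gramDev_gt_le (η := η) (T := T) hc hn hx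
  -- The absolute noise bound is used, because here the form may have full rank.
  have b2 := h.measure_score_gt_le hη (T := T)
    (fun o => h.integral_features_sq_mul_noise_sq_le_card hc hη hs hK o) hn hy
  have b3 : ∀ j ∈ S, _ := fun j hj =>
    h.measure_noise_sq_mul_inner_sq_gt_le hc hη hs hK (hg j hj) hn
  have b4 : ∀ j ∈ S, _ := fun j _ => h.measure_abs_mean_noise_mul_inner_gt_le (η := η) (Q := Q)
    (g j) (V := 2 * ((K + 161280 * ((c : ℝ) * G) ^ 4 + 1) * s ^ 2)) (by positivity) hn ht
  rw [← hζ] at b1 b2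
  simp_rw [← hζ] at b3 b4
  have u3 := (measure_biUnion_finset_le (μ := ζ) S _).trans (Finset.sum_le_sum b3)
  have u4 := (measure_biUnion_finset_le (μ := ζ) S _).trans (Finset.sum_le_sum b4)
  have hsum : ∀ r : ℝ, 0 ≤ r → ∑ _j ∈ S, ENNReal.ofReal r ≤ ENNReal.ofReal (S.card * r) := by
    intro r hr
    rw [Finset.sum_const, nsmul_eq_mul, ENNReal.ofReal_mul (by positivity),
      ENNReal.ofReal_natCast]
  replace u3 := u3.trans (hsum _ (by positivity))
  replace u4 := u4.trans (hsum _ (by positivity))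
  refine le_trans (measure_mono ?_) ((measure_union_le _ _).trans (add_le_add
    ((measure_union_le _ _).trans (add_le_add
      ((measure_union_le _ _).trans (add_le_add b1 b2)) u3)) u4))
  intro ω hω
  by_contra hcon
  simp only [Set.mem_union, not_or, Set.mem_iUnion, not_exists, Set.mem_inter_iff,
    Set.mem_ofPred_eq, not_lt, not_and, not_le] at hcon
  obtain ⟨⟨⟨c1, c2⟩, c3⟩, c4⟩ := hcon
  refine hω ⟨c1, c2, fun j hj => ?_⟩
  by_contra hlt
  exact absurd (c3 j hj) (not_le.2 (c4 j hj (not_le.1 hlt)))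

end IsIsotropic

/-! ### The law of the sample -/

/-- Independence within the covariates, within the errors and between the two blocks is exactly what
identifies the joint law, after regrouping by observation. From here on only this law matters. -/
theorem map_sample_eq {n d : ℕ} {Ω : Type*} [MeasurableSpace Ω] {b : ℝ≥0} {P : Measure Ω}
    [IsProbabilityMeasure P] {ν : Measure (Fin d → ℝ)} {η : Measure ℝ}
    [IsProbabilityMeasure ν] [IsProbabilityMeasure η]
    {x : Fin n → Ω → Fin d → ℝ} {ε : Fin n → Ω → ℝ} (h : ConditionSG b P ν η x ε) :
    AEMeasurable (fun ω i => (x i ω, ε i ω)) P ∧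
    P.map (fun ω i => (x i ω, ε i ω)) = Measure.pi fun _ : Fin n => ν.prod η := by
  have hx : ∀ i, AEMeasurable (x i) P := fun i => (h.law_x i).aemeasurable
  have he : ∀ i, AEMeasurable (ε i) P := fun i => (h.law_error i).aemeasurable
  have hX : P.map (fun ω i => x i ω) = Measure.pi fun _ : Fin n => ν := by
    rw [(iIndepFun_iff_map_fun_eq_pi_map hx).1 h.indep_x]
    congr 1
    ext1 i
    exact (h.law_x i).map_eq
  have hE : P.map (fun ω i => ε i ω) = Measure.pi fun _ : Fin n => η := by
    rw [(iIndepFun_iff_map_fun_eq_pi_map he).1 h.indep_error]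
    congr 1
    ext1 i
    exact (h.law_error i).map_eq
  have hxm : AEMeasurable (fun ω i => x i ω) P := aemeasurable_pi_lambda _ hx
  have hem : AEMeasurable (fun ω i => ε i ω) P := aemeasurable_pi_lambda _ he
  have hj := (indepFun_iff_map_prod_eq_prod_map_map hxm hem).1 h.indep_x_error
  rw [hX, hE] at hj
  refine ⟨aemeasurable_pi_lambda _ fun i => (hx i).prodMk (he i), ?_⟩
  have hmp := (measurePreserving_arrowProdEquivProdArrow (Fin d → ℝ) ℝ (Fin n) (fun _ => ν)
    (fun _ => η)).symm
  rw [← hmp.map_eq, ← hj, AEMeasurable.map_map_of_aemeasurable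
    (MeasurableEquiv.measurable _).aemeasurable (hxm.prodMk hem)]
  rfl

/-! ### The good event -/

theorem sqrt_mul_sqrt_le_of_mul_le_sq {a b c : ℝ} (ha : 0 ≤ a) (hc : 0 ≤ c) (h : a * b ≤ c ^ 2) :
    √a * √b ≤ c := by
  rw [← Real.sqrt_mul ha]
  exact Real.sqrt_le_iff.2 ⟨hc, h⟩

theorem sum_subtype_mul_eq_inner {k : ℕ} {T : Finset (Fin k)} {u : Euc k}
    (hu : ∀ l ∉ T, u l = 0) (v : Euc k) : ∑ l : {l // l ∈ T}, u l * v l = inner ℝ u v := by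
  rw [PiLp.inner_apply, ← Finset.sum_add_sum_compl T,
    Finset.sum_eq_zero (s := Tᶜ) (fun l hl => by simp [hu l (by simpa using hl)]), add_zero,
    ← Finset.sum_coe_sort T (fun l => (inner ℝ (u l) (v l) : ℝ))]
  exact Finset.sum_congr rfl fun l _ => by simp [mul_comm]

theorem sum_subtype_sq_le {k : ℕ} (T : Finset (Fin k)) (v : Euc k) :
    ∑ l : {l // l ∈ T}, v l ^ 2 ≤ ‖v‖ ^ 2 := by
  rw [EuclideanSpace.real_norm_sq_eq, Finset.sum_coe_sort T (fun l => v l ^ 2)]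
  exact Finset.sum_le_sum_of_subset_of_nonneg (Finset.subset_univ _) fun _ _ _ => sq_nonneg _

theorem gramDev_nonneg {ι : Type*} [Fintype ι] [DecidableEq ι] {n : ℕ} (φ : Fin n → ι → ℝ) :
    0 ≤ gramDev φ :=
  Finset.sum_nonneg fun _ _ => Finset.sum_nonneg fun _ _ => sq_nonneg _

/-- Linear coordinates of the active covariates, together with an intercept. -/
def activeFeatures {d : ℕ} {ι : Type*} (α : ι → Fin d → ℝ) (S : Finset (Fin d))
    (v : Fin d → ℝ) : Option ι → ℝ :=
  withIntercept fun l => ∑ k ∈ S, α l k * v k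

theorem measurable_activeFeatures {d : ℕ} {ι : Type*} (α : ι → Fin d → ℝ) (S : Finset (Fin d))
    (o : Option ι) : Measurable fun v : Fin d → ℝ => activeFeatures α S v o := by
  cases o with
  | none => exact measurable_const
  | some l => simp only [activeFeatures, withIntercept, Option.elim]; fun_prop

theorem measurable_interactionEffect {d : ℕ} (ν : Measure (Fin d → ℝ)) (βI : Sym2 (Fin d) → ℝ) :
    Measurable (interactionEffect ν βI) := by
  refine Finset.measurable_sum _ fun z _ => ?_
  induction z using Sym2.ind with
  | _ i j => simp only [Sym2.map_mk, Sym2.mul_mk]; fun_prop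

/-- The linear residuals of the covariates given the active ones. -/
def regResidual {d : ℕ} (c : Fin d → Fin d → ℝ) (S : Finset (Fin d)) (v : Fin d → ℝ) (j : Fin d) :
    ℝ :=
  v j - ∑ i ∈ S, c j i * v i

/-- The effective noise as a function of the covariates and the error. -/
def rawNoise {d : ℕ} (ν : Measure (Fin d → ℝ)) (βI : Sym2 (Fin d) → ℝ) (v : (Fin d → ℝ) × ℝ) : ℝ :=
  interactionEffect ν βI v.1 + v.2

/-- The samples on which the LASSO is shown to succeed. -/
def goodSamples {n d : ℕ} (ν : Measure (Fin d → ℝ)) (βI : Sym2 (Fin d) → ℝ)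
    (S : Finset (Fin d)) {ι : Type*} [Fintype ι] [DecidableEq ι] (α : ι → Fin d → ℝ)
    (a g : Fin d → ι → ℝ) (c : Fin d → Fin d → ℝ) (t x4 y4 x1 y1 r : ℝ) :
    Set (Fin n → (Fin d → ℝ) × ℝ) := {ξ |
  (∀ i, ∀ k ∈ S, (ξ i).1 k = ∑ l, a k l * activeFeatures α S (ξ i).1 (some l)) ∧
  (∀ j ∉ S, |(n : ℝ)⁻¹ * ∑ i, regResidual c S (ξ i).1 j * rawNoise ν βI (ξ i)| ≤ t ∧
    ∑ o, ((n : ℝ)⁻¹ * ∑ i, regResidual c S (ξ i).1 j * activeFeatures α S (ξ i).1 o) ^ 2 ≤ x4 ∧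
    (∑ o, ((n : ℝ)⁻¹ * ∑ i, regResidual c S (ξ i).1 j * activeFeatures α S (ξ i).1 o) ^ 2) *
      (∑ o, ((n : ℝ)⁻¹ * ∑ i, rawNoise ν βI (ξ i) * activeFeatures α S (ξ i).1 o) ^ 2) ≤ x4 * y4) ∧
  (gramDev (fun i => activeFeatures α S (ξ i).1) ≤ x1 ∧
    ∑ o, ((n : ℝ)⁻¹ * ∑ i, rawNoise ν βI (ξ i) * activeFeatures α S (ξ i).1 o) ^ 2 ≤ y1 ∧
    ∀ j ∈ S, |(n : ℝ)⁻¹ * ∑ i, rawNoise ν βI (ξ i) *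
      ∑ l, g j l * activeFeatures α S (ξ i).1 (some l)| ≤ r)}

/-- Success of the LASSO is not itself shown measurable. Transporting probabilities between sample
spaces needs a measurable set of samples on which success is guaranteed. -/
theorem measurableSet_goodSamples {n d : ℕ} (ν : Measure (Fin d → ℝ)) (βI : Sym2 (Fin d) → ℝ)
    (S : Finset (Fin d)) {ι : Type*} [Fintype ι] [DecidableEq ι] (α : ι → Fin d → ℝ)
    (a g : Fin d → ι → ℝ) (c : Fin d → Fin d → ℝ) (t x4 y4 x1 y1 r : ℝ) :
    MeasurableSet (goodSamples (n := n) ν βI S α a g c t x4 y4 x1 y1 r) := by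
  have hφm : ∀ i o, Measurable fun ξ : Fin n → (Fin d → ℝ) × ℝ => activeFeatures α S (ξ i).1 o :=
    fun i o => (measurable_activeFeatures α S o).comp (measurable_fst.comp (measurable_pi_apply i))
  have hem : ∀ i j, Measurable fun ξ : Fin n → (Fin d → ℝ) × ℝ => regResidual c S (ξ i).1 j :=
    fun i j => by simp only [regResidual]; fun_prop
  have hWm : ∀ i, Measurable fun ξ : Fin n → (Fin d → ℝ) × ℝ => rawNoise ν βI (ξ i) := fun i =>
    (((measurable_interactionEffect ν βI).comp measurable_fst).add measurable_snd).comp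
      (measurable_pi_apply i)
  have hle : ∀ {F G : (Fin n → (Fin d → ℝ) × ℝ) → ℝ}, Measurable F → Measurable G →
      Measurable fun ξ => F ξ ≤ G ξ :=
    fun hF hG => measurableSet_setOfPred.1 (measurableSet_le hF hG)
  refine measurableSet_setOfPred.2 ?_
  refine .and ?_ (.and ?_ (.and ?_ (.and ?_ ?_)))
  · refine .forall fun i => .forall fun k => .forall fun _ => ?_
    exact measurableSet_setOfPred.1 (measurableSet_eq_fun (by fun_prop) (by fun_prop))
  · refine .forall fun j => .forall fun _ => .and ?_ (.and ?_ ?_)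
    · exact hle (by fun_prop) measurable_const
    · exact hle (by fun_prop) measurable_const
    · exact hle (by fun_prop) measurable_const
  · exact hle (by unfold gramDev; fun_prop) measurable_const
  · exact hle (by fun_prop) measurable_const
  · refine .forall fun j => .forall fun _ => ?_
    exact hle (by fun_prop) measurable_const

/-- Translation of the squared bounds of the good event into the square root bounds of the
deterministic criterion; sums over `T` become inner products because the active and the dual vectors
vanish off `T`. -/
theorem lassoSucceeds_of_mem_goodSamples {n d k : ℕ} (hn : n ≠ 0) {ν : Measure (Fin d → ℝ)}
    {β₀ : ℝ} {β : Fin d → ℝ} {βI : Sym2 (Fin d) → ℝ}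
    {lam Cmin γ : ℝ} (hlam : 0 < lam) (hCmin : 0 < Cmin) (hγ : 0 < γ)
    {S : Finset (Fin d)} (hS : S = support β βI) {a g : Fin d → Euc k} {T : Finset (Fin k)}
    (haT : ∀ j ∈ S, ∀ l ∉ T, a j l = 0) (hgT : ∀ j ∈ S, ∀ l ∉ T, g j l = 0)
    {α : {l // l ∈ T} → Fin d → ℝ}
    (hdual : ∀ i ∈ S, ∀ j ∈ S, inner ℝ (a j) (g i) = if i = j then (1 : ℝ) else 0)
    (hspan : ∀ i ∈ S, g i = ∑ j ∈ S, (inner ℝ (g i) (g j) : ℝ) • a j)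
    (hg : ∀ u : Fin d → ℝ, ‖∑ i ∈ S, u i • g i‖ ^ 2 ≤ (∑ i ∈ S, u i ^ 2) / Cmin)
    (hc : ∀ j ∉ S, ∑ i ∈ S, |inner ℝ (a j) (g i)| ≤ 1 - γ)
    {x1 x4 y1 y4 : ℝ} (hx1 : 0 ≤ x1) (hx1' : x1 ≤ 1 / 4)
    (h4 : x4 * (S.card / Cmin) ≤ (γ / 16) ^ 2) (h4' : x4 * y4 ≤ (γ * lam / 16) ^ 2)
    (h5 : x1 * y1 * (1 / Cmin) ≤ ((√S.card)⁻¹ / (2 * Cmin)) ^ 2)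
    {ξ : Fin n → (Fin d → ℝ) × ℝ}
    (hξ : ξ ∈ goodSamples ν βI S α (fun j (l : {l // l ∈ T}) => a j l)
      (fun j (l : {l // l ∈ T}) => g j l) (fun j i => inner ℝ (a j) (g i)) (γ * lam / 4)
      x4 y4 x1 y1 ((√S.card)⁻¹ / Cmin)) :
    LassoSucceeds β βI lam Cmin
      (fun i => response ν β₀ β βI (ξ i).1 (ξ i).2) (fun i => (ξ i).1) := by
  obtain ⟨g0, g1, g2, g3, g4⟩ := hξ
  refine lassoSucceeds_of_conditions (β₀ := β₀) hn hlam hCmin hγ hS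
    (fun i l => activeFeatures α S (ξ i).1 (some l)) (fun k l => a k l) (fun k l => g k l)
    (fun j i => inner ℝ (a j) (g i)) g0 ?_ ?_ ?_ ?_ hc (W := fun i => rawNoise ν βI (ξ i)) ?_
    (φ := fun i => activeFeatures α S (ξ i).1) ?_ (e := fun i => regResidual (fun j i => inner ℝ (a j) (g i)) S (ξ i).1) (fun i j => rfl) rfl (fun j => rfl)
    (g2.trans hx1') (fun j hj => (g1 j hj).1) ?_ ?_ g4 ?_
  · intro k hk k' hk'
    rw [sum_subtype_mul_eq_inner (haT k' hk'), hdual k hk k' hk']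
  · intro k hk l
    have := congrArg (fun v : Euc _ => v l) (hspan k hk)
    simp only [WithLp.ofLp_sum, WithLp.ofLp_smul, Finset.sum_apply, Pi.smul_apply,
      smul_eq_mul] at this
    simp_rw [sum_subtype_mul_eq_inner (hgT k hk)]
    exact this
  · intro u hu
    have e1 : ∀ l, ∑ k ∈ S, u k * g k l = (∑ k ∈ S, u k • g k) l := fun l => by
      simp [WithLp.ofLp_sum, WithLp.ofLp_smul, Finset.sum_apply]
    simp_rw [e1]
    refine (sum_subtype_sq_le T _).trans ((hg u).trans ?_)
    gcongr
    calc ∑ k ∈ S, u k ^ 2 ≤ ∑ _k ∈ S, (1 : ℝ) :=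
          Finset.sum_le_sum fun k _ => (sq_le_one_iff_abs_le_one _).2 (hu k)
      _ = S.card := by simp
  · intro k hk
    refine (sum_subtype_sq_le T _).trans ?_
    have := hg (fun i => if i = k then 1 else 0)
    simpa [hk] using this
  · intro i
    simp only [rawNoise, response]
    ring
  · intro i
    ext o
    cases o <;> rfl
  · intro j hj
    refine sqrt_mul_sqrt_le_of_mul_le_sq (Finset.sum_nonneg fun _ _ => sq_nonneg _)
      (by positivity) (le_trans ?_ h4)
    have := (g1 j hj).2.1
    gcongr
  · intro j hj
    exact sqrt_mul_sqrt_le_of_mul_le_sq (Finset.sum_nonneg fun _ _ => sq_nonneg _)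
      (by positivity) ((g1 j hj).2.2.trans h4')
  · rw [← Real.sqrt_mul (gramDev_nonneg _)]
    refine sqrt_mul_sqrt_le_of_mul_le_sq (mul_nonneg
      (gramDev_nonneg _)
      (Finset.sum_nonneg fun _ _ => sq_nonneg _)) (by positivity) (le_trans ?_ h5)
    have hnn : 0 ≤ ∑ o, ((n : ℝ)⁻¹ * ∑ i, rawNoise ν βI (ξ i) * activeFeatures α S (ξ i).1 o) ^ 2 :=
      Finset.sum_nonneg fun _ _ => sq_nonneg _
    gcongr

/-- Failure of the LASSO is contained in the exceptional events. -/
theorem measure_not_lassoSucceeds_le {n d k : ℕ} (hn : n ≠ 0) {Ω : Type*} [MeasurableSpace Ω]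
    {b : ℝ≥0} {P : Measure Ω} [IsProbabilityMeasure P] {ν : Measure (Fin d → ℝ)} {η : Measure ℝ}
    [IsProbabilityMeasure η] {x : Fin n → Ω → Fin d → ℝ} {ε : Fin n → Ω → ℝ}
    (hSG : ConditionSG b P ν η x ε) {β₀ : ℝ} {β : Fin d → ℝ} {βI : Sym2 (Fin d) → ℝ}
    {lam Cmin γ : ℝ} (hlam : 0 < lam) (hCmin : 0 < Cmin) (hγ : 0 < γ)
    {S : Finset (Fin d)} (hS : S = support β βI)
    {μ : Measure (Euc k)} {c : ℝ≥0} (h : IsIsotropic μ c) {a g : Fin d → Euc k}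
    (hν : ν = μ.map fun w j => inner ℝ (a j) w) {T : Finset (Fin k)}
    (haT : ∀ j ∈ S, ∀ l ∉ T, a j l = 0) {α : {l // l ∈ T} → Fin d → ℝ}
    (hα : ∀ l : {l // l ∈ T}, EuclideanSpace.single (l : Fin k) (1 : ℝ) = ∑ j ∈ S, α l j • a j)
    (hdual : ∀ i ∈ S, ∀ j ∈ S, inner ℝ (a j) (g i) = if i = j then (1 : ℝ) else 0)
    (hspan : ∀ i ∈ S, g i = ∑ j ∈ S, (inner ℝ (g i) (g j) : ℝ) • a j)
    (hg : ∀ u : Fin d → ℝ, ‖∑ i ∈ S, u i • g i‖ ^ 2 ≤ (∑ i ∈ S, u i ^ 2) / Cmin)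
    (hc : ∀ j ∉ S, ∑ i ∈ S, |inner ℝ (a j) (g i)| ≤ 1 - γ)
    {x1 x4 y1 y4 : ℝ} (hx1 : 0 ≤ x1) (hx1' : x1 ≤ 1 / 4)
    (h4 : x4 * (S.card / Cmin) ≤ (γ / 16) ^ 2) (h4' : x4 * y4 ≤ (γ * lam / 16) ^ 2)
    (h5 : x1 * y1 * (1 / Cmin) ≤ ((√S.card)⁻¹ / (2 * Cmin)) ^ 2) :
    P {ω | ¬ LassoSucceeds β βI lam Cmin
      (fun i => response ν β₀ β βI (x i ω) (ε i ω)) (fun i => x i ω)} ≤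
    (Measure.pi fun _ : Fin n => μ.prod η) {ω | ¬ ∀ j ∉ S,
      |(n : ℝ)⁻¹ * ∑ i, inner ℝ (a j - ∑ i ∈ S, (inner ℝ (a j) (g i) : ℝ) • a i) (ω i).1 *
        noise (pulledForm a (coefMatrix βI)) (ω i)| ≤ γ * lam / 4 ∧
      ∑ o, ((n : ℝ)⁻¹ * ∑ i, inner ℝ (a j - ∑ i ∈ S, (inner ℝ (a j) (g i) : ℝ) • a i) (ω i).1 *
        features T (ω i) o) ^ 2 ≤ x4 ∧
      (∑ o, ((n : ℝ)⁻¹ * ∑ i, inner ℝ (a j - ∑ i ∈ S, (inner ℝ (a j) (g i) : ℝ) • a i) (ω i).1 *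
        features T (ω i) o) ^ 2) *
        (∑ o, ((n : ℝ)⁻¹ * ∑ i, noise (pulledForm a (coefMatrix βI)) (ω i) *
          features T (ω i) o) ^ 2) ≤ x4 * y4} +
    (Measure.pi fun _ : Fin n => μ.prod η) {ω | ¬ (gramDev (fun i => features T (ω i)) ≤ x1 ∧
      ∑ o, ((n : ℝ)⁻¹ * ∑ i, noise (pulledForm a (coefMatrix βI)) (ω i) *
        features T (ω i) o) ^ 2 ≤ y1 ∧
      ∀ j ∈ S, |(n : ℝ)⁻¹ * ∑ i, noise (pulledForm a (coefMatrix βI)) (ω i) *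
        inner ℝ (g j) (ω i).1| ≤ (√S.card)⁻¹ / Cmin)} := by
  have hμ := h.isProbabilityMeasure
  have hA := IsIsotropic.measurable_linearImage a
  have hνp : IsProbabilityMeasure ν := by
    rw [hν]; exact Measure.isProbabilityMeasure_map hA.aemeasurable
  have hgT : ∀ j ∈ S, ∀ m ∉ T, g j m = 0 := by
    intro j hj m hm
    rw [hspan j hj]
    simp only [WithLp.ofLp_sum, WithLp.ofLp_smul, Finset.sum_apply, Pi.smul_apply, smul_eq_mul]
    exact Finset.sum_eq_zero fun i hi => by rw [haT i hi m hm, mul_zero]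
  set Γ : Set (Fin n → (Fin d → ℝ) × ℝ) :=
    goodSamples ν βI S α (fun j (l : {l // l ∈ T}) => a j l)
      (fun j (l : {l // l ∈ T}) => g j l) (fun j i => inner ℝ (a j) (g i)) (γ * lam / 4)
      x4 y4 x1 y1 ((√S.card)⁻¹ / Cmin) with hΓdef
  have hΓ : MeasurableSet Γ := measurableSet_goodSamples _ _ _ _ _ _ _ _ _ _ _ _ _
  have hsucc : ∀ ξ ∈ Γ, LassoSucceeds β βI lam Cmin
      (fun i => response ν β₀ β βI (ξ i).1 (ξ i).2) (fun i => (ξ i).1) := fun ξ hξ =>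
    lassoSucceeds_of_mem_goodSamples hn hlam hCmin hγ hS haT hgT hdual hspan hg hc hx1 hx1'
      h4 h4' h5 hξ
  obtain ⟨hXm, hXlaw⟩ := map_sample_eq hSG
  -- The observed sample has the law of the image of an isotropic sample under `Φ`, and the good
  -- event pulls back along both maps. No isotropic vector has to be constructed on `Ω` itself.
  let Φ : (Fin n → Euc k × ℝ) → Fin n → (Fin d → ℝ) × ℝ := fun ω i =>
    (fun j => inner ℝ (a j) (ω i).1, (ω i).2)
  have hΦ : MeasurePreserving Φ (Measure.pi fun _ : Fin n => μ.prod η)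
      (Measure.pi fun _ : Fin n => ν.prod η) :=
    measurePreserving_pi (fun _ : Fin n => μ.prod η) (fun _ : Fin n => ν.prod η)
      fun i => (⟨hA, hν.symm⟩ : MeasurePreserving _ μ ν).prod (MeasurePreserving.id η)
  have hφΦ : ∀ ω i, activeFeatures α S (Φ ω i).1 = features T (ω i) := by
    intro ω i
    ext o
    cases o with
    | none => rfl
    | some l =>
      have h1 := congrArg (fun v : Euc k => (inner ℝ v (ω i).1 : ℝ)) (hα l)
      simp only [EuclideanSpace.inner_single_left, map_one, one_mul, sum_inner,
        inner_smul_left, conj_trivial] at h1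
      exact h1.symm
  have heΦ : ∀ ω i j, regResidual (fun j i => inner ℝ (a j) (g i)) S (Φ ω i).1 j =
      inner ℝ (a j - ∑ i ∈ S, (inner ℝ (a j) (g i) : ℝ) • a i) (ω i).1 := by
    intro ω i j
    simp only [regResidual, Φ, inner_sub_left, sum_inner, inner_smul_left, conj_trivial]
  have hWΦ : ∀ ω i, rawNoise ν βI (Φ ω i) = noise (pulledForm a (coefMatrix βI)) (ω i) := by
    intro ω i
    simp only [rawNoise, Φ, noise]
    rw [hν, interactionEffect_linearImage h]
  have step1 : {ω | ¬ LassoSucceeds β βI lam Cmin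
      (fun i => response ν β₀ β βI (x i ω) (ε i ω)) (fun i => x i ω)} ⊆
      (fun ω i => (x i ω, ε i ω)) ⁻¹' Γᶜ := by
    intro ω hω
    rw [Set.mem_preimage, Set.mem_compl_iff]
    rw [Set.mem_ofPred_eq] at hω
    intro hω'
    have h1 := hsucc _ hω'
    dsimp only at h1
    exact hω h1
  have step2 : P ((fun ω i => (x i ω, ε i ω)) ⁻¹' Γᶜ) =
      (Measure.pi fun _ : Fin n => μ.prod η) (Φ ⁻¹' Γᶜ) := by
    rw [← Measure.map_apply_of_aemeasurable hXm hΓ.compl, hXlaw,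
      hΦ.measure_preimage hΓ.compl.nullMeasurableSet]
  refine (measure_mono step1).trans (step2.le.trans
    ((measure_mono ?_).trans (measure_union_le _ _)))
  intro ω hω
  by_contra hcon
  rw [Set.mem_union, not_or] at hcon
  obtain ⟨c1, c2⟩ := hcon
  rw [Set.mem_ofPred_eq, not_not] at c1 c2
  rw [Set.mem_preimage, Set.mem_compl_iff, hΓdef] at hω
  refine hω ⟨?_, ?_, ?_⟩
  · intro i k hk
    rw [hφΦ]
    exact (sum_subtype_mul_eq_inner (haT k hk) (ω i).1).symm
  · simp_rw [hφΦ, heΦ, hWΦ]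
    exact c1
  · simp_rw [hφΦ, hWΦ]
    refine ⟨c2.1, c2.2.1, fun j hj => ?_⟩
    have := c2.2.2 j hj
    simp_rw [← sum_subtype_mul_eq_inner (hgT j hj)] at this
    exact this

/-! ### Isotropic representation of the design -/

theorem covMatrix_isHermitian {d : ℕ} (ν : Measure (Fin d → ℝ)) : (covMatrix ν).IsHermitian := by
  ext i j
  simp only [covMatrix, Matrix.conjTranspose_apply, Matrix.of_apply, star_trivial]
  exact covariance_comm _ _

theorem le_variance_of_le_spectrum {d : ℕ} {ν : Measure (Fin d → ℝ)} {S : Finset (Fin d)}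
    {Cmin : ℝ} (h : ∀ x ∈ spectrum ℝ (blockSS (covMatrix ν) S), Cmin ≤ x) {j : Fin d}
    (hj : j ∈ S) : Cmin ≤ Var[fun v : Fin d → ℝ => v j; ν] := by
  have h1 := mul_dotProduct_le_of_le_spectrum
    ((covMatrix_isHermitian ν).submatrix (Subtype.val : {j // j ∈ S} → Fin d)) h
    (Pi.single ⟨j, hj⟩ 1)
  rw [← covariance_self (measurable_pi_apply j).aemeasurable]
  simpa [covMatrix] using h1

/-- The coefficients `α` express each coordinate in `T` through the active covariates, so the
features are functions of the observed data. The norm bound is the second moment bound `4 · 2! · b²`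
for a marginal. -/
theorem exists_isotropic_representation {d : ℕ} {ν : Measure (Fin d → ℝ)} {b : ℝ≥0}
    (hb : 0 < b) (hell : IsElliptical ν)
    (hsub : ∀ j, HasSubgaussianMGF (fun v : Fin d → ℝ => v j) (b ^ 2) ν)
    {S : Finset (Fin d)} (hS : S.Nonempty) {Cmin : ℝ≥0} (hC : 0 < Cmin)
    (hspec : ∀ x ∈ spectrum ℝ (blockSS (covMatrix ν) S), (Cmin : ℝ) ≤ x) :
    ∃ (k : ℕ) (μ : Measure (Euc k)) (a g : Fin d → Euc k) (T : Finset (Fin k))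
      (α : {l // l ∈ T} → Fin d → ℝ),
      IsIsotropic μ (b ^ 2 / Cmin) ∧ (ν = μ.map fun w j => inner ℝ (a j) w) ∧
      T.card ≤ S.card ∧ (∀ j ∈ S, ∀ l ∉ T, a j l = 0) ∧
      (∀ l : {l // l ∈ T}, EuclideanSpace.single (l : Fin k) (1 : ℝ) = ∑ j ∈ S, α l j • a j) ∧
      (∀ i ∈ S, ∀ j ∈ S, inner ℝ (a j) (g i) = if i = j then (1 : ℝ) else 0) ∧
      (∀ i ∈ S, g i = ∑ j ∈ S, (inner ℝ (g i) (g j) : ℝ) • a j) ∧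
      (∀ u : Fin d → ℝ, ‖∑ i ∈ S, u i • g i‖ ^ 2 ≤ (∑ i ∈ S, u i ^ 2) / Cmin) ∧
      (∀ i ∈ S, a i = ∑ j ∈ S, (inner ℝ (a j) (a i) : ℝ) • g j) ∧
      (∀ j ∉ S, ∑ i ∈ S, |inner ℝ (a j) (g i)| ≤ maxRowSum
        (blockScS (covMatrix ν) S * (blockSS (covMatrix ν) S)⁻¹)) ∧
      ∀ j, ‖a j‖ ^ 2 ≤ 8 * (b : ℝ) ^ 2 := by
  obtain ⟨j₀, hj₀⟩ := hS
  obtain ⟨k, μ, a₀, h, hν₀⟩ := exists_isIsotropic_of_isElliptical hell hsub hC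
    (le_variance_of_le_spectrum hspec hj₀)
  obtain ⟨a, T, hmap, hTS, haT, hα⟩ := exists_adapted_coordinates h a₀ S
  have hν : ν = μ.map fun w j => inner ℝ (a j) w := hν₀.trans hmap
  choose α hα using hα
  have hcov : covMatrix ν = Matrix.gram ℝ a := by rw [hν]; exact h.covMatrix_map a
  rw [hcov] at hspec ⊢
  obtain ⟨g, g1, g2, g3, g4, g5⟩ := exists_dual_vectors a S (NNReal.coe_pos.2 hC) hspec
  refine ⟨k, μ, a, g, T, fun l => α l l.2, h, hν, hTS, haT, fun l => hα l l.2, g1, g2, g3, g4, g5,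
    fun j => ?_⟩
  have hμ := h.isProbabilityMeasure
  have hA := IsIsotropic.measurable_linearImage a
  have hνp : IsProbabilityMeasure ν := by
    rw [hν]; exact Measure.isProbabilityMeasure_map hA.aemeasurable
  have h1 := integral_pow_le_of_subgaussian (pow_pos hb 2) (hsub j) 1
  have h2 : ∫ v, v j ^ (2 * 1) ∂ν = ‖a j‖ ^ 2 := by
    rw [← h.integral_sq, hν, integral_map hA.aemeasurable
      ((measurable_pi_apply j).pow_const _).aestronglyMeasurable]
  rw [h2] at h1
  norm_num at h1
  linarith

/-- Each basis vector indexed by `T` lies in the span of the active vectors, to which the regression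
residual is orthogonal. -/
theorem residual_apply_eq_zero {d k : ℕ} {a g : Fin d → Euc k} {S : Finset (Fin d)}
    {T : Finset (Fin k)} {α : {l // l ∈ T} → Fin d → ℝ}
    (hα : ∀ l : {l // l ∈ T}, EuclideanSpace.single (l : Fin k) (1 : ℝ) = ∑ j ∈ S, α l j • a j)
    (hreg : ∀ i ∈ S, a i = ∑ j ∈ S, (inner ℝ (a j) (a i) : ℝ) • g j) (v : Euc k) {l : Fin k}
    (hl : l ∈ T) : (v - ∑ i ∈ S, (inner ℝ v (g i) : ℝ) • a i) l = 0 := by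
  set f := v - ∑ i ∈ S, (inner ℝ v (g i) : ℝ) • a i with hf
  have h1 : (inner ℝ f (EuclideanSpace.single l (1 : ℝ)) : ℝ) = 0 := by
    rw [hα ⟨l, hl⟩, inner_sum]
    refine Finset.sum_eq_zero fun i hi => ?_
    rw [inner_smul_right, hf, inner_regression_residual hreg v hi, mul_zero]
  simpa [EuclideanSpace.inner_single_right] using h1

/-! ### Numerical bounds -/

theorem ofReal_le_one_div {A x N : ℝ} (hx : 0 < x) (hN : 0 < N) (h : A * N ≤ x) :
    ENNReal.ofReal (A / x) ≤ ENNReal.ofReal (1 / N) := by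
  refine ENNReal.ofReal_le_ofReal ?_
  rw [div_le_div_iff₀ hx hN]
  linarith

/-- For `d ≥ 2` one has `log d ≥ 1 / 2`, so `log d * (1 + 2 N)` pays for the union and leaves `N`.
-/
theorem union_tail_le {d : ℕ} {N E : ℝ} (hd : 2 ≤ d) (hN : 1 ≤ N)
    (hE : Real.log d * (1 + 2 * N) ≤ E) :
    d * (2 * Real.exp (-E)) ≤ 2 * Real.exp (-N) := by
  have hd0 : (0 : ℝ) < d := by positivity
  have hlog : 1 / 2 ≤ Real.log d := by
    have h1 : Real.log 2 ≤ Real.log d := Real.log_le_log (by norm_num) (by exact_mod_cast hd)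
    linarith [Real.log_two_gt_d9]
  have h2 : (d : ℝ) * Real.exp (-E) ≤ Real.exp (-N) := by
    nth_rewrite 1 [← Real.exp_log hd0]
    rw [← Real.exp_add]
    exact Real.exp_le_exp.2 (by nlinarith)
  linarith

/-- The exponent covers the union over `d` by `log d` and the decoupling price by `s + 1`, since `2
< e`. -/
theorem union_two_pow_tail_le {d t : ℕ} {s N E : ℝ} (hd : 0 < d) (hts : (t : ℝ) ≤ s)
    (hE : s + 1 + Real.log d + N ≤ E) :
    d * (2 ^ (t + 1) * Real.exp (-E)) ≤ Real.exp (-N) := by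
  have hd0 : (0 : ℝ) < d := by positivity
  have h2 : (2 : ℝ) ^ (t + 1) ≤ Real.exp (t + 1) := by
    calc (2 : ℝ) ^ (t + 1) ≤ Real.exp 1 ^ (t + 1) := by
          gcongr; linarith [Real.exp_one_gt_d9]
      _ = Real.exp (t + 1) := by rw [← Real.exp_nat_mul]; push_cast; ring_nf
  calc (d : ℝ) * (2 ^ (t + 1) * Real.exp (-E))
      ≤ Real.exp (Real.log d) * (Real.exp (t + 1) * Real.exp (-E)) := by
        rw [Real.exp_log hd0]; gcongr
    _ = Real.exp (Real.log d + (t + 1 + -E)) := by rw [← Real.exp_add, ← Real.exp_add]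
    _ ≤ _ := Real.exp_le_exp.2 (by linarith)

/-! ### Probabilities of the exceptional events -/

/-- The Gram level is of order `N s² / n` and the score level of order `N s³ / n`. Their product is
of order `(N s³ / n)² / s`, so `n ≥ C N s³` brings it below the squared budget, of order `1 / s`. -/
theorem active_level_le {M K C N s n Cmin : ℝ} (hCmin : 0 < Cmin)
    (hC : 1 ≤ C) (hC2 : 32 * M * K * Cmin ≤ C) (hN : 1 ≤ N) (hs : 1 ≤ s) (hn : C * N * s ^ 3 ≤ n) :
    (N * (4 * s ^ 2 * M) / n) * (N * (2 * K * s ^ 3) / n) * (1 / Cmin) ≤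
      ((√s)⁻¹ / (2 * Cmin)) ^ 2 := by
  have hn0 : 0 < n := lt_of_lt_of_le (by positivity) hn
  have hs0 : 0 < s := by linarith
  have e1 : ((√s)⁻¹ / (2 * Cmin)) ^ 2 = 1 / (4 * s * Cmin ^ 2) := by
    rw [div_pow, inv_pow, Real.sq_sqrt hs0.le]; field_simp; ring
  have e2 : (N * (4 * s ^ 2 * M) / n) * (N * (2 * K * s ^ 3) / n) * (1 / Cmin) =
      8 * M * K * N ^ 2 * s ^ 5 / (n ^ 2 * Cmin) := by field_simp; ring
  rw [e1, e2, div_le_div_iff₀ (by positivity) (by positivity)]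
  have h1 : (C * N * s ^ 3) ^ 2 ≤ n ^ 2 := by gcongr
  have h2 : 32 * M * K * Cmin * (N * s ^ 3) ^ 2 ≤ n ^ 2 := by
    calc 32 * M * K * Cmin * (N * s ^ 3) ^ 2 ≤ C * (N * s ^ 3) ^ 2 := by gcongr
      _ ≤ C ^ 2 * (N * s ^ 3) ^ 2 := by
        gcongr; nlinarith
      _ ≤ n ^ 2 := by rw [← mul_pow, ← mul_assoc]; exact h1
  calc 8 * M * K * N ^ 2 * s ^ 5 * (4 * s * Cmin ^ 2) =
        32 * M * K * Cmin * (N * s ^ 3) ^ 2 * Cmin := by ring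
    _ ≤ n ^ 2 * Cmin := by gcongr
    _ = _ := by ring

/-- A squared deviation of order `1 / s` over a variance of order `s² / n`: this is where the
exponent `n / s³` originates. -/
theorem active_exponent_ge {K C s n Cmin : ℝ} (hK : 0 < K) (hCmin : 0 < Cmin)
    (hC : 4 * K * Cmin ^ 2 ≤ C) (hs : 1 ≤ s) (hn : 0 < n) :
    n / (C * s ^ 3) ≤ ((√s)⁻¹ / Cmin) ^ 2 / (2 * (2 * (K * s ^ 2) / n)) := by
  have hs0 : 0 < s := by linarith
  have e1 : ((√s)⁻¹ / Cmin) ^ 2 / (2 * (2 * (K * s ^ 2) / n)) =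
      n / (4 * K * Cmin ^ 2 * s ^ 3) := by
    rw [div_pow, inv_pow, Real.sq_sqrt hs0.le]; field_simp; ring
  rw [e1]
  gcongr

namespace IsIsotropic

variable {k : ℕ} {μ : Measure (Euc k)} {c ce : ℝ≥0} {η : Measure ℝ} [IsProbabilityMeasure η]
  {T : Finset (Fin k)} {Q : Matrix (Fin k) (Fin k) ℝ} {n d : ℕ}

/-- The exceptional event for the active variables at a suitable level. -/
theorem exists_measure_active_le (h : IsIsotropic μ c) (hc : 0 < c)
    (hη : HasSubgaussianMGF (fun e : ℝ => e) ce η) {S : Finset (Fin d)} (hS : S.Nonempty) {K : ℝ}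
    (hK0 : 0 ≤ K) (hK : ∫ z, noise Q z ^ 8 ∂(μ.prod η) ≤ K * (S.card : ℝ) ^ 8)
    (hTS : T.card ≤ S.card) {g : Fin d → Euc k} {Cmin : ℝ} (hCmin : 0 < Cmin)
    (hg : ∀ j ∈ S, ‖g j‖ ^ 2 ≤ 1 / Cmin) {C N : ℝ} (hC : 1 ≤ C)
    (hC1 : 16 * (1 + 96 * (c : ℝ) ^ 2) ≤ C)
    (hC2 : 32 * (1 + 96 * (c : ℝ) ^ 2) * (K + 1 + 96 * (c : ℝ) ^ 2) * Cmin ≤ C)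
    (hC3 : 4 * (K + 161280 * ((c : ℝ) * (1 / Cmin)) ^ 4 + 1) * Cmin ^ 2 ≤ C)
    (hN : 1 ≤ N) (hn : C * N * (S.card : ℝ) ^ 3 ≤ n) :
    ∃ x y : ℝ, 0 ≤ x ∧ x ≤ 1 / 4 ∧ x * y * (1 / Cmin) ≤ ((√S.card)⁻¹ / (2 * Cmin)) ^ 2 ∧
    (Measure.pi fun _ : Fin n => μ.prod η) {ω | ¬ (gramDev (fun i => features T (ω i)) ≤ x ∧
      ∑ o, ((n : ℝ)⁻¹ * ∑ i, noise Q (ω i) * features T (ω i) o) ^ 2 ≤ y ∧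
      ∀ j ∈ S, |(n : ℝ)⁻¹ * ∑ i, noise Q (ω i) * inner ℝ (g j) (ω i).1| ≤
        (√S.card)⁻¹ / Cmin)} ≤
      ENNReal.ofReal (1 / N) + ENNReal.ofReal (1 / N) + ENNReal.ofReal ((S.card : ℝ) ^ 3 / n) +
      ENNReal.ofReal (2 * S.card * Real.exp (-(n / (C * (S.card : ℝ) ^ 3)))) := by
  have hs : (1 : ℝ) ≤ S.card := by exact_mod_cast hS.card_pos
  have hT : (T.card : ℝ) + 1 ≤ 2 * S.card := by
    have : (T.card : ℝ) ≤ S.card := by exact_mod_cast hTS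
    linarith
  set s : ℝ := (S.card : ℝ) with hsdef
  have hs0 : 0 < s := by linarith
  have hn0 : (0 : ℝ) < n := lt_of_lt_of_le (by positivity) hn
  have hn' : n ≠ 0 := by
    rintro rfl
    simp at hn0
  set M : ℝ := 1 + 96 * (c : ℝ) ^ 2 with hM
  have hM0 : 0 < M := by positivity
  have hK9 : K + 1 + 96 * (c : ℝ) ^ 2 = K + M := by rw [hM]; ring
  rw [hK9] at hC2
  have hKM : 0 < K + M := by positivity
  refine ⟨N * (4 * s ^ 2 * M) / n, N * (2 * (K + M) * s ^ 3) / n, by positivity, ?_,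
    active_level_le hCmin hC hC2 hN hs hn, ?_⟩
  · rw [div_le_iff₀ hn0]
    have : 16 * M * N * s ^ 2 ≤ C * N * s ^ 3 := by
      gcongr
      norm_num
    linarith
  · refine (h.measure_active_le (T := T) hc hη hs0 hK hg hn' (x := N * (4 * s ^ 2 * M) / n)
      (y := N * (2 * (K + M) * s ^ 3) / n) (by positivity) (by positivity)
      (t := (√s)⁻¹ / Cmin) (by positivity)).trans ?_
    rw [← hM, hK9]
    refine add_le_add (add_le_add (add_le_add ?_ ?_) ?_) ?_
    · refine ofReal_le_one_div (by positivity) (by positivity) ?_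
      calc (n : ℝ)⁻¹ * (((T.card : ℝ) + 1) ^ 2 * M) * N ≤ (n : ℝ)⁻¹ * ((2 * s) ^ 2 * M) * N := by
            gcongr
        _ = _ := by field_simp; ring
    · refine ofReal_le_one_div (by positivity) (by positivity) ?_
      calc (n : ℝ)⁻¹ * (((T.card : ℝ) + 1) * ((K + M) * s ^ 2)) * N ≤
            (n : ℝ)⁻¹ * (2 * s * ((K + M) * s ^ 2)) * N := by gcongr
        _ = _ := by field_simp
    · refine ENNReal.ofReal_le_ofReal ?_
      rw [div_eq_mul_inv]
      gcongr
      exact le_self_pow₀ hs (by norm_num)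
    · refine ENNReal.ofReal_le_ofReal ?_
      have h1 := active_exponent_ge (K := K + 161280 * ((c : ℝ) * (1 / Cmin)) ^ 4 + 1)
        (by positivity) hCmin hC3 hs hn0
      calc s * (2 * Real.exp (-(((√s)⁻¹ / Cmin) ^ 2 / (2 * (2 * ((K +
            161280 * ((c : ℝ) * (1 / Cmin)) ^ 4 + 1) * s ^ 2) / n))))) ≤
            s * (2 * Real.exp (-(n / (C * s ^ 3)))) := by gcongr
        _ = _ := by ring

end IsIsotropic

/-- The factor `(s + 1 + L + N) s / n` is at most `1 / C` by the sparsity requirement, and `L (1 + 2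
N) ≥ 1` disposes of the rest; what remains is `lam²` with a constant beaten by `C`. -/
theorem inactive_level_le {M B R C N s L n lam γ : ℝ} (hM : 0 < M) (hB : 0 < B) (hR : 0 < R)
    (hC : 1 ≤ C) (hγ : 0 < γ) (hC2 : 4096 * B * R * M / γ ^ 2 ≤ C) (hN : 1 ≤ N) (hs : 1 ≤ s)
    (hL : 1 / 2 ≤ L) (hn0 : 0 < n) (hn : C * (s + 1 + L + N) * s ≤ n) :
    (4 * B * R / n * (s + 1 + L + N)) *
      (4 * N * s * M * (lam ^ 2 * n / (L * (C * N * (1 + 2 * N)))) / n) ≤ (γ * lam / 16) ^ 2 := by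
  have hL0 : 0 < L := by linarith
  have e : (4 * B * R / n * (s + 1 + L + N)) *
      (4 * N * s * M * (lam ^ 2 * n / (L * (C * N * (1 + 2 * N)))) / n) =
      (16 * B * R * M * lam ^ 2) * ((s + 1 + L + N) * s / n) * (1 / (C * (L * (1 + 2 * N)))) := by
    field_simp; ring
  have h1 : (s + 1 + L + N) * s / n ≤ 1 / C := by
    rw [div_le_div_iff₀ hn0 (by positivity)]; linarith
  have h2 : 1 / (C * (L * (1 + 2 * N))) ≤ 1 := by
    rw [div_le_one (by positivity)]
    have : 1 ≤ L * (1 + 2 * N) := by nlinarith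
    nlinarith
  have h3 : 16 * B * R * M / C ≤ γ ^ 2 / 256 := by
    rw [div_le_iff₀ (by positivity)] at hC2 ⊢
    nlinarith
  rw [e]
  calc _ ≤ (16 * B * R * M * lam ^ 2) * (1 / C) * 1 := by gcongr
    _ = (16 * B * R * M / C) * lam ^ 2 := by field_simp
    _ ≤ γ ^ 2 / 256 * lam ^ 2 := by gcongr
    _ = _ := by ring

/-- The noise level allowed by the tuning parameter carries `L` and `1 + 2 N` in its denominator
precisely so that they reappear in the exponent and pay for the union over variables. -/
theorem inactive_exponent_ge {M B C N L n lam γ : ℝ} (hM : 0 < M) (hB : 0 < B)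
    (hC : 1 ≤ C) (hγ : 0 < γ) (hC2 : 64 * B * M / γ ^ 2 ≤ C) (hN : 1 ≤ N)
    (hL : 0 < L) (hn0 : 0 < n) (hlam : 0 < lam) :
    L * (1 + 2 * N) ≤ (γ * lam / 4) ^ 2 /
      (2 * (B * (2 * M * N * (lam ^ 2 * n / (L * (C * N * (1 + 2 * N))))) / n)) := by
  have e : (γ * lam / 4) ^ 2 /
      (2 * (B * (2 * M * N * (lam ^ 2 * n / (L * (C * N * (1 + 2 * N))))) / n)) =
      L * (1 + 2 * N) * (γ ^ 2 * C / (64 * B * M)) := by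
    field_simp; ring
  rw [e]
  refine le_mul_of_one_le_right (by positivity) ?_
  rw [div_le_iff₀ (by positivity)] at hC2
  rw [one_le_div (by positivity)]
  linarith

namespace IsIsotropic

variable {k : ℕ} {μ : Measure (Euc k)} {c ce : ℝ≥0} {η : Measure ℝ} [IsProbabilityMeasure η]
  {T : Finset (Fin k)} {Q : Matrix (Fin k) (Fin k) ℝ} {n d : ℕ}

/-- The exceptional event for the inactive variables at a suitable level. -/
theorem exists_measure_inactive_le (h : IsIsotropic μ c) (hc : 0 < c)
    (hη : HasSubgaussianMGF (fun e : ℝ => e) ce η) (hQ : Q.IsHermitian)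
    (hQT : ∀ l, ∀ m ∉ T, Q l m = 0) {f : Fin d → Euc k}
    {S : Finset (Fin d)} (hS : S.Nonempty) (hTS : T.card ≤ S.card)
    (hf : ∀ j ∉ S, ∀ l ∈ T, f j l = 0) {B : ℝ} (hB0 : 0 < B)
    (hB : ∀ j ∉ S, ‖f j‖ ^ 2 ≤ B) {lam γ Cmin C N : ℝ} (hlam : 0 < lam) (hγ : 0 < γ)
    (hCmin : 0 < Cmin) (hC : 1 ≤ C) (hN : 1 ≤ N)
    (hC1 : 4 * (1 + 161280 * (c : ℝ) ^ 4) ≤ C)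
    (hC2 : 4096 * B * (3 + 192 * (c : ℝ) ^ 2) * (60000 * (c : ℝ) ^ 3 + 16 * c + 1) / γ ^ 2 ≤ C)
    (hC3 : 64 * B * (60000 * (c : ℝ) ^ 3 + 16 * c + 1) / γ ^ 2 ≤ C)
    (hC4 : 1024 * B * (3 + 192 * (c : ℝ) ^ 2) / (γ ^ 2 * Cmin) ≤ C)
    (hn0 : n ≠ 0) (hn : C * (S.card + 1 + Real.log d + N) * S.card ≤ n)
    (hD : (∫ w, centeredForm Q w ^ 2 ∂μ + ∫ e, e ^ 2 ∂η) * (Real.log d * (C * N * (1 + 2 * N))) ≤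
      lam ^ 2 * n) :
    ∃ x y : ℝ, x * (S.card / Cmin) ≤ (γ / 16) ^ 2 ∧ x * y ≤ (γ * lam / 16) ^ 2 ∧
    (Measure.pi fun _ : Fin n => μ.prod η) {ω | ¬ ∀ j ∉ S,
      |(n : ℝ)⁻¹ * ∑ i, inner ℝ (f j) (ω i).1 * noise Q (ω i)| ≤ γ * lam / 4 ∧
      ∑ o, ((n : ℝ)⁻¹ * ∑ i, inner ℝ (f j) (ω i).1 * features T (ω i) o) ^ 2 ≤ x ∧
      (∑ o, ((n : ℝ)⁻¹ * ∑ i, inner ℝ (f j) (ω i).1 * features T (ω i) o) ^ 2) *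
        (∑ o, ((n : ℝ)⁻¹ * ∑ i, noise Q (ω i) * features T (ω i) o) ^ 2) ≤ x * y} ≤
      ENNReal.ofReal (C * ((S.card : ℝ) ^ 3 / n)) + ENNReal.ofReal (1 / N) +
      ENNReal.ofReal (1 / N) + ENNReal.ofReal (2 * Real.exp (-N)) +
      ENNReal.ofReal (Real.exp (-N)) := by
  -- Without inactive variables there is nothing to show, and `log d` may vanish. Otherwise `d ≥ 2`,
  -- as `S` is nonempty, and `log d` is bounded below.
  by_cases hSu : ∀ j, j ∈ S
  · refine ⟨0, 0, by rw [zero_mul]; positivity, by rw [zero_mul]; positivity, ?_⟩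
    refine le_of_eq_of_le ?_ (zero_le (a := _))
    convert measure_empty (μ := Measure.pi fun _ : Fin n => μ.prod η)
    rw [Set.eq_empty_iff_forall_notMem]
    exact fun ω hω => hω fun j hj => absurd (hSu j) hj
  push Not at hSu
  obtain ⟨j₁, hj₁⟩ := hSu
  obtain ⟨j₀, hj₀⟩ := hS
  have hd : 2 ≤ d := by
    have : j₀ ≠ j₁ := fun h => hj₁ (h ▸ hj₀)
    have h1 := j₀.2
    have h2 := j₁.2
    have h3 : (j₀ : ℕ) ≠ j₁ := fun h => this (Fin.ext h)
    omega
  have hs : (1 : ℝ) ≤ S.card := by exact_mod_cast Finset.card_pos.2 ⟨j₀, hj₀⟩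
  have hTs : (T.card : ℝ) ≤ S.card := by exact_mod_cast hTS
  have hn0' : (0 : ℝ) < n := by exact_mod_cast Nat.pos_of_ne_zero hn0
  have hL : 1 / 2 ≤ Real.log d := by
    have h1 : Real.log 2 ≤ Real.log d := Real.log_le_log (by norm_num) (by exact_mod_cast hd)
    linarith [Real.log_two_gt_d9]
  set s : ℝ := (S.card : ℝ) with hsdef
  set L : ℝ := Real.log d with hLdef
  have hL0 : 0 < L := by linarith
  set M : ℝ := 60000 * (c : ℝ) ^ 3 + 16 * c + 1 with hM
  set R : ℝ := 3 + 192 * (c : ℝ) ^ 2 with hR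
  have hM0 : 0 < M := by positivity
  have hR0 : 0 < R := by positivity
  have hD' : ∫ w, centeredForm Q w ^ 2 ∂μ + ∫ e, e ^ 2 ∂η ≤
      lam ^ 2 * n / (L * (C * N * (1 + 2 * N))) := by
    rw [le_div_iff₀ (by positivity)]; exact hD
  -- The largest noise variance compatible with the tuning parameter. Replacing the true variance by
  -- it keeps the levels positive even when there is no noise.
  set D : ℝ := lam ^ 2 * n / (L * (C * N * (1 + 2 * N))) with hDdef
  have hD0 : 0 < D := by positivity
  refine ⟨4 * B * R / n * (s + 1 + L + N), 4 * N * s * M * D / n, ?_,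
    inactive_level_le hM0 hB0 hR0 hC hγ hC2 hN hs hL hn0' hn, ?_⟩
  · rw [div_le_iff₀ (by positivity)] at hC4
    have h1 : (s + 1 + L + N) * s / n ≤ 1 / C := by
      rw [div_le_div_iff₀ hn0' (by positivity)]; linarith
    calc 4 * B * R / n * (s + 1 + L + N) * (s / Cmin) =
          4 * B * R / Cmin * ((s + 1 + L + N) * s / n) := by field_simp
      _ ≤ 4 * B * R / Cmin * (1 / C) := by gcongr
      _ = 4 * B * R / (Cmin * C) := by field_simp
      _ ≤ (γ / 16) ^ 2 := by rw [div_le_iff₀ (by positivity)]; nlinarith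
  · refine (h.measure_inactive_le (T := T) hc hη hQ hQT hD' hf hB0 hB hn0
      (V := 2 * M * N * D) (x := 4 * B * R / n * (s + 1 + L + N)) (y := 4 * N * s * M * D / n)
      (t := γ * lam / 4) (by positivity) (by positivity) (by positivity) (by positivity)).trans ?_
    rw [← hM, ← hR]
    refine add_le_add (add_le_add (add_le_add (add_le_add ?_ ?_) ?_) ?_) ?_
    · refine ENNReal.ofReal_le_ofReal ?_
      have h1 : ((T.card : ℝ) + 1) ^ 2 ≤ (2 * s) ^ 2 := by gcongr; linarith
      calc (n : ℝ)⁻¹ * (((T.card : ℝ) + 1) ^ 2 * (1 + 161280 * (c : ℝ) ^ 4)) ≤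
            (n : ℝ)⁻¹ * ((2 * s) ^ 2 * (1 + 161280 * (c : ℝ) ^ 4)) := by gcongr
        _ = (n : ℝ)⁻¹ * (4 * (1 + 161280 * (c : ℝ) ^ 4)) * s ^ 2 := by ring
        _ ≤ (n : ℝ)⁻¹ * C * s ^ 3 := by
          gcongr
          norm_num
        _ = _ := by field_simp
    · refine ofReal_le_one_div (by positivity) (by positivity) (le_of_eq (by ring))
    · refine ofReal_le_one_div (by positivity) (by positivity) ?_
      have h1 : (T.card : ℝ) + 1 ≤ 2 * s := by linarith
      calc (n : ℝ)⁻¹ * (((T.card : ℝ) + 1) * (2 * M * D)) * N ≤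
            (n : ℝ)⁻¹ * (2 * s * (2 * M * D)) * N := by gcongr
        _ = _ := by field_simp; ring
    · exact ENNReal.ofReal_le_ofReal (union_tail_le hd hN
        (inactive_exponent_ge hM0 hB0 hC hγ hC3 hN hL0 hn0' hlam))
    · refine ENNReal.ofReal_le_ofReal (union_two_pow_tail_le (s := s) (by omega) hTs (le_of_eq ?_))
      rw [hLdef]
      field_simp

end IsIsotropic

/-! ### The failure probability -/

/-- The failure probability of the LASSO at a fixed sample size, with a constant that depends only
on the subgaussian scale, the incoherence parameter and the two spectral bounds. -/
theorem exists_measure_not_lassoSucceeds_le {b : ℝ≥0} {γ Cmin CB : ℝ} (hb : 0 < b) (hγ : 0 < γ)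
    (hCmin : 0 < Cmin) (hCB : 0 < CB) :
    ∃ C : ℝ, 1 ≤ C ∧ ∀ {n d : ℕ} (_ : n ≠ 0) {Ω : Type*} [MeasurableSpace Ω]
      {P : Measure Ω} [IsProbabilityMeasure P] {ν : Measure (Fin d → ℝ)} {η : Measure ℝ}
      {x : Fin n → Ω → Fin d → ℝ} {ε : Fin n → Ω → ℝ} (_ : ConditionSG b P ν η x ε)
      {β₀ : ℝ} {β : Fin d → ℝ} {βI : Sym2 (Fin d) → ℝ} {lam N : ℝ} (_ : 0 < lam) (_ : 1 ≤ N)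
      (_ : (support β βI).Nonempty)
      (_ : maxRowSum (blockScS (covMatrix ν) (support β βI) *
        (blockSS (covMatrix ν) (support β βI))⁻¹) ≤ 1 - γ)
      (_ : ∀ μ ∈ spectrum ℝ (blockSS (covMatrix ν) (support β βI)), Cmin ≤ μ)
      (_ : ∀ μ ∈ spectrum ℝ (coefMatrix βI * coefMatrix βI), μ ≤ CB ^ 2)
      (_ : C * N * ((support β βI).card : ℝ) ^ 3 ≤ n)
      (_ : C * ((support β βI).card + 1 + Real.log d + N) * (support β βI).card ≤ n)
      (_ : (interactionSD ν βI ^ 2 + errorSD η ^ 2) * (Real.log d * (C * N * (1 + 2 * N))) ≤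
        lam ^ 2 * n),
      P {ω | ¬ LassoSucceeds β βI lam Cmin
        (fun i => response ν β₀ β βI (x i ω) (ε i ω)) (fun i => x i ω)} ≤
      ENNReal.ofReal (4 / N + 3 * Real.exp (-N) +
        ((C + 1) * (((support β βI).card : ℝ) ^ 3 / n) +
          2 * (support β βI).card * Real.exp (-(n / (C * ((support β βI).card : ℝ) ^ 3))))) := by
  lift Cmin to ℝ≥0 using hCmin.le
  have hCm : 0 < Cmin := by exact_mod_cast hCmin
  obtain ⟨c, hcdef⟩ : ∃ c : ℝ≥0, c = b ^ 2 / Cmin := ⟨_, rfl⟩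
  have hc : 0 < c := by rw [hcdef]; positivity
  obtain ⟨K, hKdef⟩ : ∃ K : ℝ, K = 128 * (128 * (CB ^ 8 * (4 * (Nat.factorial 16) *
      (c * (8 * (b : ℝ) ^ 2)) ^ 8 + (8 * (b : ℝ) ^ 2) ^ 8)) + 161280 * ((b : ℝ) ^ 2) ^ 4) := ⟨_, rfl⟩
  have hb' : (0 : ℝ) < b := by exact_mod_cast hb
  have hc' : (0 : ℝ) < c := by exact_mod_cast hc
  have hK0 : 0 ≤ K := by rw [hKdef]; positivity
  obtain ⟨B, hBdef⟩ : ∃ B : ℝ, B = 8 * (b : ℝ) ^ 2 := ⟨_, rfl⟩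
  have hB0 : 0 < B := by rw [hBdef]; positivity
  obtain ⟨A1, hA1⟩ : ∃ A : ℝ, A = 16 * (1 + 96 * (c : ℝ) ^ 2) := ⟨_, rfl⟩
  obtain ⟨A2, hA2⟩ : ∃ A : ℝ, A = 32 * (1 + 96 * (c : ℝ) ^ 2) * (K + 1 + 96 * (c : ℝ) ^ 2) *
    Cmin := ⟨_, rfl⟩
  obtain ⟨A3, hA3⟩ : ∃ A : ℝ, A = 4 * (K + 161280 * ((c : ℝ) * (1 / Cmin)) ^ 4 + 1) *
    (Cmin : ℝ) ^ 2 := ⟨_, rfl⟩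
  obtain ⟨A4, hA4⟩ : ∃ A : ℝ, A = 4 * (1 + 161280 * (c : ℝ) ^ 4) := ⟨_, rfl⟩
  obtain ⟨A5, hA5⟩ : ∃ A : ℝ, A = 4096 * B * (3 + 192 * (c : ℝ) ^ 2) *
    (60000 * (c : ℝ) ^ 3 + 16 * c + 1) / γ ^ 2 := ⟨_, rfl⟩
  obtain ⟨A6, hA6⟩ : ∃ A : ℝ, A = 64 * B * (60000 * (c : ℝ) ^ 3 + 16 * c + 1) / γ ^ 2 := ⟨_, rfl⟩
  obtain ⟨A7, hA7⟩ : ∃ A : ℝ, A = 1024 * B * (3 + 192 * (c : ℝ) ^ 2) / (γ ^ 2 * Cmin) := ⟨_, rfl⟩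
  have p1 : 0 ≤ A1 := by rw [hA1]; positivity
  have p2 : 0 ≤ A2 := by rw [hA2]; positivity
  have p3 : 0 ≤ A3 := by rw [hA3]; positivity
  have p4 : 0 ≤ A4 := by rw [hA4]; positivity
  have p5 : 0 ≤ A5 := by rw [hA5]; positivity
  have p6 : 0 ≤ A6 := by rw [hA6]; positivity
  have p7 : 0 ≤ A7 := by rw [hA7]; positivity
  -- Summing nonnegative requirements meets all of them at once, before the sample size, the
  -- dimension or the laws are introduced.
  obtain ⟨C, hCdef⟩ : ∃ C : ℝ, C = 1 + A1 + A2 + A3 + A4 + A5 + A6 + A7 := ⟨_, rfl⟩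
  have hC : 1 ≤ C := by linarith
  refine ⟨C, hC, ?_⟩
  intro n d hn Ω _ P _ ν η x ε hSG β₀ β βI lam N hlam hN hS hC1 hC2 hC4 hn1 hn2 hn3
  -- That the error law has mass one is inherited from the first error, which exists because `n ≠
  -- 0`.
  have hη : IsProbabilityMeasure η := by
    rw [← (hSG.law_error ⟨0, Nat.pos_of_ne_zero hn⟩).map_eq]
    exact Measure.isProbabilityMeasure_map (hSG.law_error _).aemeasurable
  obtain ⟨k, μ, a, g, T, α, h, hν, hTS, haT, hα, hdual, hspan, hg, hreg, hmax, ha⟩ :=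
    exists_isotropic_representation hb hSG.elliptical hSG.subgaussian_marginal hS hCm hC2
  rw [← hcdef] at h
  have hμ := h.isProbabilityMeasure
  obtain ⟨S, hSdef⟩ : ∃ S, S = support β βI := ⟨_, rfl⟩
  obtain ⟨Q, hQdef⟩ : ∃ Q, Q = pulledForm a (coefMatrix βI) := ⟨_, rfl⟩
  have hQ : Q.IsHermitian := by
    rw [hQdef]; exact pulledForm_isHermitian a (coefMatrix_isHermitian βI)
  have hQT : ∀ l, ∀ m ∉ T, Q l m = 0 := fun l m hm => by
    rw [hQdef]
    exact pulledForm_eq_zero a haT (fun i j hj => coefMatrix_eq_zero' β βI hj) hm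
  have h8 : ∫ z, noise Q z ^ 8 ∂(μ.prod η) ≤ K * (S.card : ℝ) ^ 8 := by
    have h1 := h.integral_centeredForm_pow_eight_le hc (Q := Q) (a := a) (S := S) (C := CB)
      (V := 8 * (b : ℝ) ^ 2) hCB.le (fun w => by
        rw [hQdef, dotProduct_pulledForm, hSdef]
        exact abs_coefMatrix_form_le β βI hCB.le hC4 _) (fun j _ => ha j)
    have h2 := h.integral_noise_pow_eight_le (Q := Q) hSG.subgaussian_error (pow_pos hb 2)
    have hs : (1 : ℝ) ≤ (S.card : ℝ) ^ 8 := one_le_pow₀ (by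
      rw [hSdef]; exact_mod_cast hS.card_pos)
    have h3 : 161280 * ((b : ℝ) ^ 2) ^ 4 ≤ 161280 * ((b : ℝ) ^ 2) ^ 4 * (S.card : ℝ) ^ 8 :=
      le_mul_of_one_le_right (by positivity) hs
    rw [NNReal.coe_pow] at h2
    rw [hKdef]
    linarith
  have hg1 : ∀ j ∈ S, ‖g j‖ ^ 2 ≤ 1 / (Cmin : ℝ) := fun j hj => by
    have := hg (Pi.single j 1)
    rw [hSdef] at hj
    rw [Finset.sum_eq_single_of_mem j hj fun i _ hij => by rw [Pi.single_eq_of_ne hij, zero_smul],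
      Finset.sum_eq_single_of_mem j hj fun i _ hij => by
        rw [Pi.single_eq_of_ne hij, zero_pow two_ne_zero]] at this
    simpa using this
  rw [← hSdef] at hS hC1 hTS haT hα hdual hspan hg hreg hmax hn1 hn2 ⊢
  obtain ⟨x1, y1, hx1, hx1', hxy1, hactive⟩ := h.exists_measure_active_le (n := n) hc
    hSG.subgaussian_error hS hK0 h8 hTS hCmin hg1 hC (by linarith) (by linarith) (by linarith)
    hN hn1
  have hn3' : (∫ w, IsIsotropic.centeredForm Q w ^ 2 ∂μ + ∫ e, e ^ 2 ∂η) *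
      (Real.log d * (C * N * (1 + 2 * N))) ≤ lam ^ 2 * n := by
    rw [← errorSD_sq hSG.subgaussian_error, hQdef, ← h.interactionSD_sq, ← hν]
    exact hn3
  obtain ⟨x4, y4, hx4, hxy4, hinactive⟩ := h.exists_measure_inactive_le (n := n) hc
    hSG.subgaussian_error hQ hQT
    (f := fun j => a j - ∑ i ∈ S, (inner ℝ (a j) (g i) : ℝ) • a i) hS hTS
    (fun j _ l hl => residual_apply_eq_zero hα hreg (a j) hl) hB0
    (fun j _ => (norm_regression_residual_sq_le hreg (a j)).trans ((ha j).trans hBdef.ge))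
    hlam hγ hCmin hC hN (by linarith) (by linarith) (by linarith) (by linarith) hn hn2 hn3'
  rw [hQdef] at hactive hinactive
  refine (measure_not_lassoSucceeds_le hn hSG hlam hCmin hγ hSdef h hν haT hα hdual hspan hg
    (fun j hj => (hmax j hj).trans hC1) hx1 hx1' hx4 hxy4 hxy1).trans
    ((add_le_add hinactive hactive).trans ?_)
  have hN0 : 0 < N := by linarith
  rw [← ENNReal.ofReal_add (by positivity) (by positivity),
    ← ENNReal.ofReal_add (by positivity) (by positivity),
    ← ENNReal.ofReal_add (by positivity) (by positivity),
    ← ENNReal.ofReal_add (by positivity) (by positivity),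
    ← ENNReal.ofReal_add (by positivity) (by positivity),
    ← ENNReal.ofReal_add (by positivity) (by positivity),
    ← ENNReal.ofReal_add (by positivity) (by positivity),
    ← ENNReal.ofReal_add (by positivity) (by positivity)]
  exact ENNReal.ofReal_le_ofReal (le_of_eq (by ring))

/-! ### Asymptotics -/

/-- For `s ≥ 2` one has `√(log s) ≥ 1 / 2`; the summand `1` covers `s = 1`, where the logarithm
vanishes. -/
theorem cube_le_eight_mul_add_one {s : ℕ} (hs : 1 ≤ s) :
    (s : ℝ) ^ 3 ≤ 8 * ((s : ℝ) * √(Real.log s)) ^ 3 + 1 := by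
  rcases hs.eq_or_lt with rfl | h2
  · norm_num
  · have h1 : (2 : ℝ) ≤ s := by exact_mod_cast h2
    have h3 : Real.log 2 ≤ Real.log s := Real.log_le_log (by norm_num) h1
    have h4 : (1 / 2 : ℝ) ≤ √(Real.log s) := by
      refine Real.le_sqrt_of_sq_le ?_
      linarith [Real.log_two_gt_d9]
    have h5 : (1 / 2 : ℝ) ^ 3 ≤ √(Real.log s) ^ 3 := by gcongr
    have h6 : (0 : ℝ) ≤ (s : ℝ) ^ 3 := by positivity
    rw [mul_pow]
    nlinarith

theorem cube_mul_log_le {s : ℕ} (hs : 1 ≤ s) :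
    (s : ℝ) ^ 3 * Real.log s ≤ (s : ℝ) ^ 3 + ((s : ℝ) * √(Real.log s)) ^ 3 := by
  have h0 : 0 ≤ Real.log s := Real.log_nonneg (by exact_mod_cast hs)
  have h6 : (0 : ℝ) ≤ (s : ℝ) ^ 3 := by positivity
  have h1 : Real.log s ≤ 1 + √(Real.log s) ^ 3 := by
    set r := √(Real.log s)
    have hr : 0 ≤ r := Real.sqrt_nonneg _
    have h2 : Real.log s = r ^ 2 := (Real.sq_sqrt h0).symm
    rw [h2]
    rcases le_total r 1 with h | h
    · nlinarith [pow_nonneg hr 3]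
    · nlinarith [mul_nonneg (sq_nonneg r) (sub_nonneg.2 h)]
  calc (s : ℝ) ^ 3 * Real.log s ≤ (s : ℝ) ^ 3 * (1 + √(Real.log s) ^ 3) := by gcongr
    _ = _ := by ring

/-- Cubing the sparsity condition gives `s³ (log s)^{3/2} = o(n)`, which is stronger than both
conclusions except for bounded `s`, where the additional constant intervenes. -/
theorem isLittleO_cube {s : ℕ → ℕ} (hs : ∀ n, 1 ≤ s n)
    (h : (fun n => (s n : ℝ) * √(Real.log (s n))) =o[atTop] fun n : ℕ => (n : ℝ) ^ (1 / 3 : ℝ)) :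
    (fun n => (s n : ℝ) ^ 3) =o[atTop] (fun n : ℕ => (n : ℝ)) ∧
      (fun n => (s n : ℝ) ^ 3 * Real.log (s n)) =o[atTop] (fun n : ℕ => (n : ℝ)) := by
  have h3 : (fun n => ((s n : ℝ) * √(Real.log (s n))) ^ 3) =o[atTop] (fun n : ℕ => (n : ℝ)) := by
    refine (h.pow (n := 3) (by norm_num)).congr_right fun n => ?_
    rw [← Real.rpow_natCast, ← Real.rpow_mul (by positivity)]
    norm_num
  have h1 : (fun _ : ℕ => (1 : ℝ)) =o[atTop] (fun n : ℕ => (n : ℝ)) :=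
    isLittleO_const_left.2 (Or.inr (tendsto_norm_atTop_atTop.comp tendsto_natCast_atTop_atTop))
  have h4 : (fun n => (s n : ℝ) ^ 3) =o[atTop] (fun n : ℕ => (n : ℝ)) := by
    refine (IsBigO.of_bound' (Eventually.of_forall fun n => ?_)).trans_isLittleO
      ((h3.const_mul_left 8).add h1)
    rw [Real.norm_of_nonneg (by positivity), Real.norm_of_nonneg (by positivity)]
    exact cube_le_eight_mul_add_one (hs n)
  refine ⟨h4, (IsBigO.of_bound' (Eventually.of_forall fun n => ?_)).trans_isLittleO (h4.add h3)⟩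
  have := Real.log_nonneg (x := s n) (by exact_mod_cast hs n)
  rw [Real.norm_of_nonneg (by positivity), Real.norm_of_nonneg (by positivity)]
  exact cube_mul_log_le (hs n)

/-- Half of the exponent absorbs the factor `s`, and the other half is converted into a rate by `exp
(-x) ≤ 1 / x`. -/
theorem mul_exp_neg_le {s C n : ℝ} (hs : 1 ≤ s) (hC : 0 < C) (hn : 0 < n)
    (h : 2 * C * (s ^ 3 * Real.log s) ≤ n) :
    s * Real.exp (-(n / (C * s ^ 3))) ≤ 2 * C * (s ^ 3 / n) := by
  have hs0 : 0 < s := by linarith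
  have hX : 0 < n / (2 * C * s ^ 3) := by positivity
  have h1 : Real.log s ≤ n / (2 * C * s ^ 3) := by
    rw [le_div_iff₀ (by positivity)]; linarith
  have h2 : n / (C * s ^ 3) = n / (2 * C * s ^ 3) + n / (2 * C * s ^ 3) := by field_simp; norm_num
  have h3 : Real.exp (-(n / (2 * C * s ^ 3))) ≤ (n / (2 * C * s ^ 3))⁻¹ := by
    rw [Real.exp_neg]
    exact inv_anti₀ hX (by linarith [Real.add_one_le_exp (n / (2 * C * s ^ 3))])
  calc s * Real.exp (-(n / (C * s ^ 3)))
      = Real.exp (Real.log s - n / (2 * C * s ^ 3)) * Real.exp (-(n / (2 * C * s ^ 3))) := by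
        rw [← Real.exp_add, h2, show Real.log s - n / (2 * C * s ^ 3) + -(n / (2 * C * s ^ 3)) =
          Real.log s + -(n / (2 * C * s ^ 3) + n / (2 * C * s ^ 3)) by ring, Real.exp_add,
          Real.exp_log hs0]
    _ ≤ 1 * (n / (2 * C * s ^ 3))⁻¹ := by
        gcongr
        exact Real.exp_le_one_iff.2 (by linarith)
    _ = _ := by field_simp

/-- The exponentials in `N` contribute at most `3 / N`, and the terms depending on `s³ / n` together
at most `6 C s³ / n ≤ 1 / N`. -/
theorem failure_bound_le {C N s n : ℝ} (hC : 1 ≤ C) (hN : 1 ≤ N) (hs : 1 ≤ s) (hn : 0 < n)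
    (h1 : 10 * (C * N * (3 + N)) * s ^ 3 ≤ n)
    (h2 : 10 * (C * N * (3 + N)) * (s ^ 3 * Real.log s) ≤ n) :
    4 / N + 3 * Real.exp (-N) + ((C + 1) * (s ^ 3 / n) +
      2 * s * Real.exp (-(n / (C * s ^ 3)))) ≤ 8 / N := by
  have hC0 : 0 < C := by linarith
  have hN0 : 0 < N := by linarith
  have hlog : 0 ≤ Real.log s := Real.log_nonneg hs
  have hs3 : 0 < s ^ 3 := by positivity
  have hCN : C ≤ C * N * (3 + N) := by
    rw [mul_assoc]
    exact le_mul_of_one_le_right hC0.le (by nlinarith)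
  have hCN' : C * N ≤ C * N * (3 + N) := le_mul_of_one_le_right (by positivity) (by linarith)
  have h3 := mul_exp_neg_le hs hC0 hn (by
    have := mul_le_mul_of_nonneg_right hCN (mul_nonneg hs3.le hlog)
    have := mul_nonneg hs3.le hlog
    nlinarith)
  have h4 : Real.exp (-N) ≤ 1 / N := by
    rw [Real.exp_neg, one_div]
    exact inv_anti₀ hN0 (by linarith [Real.add_one_le_exp N])
  have h5 : 6 * C * (s ^ 3 / n) ≤ 1 / N := by
    rw [← mul_div_assoc, div_le_div_iff₀ hn hN0]
    have := mul_le_mul_of_nonneg_right hCN' hs3.le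
    have : 0 ≤ C * N * s ^ 3 := by positivity
    nlinarith
  have h6 : 0 ≤ s ^ 3 / n := by positivity
  have h7 : (C + 1) * (s ^ 3 / n) ≤ 2 * C * (s ^ 3 / n) := by gcongr; linarith
  have h8 : 8 / N = 4 / N + 3 * (1 / N) + 1 / N := by ring
  rw [h8]
  linarith

theorem IsLittleO.eventually_mul_le {f g : ℕ → ℝ} (h : f =o[atTop] g) (hg : ∀ n, 0 ≤ g n) {A : ℝ}
    (hA : 0 < A) : ∀ᶠ n in atTop, A * f n ≤ g n := by
  filter_upwards [h.bound (inv_pos.2 hA)] with n hn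
  rw [Real.norm_of_nonneg (hg n)] at hn
  have := (le_abs_self _).trans hn
  rwa [le_inv_mul_iff₀ hA] at this

theorem isLittleO_variance_sum {τ σ lam L : ℕ → ℝ} (hL : ∀ n, 0 ≤ L n)
    (hτ : (fun n => τ n * √(L n / n)) =o[atTop] lam)
    (hσ : (fun n => σ n * √(L n / n)) =o[atTop] lam) :
    (fun n => (τ n ^ 2 + σ n ^ 2) * (L n / n)) =o[atTop] fun n => lam n ^ 2 := by
  refine ((hτ.pow (n := 2) (by norm_num)).add (hσ.pow (n := 2) (by norm_num))).congr_left
    fun n => ?_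
  rw [mul_pow, mul_pow, Real.sq_sqrt (div_nonneg (hL n) n.cast_nonneg)]
  ring

/-- Only subadditivity is used to pass to the complement, since the events need not be measurable.
-/
theorem tendsto_measure_one {Ω : ℕ → Type*} [∀ n, MeasurableSpace (Ω n)] (P : ∀ n, Measure (Ω n))
    [∀ n, IsProbabilityMeasure (P n)] {q : ∀ n, Ω n → Prop}
    (h : ∀ N : ℝ, 1 ≤ N → ∀ᶠ n in atTop, P n {ω | ¬ q n ω} ≤ ENNReal.ofReal (8 / N)) :
    Tendsto (fun n => P n {ω | q n ω}) atTop (𝓝 1) := by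
  have h0 : Tendsto (fun n => P n {ω | ¬ q n ω}) atTop (𝓝 0) := by
    rw [ENNReal.tendsto_nhds_zero]
    intro δ hδ
    have h1 : Tendsto (fun N : ℝ => ENNReal.ofReal (8 / N)) atTop (𝓝 0) := by
      rw [← ENNReal.ofReal_zero]
      exact ENNReal.tendsto_ofReal (tendsto_const_nhds.div_atTop tendsto_id)
    obtain ⟨N, hN, hN1⟩ := (((ENNReal.tendsto_nhds_zero.1 h1) δ hδ).and
      (eventually_ge_atTop 1)).exists
    exact (h N hN1).mono fun n hn => hn.trans hN
  have h2 : Tendsto (fun n => 1 - P n {ω | ¬ q n ω}) atTop (𝓝 1) := by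
    simpa using ENNReal.Tendsto.sub tendsto_const_nhds h0 (Or.inl ENNReal.one_ne_top)
  refine tendsto_of_tendsto_of_tendsto_of_le_of_le h2 tendsto_const_nhds (fun n => ?_)
    fun n => prob_le_one
  rw [tsub_le_iff_right, ← measure_univ (μ := P n)]
  refine (measure_mono fun ω _ => ?_).trans (measure_union_le _ _)
  by_cases hω : q n ω
  · exact Or.inl hω
  · exact Or.inr hω

/-- The terms without `L` are dominated by `s³` and the remaining one is `s L`, so the two parts of
the sparsity condition each pay for their share. -/
theorem sparsity_requirement {C N s n L : ℝ} (hC : 1 ≤ C) (hN : 1 ≤ N) (hs : 1 ≤ s) (hL : 0 ≤ L)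
    (h1 : 10 * (C * N * (3 + N)) * s ^ 3 ≤ n) (h3 : 10 * (C * N * (3 + N)) * (s * L) ≤ n) :
    C * (s + 1 + L + N) * s ≤ n := by
  have hC0 : 0 < C := by linarith
  have hCN : C * (3 + N) ≤ C * N * (3 + N) := by
    rw [mul_assoc]
    exact mul_le_mul_of_nonneg_left (le_mul_of_one_le_left (by linarith) hN) hC0.le
  have e1 : C ≤ C * (3 + N) := le_mul_of_one_le_right hC0.le (by linarith)
  have hs2 : s ≤ s ^ 2 := by nlinarith
  have hs3 : s ^ 2 ≤ s ^ 3 := by nlinarith [sq_nonneg s]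
  have e2 : C * (s + 1 + N) * s ≤ C * (3 + N) * s ^ 3 := by
    have : (s + 1 + N) * s ≤ (3 + N) * s ^ 3 := by nlinarith
    nlinarith
  have e3 : C * (3 + N) * s ^ 3 ≤ C * N * (3 + N) * s ^ 3 := by gcongr
  have e4 : C * (s * L) ≤ C * N * (3 + N) * (s * L) := by
    have : 0 ≤ s * L := by positivity
    gcongr
    linarith
  have e5 : 0 ≤ C * N * (3 + N) * s ^ 3 := by positivity
  have e6 : 0 ≤ C * N * (3 + N) * (s * L) := by positivity
  nlinarith

theorem variance_requirement {C N V L : ℝ} (hC : 1 ≤ C) (hN : 1 ≤ N) (hV : 0 ≤ V) (hL : 0 ≤ L) :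
    V * (L * (C * N * (1 + 2 * N))) ≤ 10 * (C * N * (3 + N)) * (V * L) := by
  have h : C * N * (1 + 2 * N) ≤ 10 * (C * N * (3 + N)) := by
    have : 0 ≤ C * N := by positivity
    nlinarith
  calc V * (L * (C * N * (1 + 2 * N))) = C * N * (1 + 2 * N) * (V * L) := by ring
    _ ≤ _ := by gcongr

end QuadLasso

end

/-! ### The asymptotic statement. -/

theorem theorem2
    -- dimension, intercept, main effects, second order effects, tuning parameter, along `n`
    (p : ℕ → ℕ) (β₀ : ℕ → ℝ) (β : ∀ n, Fin (p n) → ℝ) (βI : ∀ n, Sym2 (Fin (p n)) → ℝ)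
    (lam : ℕ → ℝ)
    -- law of one covariate vector, law of one error, probability space, covariates, errors
    (ν : ∀ n, Measure (Fin (p n) → ℝ)) (η : ℕ → Measure ℝ)
    {Ω : ℕ → Type*} [∀ n, MeasurableSpace (Ω n)]
    (P : ∀ n, Measure (Ω n)) [∀ n, IsProbabilityMeasure (P n)]
    (x : ∀ n, Fin n → Ω n → Fin (p n) → ℝ) (ε : ∀ n, Fin n → Ω n → ℝ)
    -- constants that do not depend on `n`
    (b : ℝ≥0) (γ Cmin CB : ℝ) (hb : 0 < b) (hγ0 : 0 < γ) (hγ1 : γ ≤ 1)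
    (hCmin : 0 < Cmin) (hCB : 0 < CB)
    (hS : ∀ n, (QuadLasso.support (β n) (βI n)).Nonempty)
    (hSG : ∀ n, QuadLasso.ConditionSG b (P n) (ν n) (η n) (x n) (ε n))
    -- irrepresentable condition
    (hC1 : ∀ n, QuadLasso.maxRowSum
      (QuadLasso.blockScS (QuadLasso.covMatrix (ν n)) (QuadLasso.support (β n) (βI n)) *
        (QuadLasso.blockSS (QuadLasso.covMatrix (ν n)) (QuadLasso.support (β n) (βI n)))⁻¹)
        ≤ 1 - γ)
    -- eigenvalue condition
    (hC2 : ∀ n, ∀ μ ∈ spectrum ℝ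
      (QuadLasso.blockSS (QuadLasso.covMatrix (ν n)) (QuadLasso.support (β n) (βI n))), Cmin ≤ μ)
    -- dimensionality and sparsity
    (hC3 : (fun n => ((QuadLasso.support (β n) (βI n)).card : ℝ) * Real.log (p n))
      =o[atTop] fun n => (n : ℝ))
    (hC3' : (fun n => ((QuadLasso.support (β n) (βI n)).card : ℝ) *
        √(Real.log (QuadLasso.support (β n) (βI n)).card))
      =o[atTop] fun n => (n : ℝ) ^ (1 / 3 : ℝ))
    -- coefficient matrix
    (hC4 : ∀ n, ∀ μ ∈ spectrum ℝ (QuadLasso.coefMatrix (βI n) * QuadLasso.coefMatrix (βI n)),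
      μ ≤ CB ^ 2)
    -- the tuning parameter dominates `τ (log p / n)^{1/2}`, and also `σ (log p / n)^{1/2}`
    (hlam_pos : ∀ n, 0 < lam n)
    (hlam_tau : (fun n => QuadLasso.interactionSD (ν n) (βI n) * √(Real.log (p n) / n))
      =o[atTop] lam)
    (hlam_sigma : (fun n => QuadLasso.errorSD (η n) * √(Real.log (p n) / n)) =o[atTop] lam) :
    Tendsto (fun n => P n {ω | QuadLasso.LassoSucceeds (β n) (βI n) (lam n) Cmin
      (fun i => QuadLasso.response (ν n) (β₀ n) (β n) (βI n) (x n i ω) (ε n i ω))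
      (fun i => x n i ω)}) atTop (𝓝 1) := by
  obtain ⟨C, hC, hfail⟩ := QuadLasso.exists_measure_not_lassoSucceeds_le hb hγ0 hCmin hCB
  have hs : ∀ n, 1 ≤ (QuadLasso.support (β n) (βI n)).card := fun n => (hS n).card_pos
  obtain ⟨hcube, hcubelog⟩ := QuadLasso.isLittleO_cube hs hC3'
  have hL : ∀ n, 0 ≤ Real.log (p n) := fun n => Real.log_natCast_nonneg _
  have hvar := QuadLasso.isLittleO_variance_sum hL hlam_tau hlam_sigma
  refine QuadLasso.tendsto_measure_one P fun N hN => ?_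
  have hN0 : 0 < N := by linarith
  have hC0 : 0 < C := by linarith
  -- One multiplier large enough for every finite-sample requirement, so each asymptotic condition
  -- is invoked exactly once for a given `N`.
  have hA : 0 < 10 * (C * N * (3 + N)) := by positivity
  filter_upwards [QuadLasso.IsLittleO.eventually_mul_le hcube (fun n => n.cast_nonneg) hA,
    QuadLasso.IsLittleO.eventually_mul_le hcubelog (fun n => n.cast_nonneg) hA,
    QuadLasso.IsLittleO.eventually_mul_le hC3 (fun n => n.cast_nonneg) hA,
    QuadLasso.IsLittleO.eventually_mul_le hvar (fun n => sq_nonneg _) hA,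
    eventually_gt_atTop 0] with n h1 h2 h3 h4 hn
  have hs1 : (1 : ℝ) ≤ (QuadLasso.support (β n) (βI n)).card := by exact_mod_cast hs n
  have hn0 : (0 : ℝ) < n := by exact_mod_cast hn
  refine (hfail hn.ne' (hSG n) (hlam_pos n) hN (hS n) (hC1 n) (hC2 n) (hC4 n)
    ?_ ?_ ?_).trans (ENNReal.ofReal_le_ofReal (QuadLasso.failure_bound_le hC hN hs1 hn0 h1 h2))
  · refine le_trans (mul_le_mul_of_nonneg_right ?_ (by positivity)) h1
    nlinarith [mul_pos hC0 hN0]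
  · exact QuadLasso.sparsity_requirement hC hN hs1 (hL n) h1 h3
  · rw [mul_div_assoc', mul_div_assoc', div_le_iff₀ hn0] at h4
    refine le_trans ?_ h4
    exact QuadLasso.variance_requirement hC hN (by positivity) (hL n)
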